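/- Let $V$ be a smooth manifold of dimension $2n$, with local coordinates $u=(u^\alpha)=(x^i,y^{n+i})$, $1\le i\le n$, on the domain $U$ of an arbitrary chart, and let $\mathcal L$ be a smooth real function on $U$ (an effective regular Lagrangian) such that the matrix $$\check h_{n+i\,n+j}=\check g_{ij}=\tfrac12\,\frac{\partial^2\mathcal L}{\partial y^i\partial y^j}$$ is nondegenerate on $U$ (of any signature); $y^i$ means $y^{n+i}$, and repeated indices are summed. Over $U$ put: * $G^i=\frac14\check g^{ij}\big(\frac{\partial^2\mathcal L}{\partial y^j\partial x^k}y^k-\frac{\partial\mathcal L}{\partial x^j}\big)$ and $\check N_i^{n+a}=\partial G^a/\partial y^i$; the adapted frame $\check e_i=\partial_{x^i}-\check N_i^{n+a}\partial_{y^{a}}$, $\check e_{n+a}=\partial_{y^a}$, with dual coframe $\check e^i=dx^i$, $\check e^{n+a}=dy^a+\check N^{n+a}_i dx^i$; the metric $\check g=\check g_{ij}\check e^i\otimes\check e^j+\check h_{ab}\check e^a\otimes\check e^b$; $\check J\check e_i=-\check e_{n+i}$, $\check J\check e_{n+i}=\check e_i$; $\check\theta(X,Y)=\check g(\check JX,Y)$;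 $\check\theta^{\alpha\beta}=\check g^{\alpha\gamma}\check g^{\beta\delta}\check\theta_{\gamma\delta}$ and $\check\Lambda^{\alpha\beta}=\check\theta^{\alpha\beta}-i\check g^{\alpha\beta}$. * The normal d-connection $\widehat{\mathbf D}$, with $\widehat{\mathbf D}_{\check e_\alpha}\check e_\beta=\widehat\Gamma^\gamma_{\beta\alpha}\check e_\gamma$, whose nonzero coefficients are $\widehat\Gamma^i_{jk}=\widehat\Gamma^{n+i}_{n+j\,k}=\widehat L^i_{jk}=\frac12\check g^{ih}(\check e_k\check g_{jh}+\check e_j\check g_{hk}-\check e_h\check g_{jk})$ and $\widehat\Gamma^i_{j\,n+k}=\widehat\Gamma^{n+i}_{n+j\,n+k}=\widehat C^i_{jk}=\frac12\check g^{ih}(\partial_{y^k}\check g_{jh}+\partial_{y^j}\check g_{hk}-\partial_{y^h}\check g_{jk})$; its torsion $\widehat{\mathbf T}(X,Y)=\widehat{\mathbf D}_XY-\widehat{\mathbf D}_YX-[X,Y]$ and curvature $\widehat{\mathbf R}(X,Y)Z=\widehat{\mathbf D}_X\widehat{\mathbf D}_YZ-\widehat{\mathbf D}_Y\widehat{\mathbf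 D}_XZ-\widehat{\mathbf D}_{[X,Y]}Z$, with coefficients in the index order $\widehat{\mathbf T}(\check e_\beta,\check e_\alpha)=\widehat{\mathbf T}^\tau_{\alpha\beta}\check e_\tau$ and $\widehat{\mathbf R}(\check e_\beta,\check e_\alpha)\check e_\varphi=\widehat{\mathbf R}^\tau_{\ \varphi\alpha\beta}\check e_\tau$. * $\check{\mathcal W}\otimes\Lambda$: the differential forms on $U$ whose coefficients are formal series $\sum_{r,m}a_{r,m}(u)z^m v^r$ in a formal parameter $v$ and fibre coordinates $z^\alpha$, with smooth complex-valued $a_{r,m}$. Its product $\circ$ is the formal Wick product $$a\circ b\,(z)=\exp\Big(\frac{iv}2\check\Lambda^{\alpha\beta}\frac{\partial^2}{\partial z^\alpha\partial z_{[1]}^\beta}\Big)a(z)\,b(z_{[1]})\Big|_{z=z_{[1]}}$$ on coefficients and the exterior product on forms; $\deg_a$ is the form degree, and $\mathrm{ad}_{Wick}(a)$ is the $\deg_a$-graded commutator with $a$ for $\circ$. * The operators on $\check{\mathcal W}\otimes\Lambda$, both of $\deg_a$-degree $1$, $$\widehat{\mathbf D}(a\otimes\lambda)=\Big(\check e_\alpha(a)-z^\beta\,\widehat\Gamma^\gamma_{\beta\alpha}\,\frac{\partial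 a}{\partial z^\gamma}\Big)\otimes(\check e^\alpha\wedge\lambda)+a\otimes d\lambda,\qquad \check\delta(a)=\check e^\alpha\wedge\frac{\partial a}{\partial z^\alpha}.$$ * The torsion and curvature elements $${}^z\widehat{\mathcal T}=\frac{z^\gamma}2\check\theta_{\gamma\tau}\widehat{\mathbf T}^\tau_{\alpha\beta}\,\check e^\alpha\wedge\check e^\beta,\qquad {}^z\widehat{\mathcal R}=\frac{z^\gamma z^\varphi}4\check\theta_{\gamma\tau}\widehat{\mathbf R}^\tau_{\ \varphi\alpha\beta}\,\check e^\alpha\wedge\check e^\beta .$$ **Theorem.** $\widehat{\mathbf D}$ and $\check\delta$ map $\check{\mathcal W}\otimes\Lambda$ to itself, ${}^z\widehat{\mathcal T}$ and ${}^z\widehat{\mathcal R}$ are elements of $\check{\mathcal W}\otimes\Lambda$, and $$[\widehat{\mathbf D},\check\delta]=\frac iv\,\mathrm{ad}_{Wick}({}^z\widehat{\mathcal T}),\qquad \widehat{\mathbf D}^2=-\frac iv\,\mathrm{ad}_{Wick}({}^z\widehat{\mathcal R}),$$ where $[\cdot,\cdot]$ is the $\deg_a$-graded commutator of endomorphisms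 of $\check{\mathcal W}\otimes\Lambda$. (Division by $v$ means: $v$ times the left side equals $\pm i\,\mathrm{ad}_{Wick}(\cdot)$; multiplication by $v$ is injective.) -/

import Mathlib

open scoped ContDiff Manifold

noncomputable section

namespace LagrangeFedosov

/-! ### Coordinates, effective Lagrangian, N-connection, adapted frames -/

/-- Indices `α = (i, a)`: `Sum.inl i` is the horizontal index `i`, and `Sum.inr i` is the vertical
index `n + i`. -/
abbrev Idx (n : ℕ) := Fin n ⊕ Fin n

/-- The coordinate space of points `u = (x, y)`: `u (Sum.inl i) = x^i`, `u (Sum.inr i) = y^{n+i}`. -/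
abbrev Coord (n : ℕ) := Idx n → ℝ

/-- The position of an index in `1, …, n, n+1, …, 2n` (counted from `0`). -/
def Idx.pos {n : ℕ} : Idx n → ℕ
  | Sum.inl i => i
  | Sum.inr i => n + i

/-- The coordinate vector field `∂ / ∂u^α`. -/
def coordVec {n : ℕ} (α : Idx n) : Coord n := Pi.single α 1

/-- The partial derivative `∂f / ∂u^α`. -/
def pd {n : ℕ} (α : Idx n) (f : Coord n → ℝ) (u : Coord n) : ℝ := fderiv ℝ f u (coordVec α)

/-- `h_{ab} = (1/2) ∂²L / ∂y^a ∂y^b`; the same matrix is `g_{ij} = h_{n+i n+j}`. -/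
def vHessian {n : ℕ} (L : Coord n → ℝ) (u : Coord n) : Matrix (Fin n) (Fin n) ℝ :=
  Matrix.of fun i j => (1 / 2) * pd (Sum.inr i) (pd (Sum.inr j) L) u

/-- The semispray coefficients `G^i`, where
`2 G^i = (1/2) h^{ij} (∂²L / ∂y^j ∂x^k y^k - ∂L / ∂x^j)`. -/
def semispray {n : ℕ} (L : Coord n → ℝ) (i : Fin n) (u : Coord n) : ℝ :=
  (1 / 4) * ∑ j, (vHessian L u)⁻¹ i j *
    ((∑ k, pd (Sum.inr j) (pd (Sum.inl k) L) u * u (Sum.inr k)) - pd (Sum.inl j) L u)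

/-- The canonical N-connection coefficients `N_i^{n+a} = ∂G^a / ∂y^i`, as `nConn L a i`. -/
def nConn {n : ℕ} (L : Coord n → ℝ) (a i : Fin n) (u : Coord n) : ℝ :=
  pd (Sum.inr i) (semispray L a) u

/-- The N-adapted frame `e_i = ∂/∂x^i - N_i^a ∂/∂y^a`, `e_a = ∂/∂y^a`. -/
def frame {n : ℕ} (L : Coord n → ℝ) : Idx n → Coord n → Coord n
  | Sum.inl i => fun u => coordVec (Sum.inl i) - ∑ a, nConn L a i u • coordVec (Sum.inr a)
  | Sum.inr a => fun _ => coordVec (Sum.inr a)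

/-- The dual coframe `e^i = dx^i`, `e^a = dy^a + N_i^a dx^i`: the value of `e^α` at `u` on `w`. -/
def coframe {n : ℕ} (L : Coord n → ℝ) (α : Idx n) (u w : Coord n) : ℝ :=
  match α with
  | Sum.inl i => w (Sum.inl i)
  | Sum.inr a => w (Sum.inr a) + ∑ i, nConn L a i u * w (Sum.inl i)

/-- The derivative `e_α(f)` of a function along the adapted frame. -/
def frameD {n : ℕ} {F : Type*} [NormedAddCommGroup F] [NormedSpace ℝ F]
    (L : Coord n → ℝ) (α : Idx n) (f : Coord n → F) (u : Coord n) : F :=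
  fderiv ℝ f u (frame L α u)

/-! ### Metric, almost complex structure, almost symplectic form (components in the frame) -/

/-- `g = g_{ij} e^i ⊗ e^j + h_{ab} e^a ⊗ e^b`. -/
def metric {n : ℕ} (L : Coord n → ℝ) (u : Coord n) : Matrix (Idx n) (Idx n) ℝ :=
  Matrix.fromBlocks (vHessian L u) 0 0 (vHessian L u)

/-- The inverse metric `g^{αβ}`. -/
def invMetric {n : ℕ} (L : Coord n → ℝ) (u : Coord n) : Matrix (Idx n) (Idx n) ℝ :=
  (metric L u)⁻¹

/-- The almost complex structure `J(e_i) = -e_{n+i}`, `J(e_{n+i}) = e_i`; the entry `(α, β)` is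
`J^α_β`, where `J(e_β) = J^α_β e_α`. -/
def almostComplex (n : ℕ) : Matrix (Idx n) (Idx n) ℝ :=
  Matrix.fromBlocks 0 1 (-1) 0

/-- `θ(X, Y) = g(J X, Y)`, so `θ_{αβ} = J^γ_α g_{γβ}`. -/
def theta {n : ℕ} (L : Coord n → ℝ) (u : Coord n) (α β : Idx n) : ℝ :=
  ∑ γ, almostComplex n γ α * metric L u γ β

/-- `θ` with indices raised by the metric: `θ^{αβ} = g^{αγ} g^{βδ} θ_{γδ}`. -/
def thetaUp {n : ℕ} (L : Coord n → ℝ) (u : Coord n) (α β : Idx n) : ℝ :=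
  ∑ γ, ∑ δ, invMetric L u α γ * invMetric L u β δ * theta L u γ δ

/-- `Λ^{αβ} = θ^{αβ} - i g^{αβ}`. -/
def wickTensor {n : ℕ} (L : Coord n → ℝ) (u : Coord n) (α β : Idx n) : ℂ :=
  (thetaUp L u α β : ℂ) - Complex.I * (invMetric L u α β : ℂ)

/-! ### The normal d-connection, its torsion and curvature -/

/-- `L^i_{jk} = (1/2) g^{ih} (e_k g_{jh} + e_j g_{hk} - e_h g_{jk})`. -/
def hCoef {n : ℕ} (L : Coord n → ℝ) (i j k : Fin n) (u : Coord n) : ℝ :=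
  (1 / 2) * ∑ h, (vHessian L u)⁻¹ i h *
    (frameD L (Sum.inl k) (fun w => vHessian L w j h) u
      + frameD L (Sum.inl j) (fun w => vHessian L w h k) u
      - frameD L (Sum.inl h) (fun w => vHessian L w j k) u)

/-- `C^i_{jk} = (1/2) g^{ih} (∂g_{jh}/∂y^k + ∂g_{hk}/∂y^j - ∂g_{jk}/∂y^h)`. -/
def vCoef {n : ℕ} (L : Coord n → ℝ) (i j k : Fin n) (u : Coord n) : ℝ :=
  (1 / 2) * ∑ h, (vHessian L u)⁻¹ i h *
    (pd (Sum.inr k) (fun w => vHessian L w j h) u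
      + pd (Sum.inr j) (fun w => vHessian L w h k) u
      - pd (Sum.inr h) (fun w => vHessian L w j k) u)

/-- The coefficients `Γ^γ_{βα}` of the normal d-connection, as `normalConn L γ β α`, with
`D_{e_α} e_β = Γ^γ_{βα} e_γ`: the last index is the direction of differentiation. -/
def normalConn {n : ℕ} (L : Coord n → ℝ) (γ β α : Idx n) (u : Coord n) : ℝ :=
  match γ, β, α with
  | Sum.inl i, Sum.inl j, Sum.inl k => hCoef L i j k u
  | Sum.inl i, Sum.inl j, Sum.inr k => vCoef L i j k u
  | Sum.inr i, Sum.inr j, Sum.inl k => hCoef L i j k u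
  | Sum.inr i, Sum.inr j, Sum.inr k => vCoef L i j k u
  | Sum.inl _, Sum.inr _, _ => 0
  | Sum.inr _, Sum.inl _, _ => 0

/-- The covariant derivative `D_X Y` of vector fields. -/
def covD {n : ℕ} (L : Coord n → ℝ) (X Y : Coord n → Coord n) (u : Coord n) : Coord n :=
  ∑ γ, (∑ α, coframe L α u (X u) *
      (frameD L α (fun w => coframe L γ w (Y w)) u
        + ∑ β, normalConn L γ β α u * coframe L β u (Y u))) • frame L γ u

/-- The torsion `T(X, Y) = D_X Y - D_Y X - [X, Y]`. -/
def torsion {n : ℕ} (L : Coord n → ℝ) (X Y : Coord n → Coord n) (u : Coord n) : Coord n :=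
  covD L X Y u - covD L Y X u - VectorField.lieBracket ℝ X Y u

/-- The curvature `R(X, Y) Z = D_X D_Y Z - D_Y D_X Z - D_{[X, Y]} Z`. -/
def curvature {n : ℕ} (L : Coord n → ℝ) (X Y Z : Coord n → Coord n) (u : Coord n) : Coord n :=
  covD L X (covD L Y Z) u - covD L Y (covD L X Z) u - covD L (VectorField.lieBracket ℝ X Y) Z u

/-- The coefficients `T^τ_{αβ}`, in the index order `T(e_β, e_α) = T^τ_{αβ} e_τ`. In this order
`T^i_{jc} = C^i_{jc}`, `T^a_{ij} = Ω^a_{ij}` and `T^a_{ib} = ∂N_i^a/∂y^b - L^a_{bi}`. -/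
def torsionCoef {n : ℕ} (L : Coord n → ℝ) (τ α β : Idx n) (u : Coord n) : ℝ :=
  coframe L τ u (torsion L (frame L β) (frame L α) u)

/-- The coefficients `R^τ_{φαβ}`, in the index order `R(e_β, e_α) e_φ = R^τ_{φαβ} e_τ`. In this
order `R^i_{hjk} = e_k L^i_{hj} - e_j L^i_{hk} + ⋯`. -/
def curvatureCoef {n : ℕ} (L : Coord n → ℝ) (τ φ α β : Idx n) (u : Coord n) : ℝ :=
  coframe L τ u (curvature L (frame L β) (frame L α) (frame L φ) u)

/-! ### The formal Wick algebra and Wick-algebra-valued forms -/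

/-- The space of formal series `∑ a_{r, m} z^m v^r` underlying the fibre of the Wick algebra bundle;
its ring multiplication is the ordinary commutative one. The inner series are in the fibre
coordinates `z^α`, the outer variable is `v`. -/
abbrev WickFibre (n : ℕ) := PowerSeries (MvPowerSeries (Idx n) ℂ)

/-- The fibre of `W ⊗ Λ`: the element `∑_I a_I ⊗ e^I`, where `e^I = e^{α_1} ∧ ⋯ ∧ e^{α_q}` for
`I = {α_1 < ⋯ < α_q}`, is stored as `I ↦ a_I`. -/
abbrev WickForm (n : ℕ) := Finset (Idx n) → WickFibre n

/-- The sections of `W ⊗ Λ` over `U` in the adapted frame: all coefficients are smooth on `U`. -/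
def sections {n : ℕ} (U : Set (Coord n)) : Set (Coord n → WickForm n) :=
  {a | ∀ (I : Finset (Idx n)) (r : ℕ) (m : Idx n →₀ ℕ),
    ContDiffOn ℝ ∞ (fun u => MvPowerSeries.coeff m (PowerSeries.coeff r (a u I))) U}

/-- The scalar `c` as a formal series. -/
def scalar {n : ℕ} (c : ℂ) : WickFibre n := PowerSeries.C (MvPowerSeries.C c)

/-- The fibre coordinate `z^α`. -/
def zVar {n : ℕ} (α : Idx n) : WickFibre n := PowerSeries.C (MvPowerSeries.X α)

/-- The formal parameter `v`. -/
def vVar (n : ℕ) : WickFibre n := PowerSeries.X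

/-- The operator `∂ / ∂z^α` on formal series in `z` and `v`. -/
def zDeriv {n : ℕ} (α : Idx n) (f : WickFibre n) : WickFibre n :=
  PowerSeries.mk fun r => MvPowerSeries.pderiv ℂ α (PowerSeries.coeff r f)

/-- `(M^{αβ} ∂²/∂z^α ∂z_1^β)^r f(z) g(z_1)` at `z = z_1`. -/
def bidiff {n : ℕ} (M : Idx n → Idx n → ℂ) :
    ℕ → MvPowerSeries (Idx n) ℂ → MvPowerSeries (Idx n) ℂ → MvPowerSeries (Idx n) ℂ
  | 0, f, g => f * g
  | r + 1, f, g =>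
      ∑ α, ∑ β, M α β • bidiff M r (MvPowerSeries.pderiv ℂ α f) (MvPowerSeries.pderiv ℂ β g)

/-- The formal Wick product
`exp((i v / 2) M^{αβ} ∂²/∂z^α ∂z_1^β) a(z) b(z_1)` at `z = z_1`: the coefficient of `v^s` collects
the terms with `r` factors `v` from the exponential, `p` from `a` and `q` from `b`, `r + p + q = s`. -/
def wickMul {n : ℕ} (M : Idx n → Idx n → ℂ) (a b : WickFibre n) : WickFibre n :=
  PowerSeries.mk fun s =>
    ∑ x ∈ Finset.HasAntidiagonal.antidiagonal s,
      ∑ y ∈ Finset.HasAntidiagonal.antidiagonal x.2,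
      ((Complex.I / 2) ^ x.1 / (x.1.factorial : ℂ)) •
        bidiff M x.1 (PowerSeries.coeff y.1 a) (PowerSeries.coeff y.2 b)

/-- For disjoint `I` and `J`, the sign with `e^I ∧ e^J = ± e^{I ∪ J}`: the parity of the number of
pairs of `I × J` in the wrong order. -/
def formSign {n : ℕ} (I J : Finset (Idx n)) : ℤ :=
  (-1) ^ ((I ×ˢ J).filter fun p => p.2.pos < p.1.pos).card

/-- The extension of a bilinear product `m` of coefficients to forms,
`(a ⊗ λ) (b ⊗ μ) = m(a, b) ⊗ (λ ∧ μ)`. -/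
def formMul {n : ℕ} (m : WickFibre n → WickFibre n → WickFibre n) (a b : WickForm n) :
    WickForm n :=
  fun K => ∑ I ∈ K.powerset, formSign I (K \ I) • m (a I) (b (K \ I))

/-- The exterior product of forms with the ordinary product of coefficients. -/
def wedge {n : ℕ} (a b : WickForm n) : WickForm n := formMul (fun f g => f * g) a b

/-- The fibrewise Wick product `a ∘ b` on sections of `W ⊗ Λ`. -/
def wick {n : ℕ} (L : Coord n → ℝ) (a b : Coord n → WickForm n) : Coord n → WickForm n :=
  fun u => formMul (wickMul (wickTensor L u)) (a u) (b u)

/-- The basis form `f ⊗ e^I`. -/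
def monoForm {n : ℕ} (I : Finset (Idx n)) (f : WickFibre n) : WickForm n := Pi.single I f

/-- The coframe element `e^α` as an element of `W ⊗ Λ`. -/
def coframeForm {n : ℕ} (α : Idx n) : WickForm n := monoForm {α} 1

/-- The component of `deg_a`-degree `q`. -/
def degPart {n : ℕ} (q : ℕ) (a : Coord n → WickForm n) : Coord n → WickForm n :=
  fun u I => if I.card = q then a u I else 0

/-- `ad_Wick(a) b`: the `deg_a`-graded commutator of `(W ⊗ Λ, ∘)`, which is
`a ∘ b - (-1)^{pq} b ∘ a` for `a` of degree `p` and `b` of degree `q`. -/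
def adWick {n : ℕ} (L : Coord n → ℝ) (a b : Coord n → WickForm n) : Coord n → WickForm n :=
  ∑ p ∈ Finset.range (2 * n + 1), ∑ q ∈ Finset.range (2 * n + 1),
    (wick L (degPart p a) (degPart q b) - (-1 : ℤ) ^ (p * q) • wick L (degPart q b) (degPart p a))

/-- The `deg_a`-graded commutator of endomorphisms `P`, `Q` of degrees `p`, `q`:
`P Q - (-1)^{pq} Q P`. -/
def opComm {n : ℕ} (p q : ℕ) (P Q : (Coord n → WickForm n) → (Coord n → WickForm n))
    (a : Coord n → WickForm n) : Coord n → WickForm n :=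
  P (Q a) - (-1 : ℤ) ^ (p * q) • Q (P a)

/-! ### The extended connection and the Fedosov operator -/

/-- The derivative `e_α(a)` of a `W`-valued function: all coefficients are differentiated. -/
def fibreFrameD {n : ℕ} (L : Coord n → ℝ) (α : Idx n) (a : Coord n → WickFibre n) (u : Coord n) :
    WickFibre n :=
  PowerSeries.mk fun r => fun m =>
    frameD L α (fun w => MvPowerSeries.coeff m (PowerSeries.coeff r (a w))) u

/-- `e_α(a) - z^β Γ^γ_{βα} ∂a/∂z^γ`. -/
def fibreCovD {n : ℕ} (L : Coord n → ℝ) (α : Idx n) (a : Coord n → WickFibre n) (u : Coord n) :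
    WickFibre n :=
  fibreFrameD L α a u
    - ∑ β, ∑ γ, scalar (normalConn L γ β α u : ℂ) * zVar β * zDeriv γ (a u)

/-- The exterior derivatives `d e^i = d dx^i = 0` and
`d e^a = d(dy^a + N_i^a dx^i) = dN_i^a ∧ e^i = e_α(N_i^a) e^α ∧ e^i`. -/
def dCoframe {n : ℕ} (L : Coord n → ℝ) (μ : Idx n) (u : Coord n) : WickForm n :=
  match μ with
  | Sum.inl _ => 0
  | Sum.inr a => ∑ i, ∑ α, (scalar ((frameD L α (nConn L a i) u : ℝ) : ℂ) : WickFibre n) •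
      wedge (coframeForm α) (coframeForm (Sum.inl i))

/-- `d(e^I)` by the graded Leibniz rule: for `I = {α_1 < ⋯ < α_q}` it is
`∑_s (-1)^{s-1} d e^{α_s} ∧ e^{I ∖ {α_s}}`. -/
def dBasis {n : ℕ} (L : Coord n → ℝ) (I : Finset (Idx n)) (u : Coord n) : WickForm n :=
  ∑ μ ∈ I, (-1 : ℤ) ^ (I.filter fun ν => ν.pos < μ.pos).card •
    wedge (dCoframe L μ u) (monoForm (I.erase μ) 1)

/-- The extension of the normal d-connection to `W ⊗ Λ`,
`D(a ⊗ λ) = (e_α(a) - z^β Γ^γ_{βα} ∂a/∂z^γ) ⊗ (e^α ∧ λ) + a ⊗ dλ`, on `∑_I a_I ⊗ e^I`. -/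
def extD {n : ℕ} (L : Coord n → ℝ) (a : Coord n → WickForm n) : Coord n → WickForm n :=
  fun u => ∑ I, ((∑ α, wedge (coframeForm α) (monoForm I (fibreCovD L α (fun w => a w I) u)))
    + a u I • dBasis L I u)

/-- The Fedosov operator `δ(a) = e^α ∧ ∂a/∂z^α`. -/
def fedosovDelta {n : ℕ} (a : Coord n → WickForm n) : Coord n → WickForm n :=
  fun u => ∑ α, wedge (coframeForm α) (fun I => zDeriv α (a u I))

/-- The torsion element `(z^γ / 2) θ_{γτ} T^τ_{αβ} e^α ∧ e^β`. -/
def torsionElt {n : ℕ} (L : Coord n → ℝ) : Coord n → WickForm n :=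
  fun u => ∑ γ, ∑ τ, ∑ α, ∑ β,
    (scalar ((1 / 2 * theta L u γ τ * torsionCoef L τ α β u : ℝ) : ℂ) * zVar γ) •
      wedge (coframeForm α) (coframeForm β)

/-- The curvature element `(z^γ z^φ / 4) θ_{γτ} R^τ_{φαβ} e^α ∧ e^β`. -/
def curvatureElt {n : ℕ} (L : Coord n → ℝ) : Coord n → WickForm n :=
  fun u => ∑ γ, ∑ φ, ∑ τ, ∑ α, ∑ β,
    (scalar ((1 / 4 * theta L u γ τ * curvatureCoef L τ φ α β u : ℝ) : ℂ) * zVar γ * zVar φ) •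
      wedge (coframeForm α) (coframeForm β)

/-- Multiplication of a section by a fixed formal series. -/
def seriesMul {n : ℕ} (f : WickFibre n) (a : Coord n → WickForm n) : Coord n → WickForm n :=
  fun u I => f * a u I

end LagrangeFedosov

end

/-!
The torsion and curvature elements generate `[D, δ]` and `D²` because `D` is compatible with `θ` and
`g`: this makes the Wick commutators with these polynomials of degree one and two in `z` first-order
operators in `z`, with the torsion and the curvature as coefficients.

*Form part.* On forms indexed by finite sets of indices, exterior multiplication `e^α ∧` and interior
multiplication `ι_α` are the operators `extMul α` and `intMul α`; they satisfy the canonical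
anticommutation relations. The exterior differential of the coframe is the operator `de^τ ∧ ι_τ`
(`dOp`), so that `D = e^α ∧ ∇_α + de^τ ∧ ι_τ` (`extD_eq`) with the covariant derivative
`∇_α = e_α - z^β Γ^γ_{βα} ∂/∂z^γ` acting on coefficients. The relations and `d² e^τ = 0`
(`extMul_dOp_add_dOp_mul_dOp`) give

* `D² = e^β ∧ e^α ∧ ∇_β ∇_α + de^τ ∧ ∇_τ` (`extD_extD`),
* `[D, δ] = e^α ∧ e^γ ∧ [∇_α, ∂/∂z^γ] + de^τ ∧ ∂/∂z^τ` (`opComm_extD_fedosovDelta`).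

Since `2 de^τ = -c^τ_{βα} e^β ∧ e^α` with the structure functions `c` of the frame (`dGen_add_self`),
the Ricci identity (`fibreCovD_comm`) turns the first operator into the contraction with
`½ z^φ R^τ_{φαβ} ∂/∂z^τ`, and the second one is the contraction with `-½ T^τ_{αβ} ∂/∂z^τ`.

*Wick part.* In the commutator with a series of degree at most two in `z` only the terms of first and
second order in the bidifferential operator remain (`wickMul_sub_wickMul`). The first-order term
involves `Λ^{αβ} - Λ^{βα} = 2θ^{αβ}`, which cancels the factor `θ_{γτ}` in the torsion and curvature
elements (`sum_wickTensor_mul_theta`). The second-order term for the curvature element is a multiple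
of `R g^{-1} + g^{-1} Rᵀ` (`sum_wickTensor_mul_curvature`). It vanishes because the normal connection is metric (`frameD_metric`), whence `g R + Rᵀ g = 0`
(`metric_mul_curvMatrix`). The matrix `θ R` is symmetric, as the quadratic form requires, because `R`
also commutes with the complex structure (`theta_curvature_symm`).
-/

noncomputable section

namespace LagrangeFedosov

/-! ### Exterior and interior multiplication on forms indexed by finite sets -/

theorem Idx.pos_injective {n : ℕ} : Function.Injective (Idx.pos : Idx n → ℕ) := by
  rintro (i | i) (j | j) h <;> simp only [Idx.pos] at h
  · exact congrArg _ (Fin.ext h)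
  · omega
  · omega
  · exact congrArg _ (Fin.ext (by omega))

/-- The sign of moving `e^α` past the factors of `e^J` that precede it. -/
def idxSign {n : ℕ} (α : Idx n) (J : Finset (Idx n)) : ℤ :=
  (-1) ^ (J.filter fun ν => ν.pos < α.pos).card

theorem idxSign_insert {n : ℕ} {α β : Idx n} {J : Finset (Idx n)} (h : β ∉ J) :
    idxSign α (insert β J) = (if β.pos < α.pos then -1 else 1) * idxSign α J := by
  unfold idxSign
  rw [Finset.filter_insert]
  split_ifs with hlt
  · rw [Finset.card_insert_of_notMem (by simp [h]), pow_succ]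
    ring
  · simp

theorem idxSign_mul_self {n : ℕ} (α : Idx n) (J : Finset (Idx n)) :
    idxSign α J * idxSign α J = 1 := by
  unfold idxSign
  rw [← pow_add, ← two_mul, pow_mul]
  simp

theorem idxSign_insert_mul {n : ℕ} {α β : Idx n} {J : Finset (Idx n)} (hne : α ≠ β)
    (hα : α ∉ J) (hβ : β ∉ J) :
    idxSign α (insert β J) * idxSign β J = -(idxSign β (insert α J) * idxSign α J) := by
  rw [idxSign_insert hβ, idxSign_insert hα]
  rcases lt_or_gt_of_ne (fun h => hne (Idx.pos_injective h)) with h | h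
  · rw [if_neg h.not_gt, if_pos h]
    ring
  · rw [if_pos h, if_neg h.not_gt]
    ring

theorem idxSign_insert_mul_insert {n : ℕ} {α β : Idx n} {J : Finset (Idx n)} (hne : α ≠ β)
    (hα : α ∉ J) (hβ : β ∉ J) :
    idxSign α (insert β J) * idxSign β (insert α J) = -(idxSign α J * idxSign β J) := by
  rw [idxSign_insert hβ, idxSign_insert hα]
  rcases lt_or_gt_of_ne (fun h => hne (Idx.pos_injective h)) with h | h
  · rw [if_neg h.not_gt, if_pos h]
    ring
  · rw [if_pos h, if_neg h.not_gt]
    ring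

section ExteriorOperators

variable {n : ℕ} {R : Type*} [CommRing R]

/-- The ring structure on the operators, registered again so that their additive structure is the
one derived from it. -/
instance formsEndRing : Ring (Module.End R (Finset (Idx n) → R)) := Module.End.instRing

/-- Left exterior multiplication by `e^α`. -/
def extMul (α : Idx n) : Module.End R (Finset (Idx n) → R) where
  toFun a K := if α ∈ K then idxSign α (K.erase α) • a (K.erase α) else 0
  map_add' a b := by ext K; by_cases h : α ∈ K <;> simp [h]
  map_smul' c a := by ext K; by_cases h : α ∈ K <;> simp [h, mul_left_comm]

/-- Interior multiplication by the frame vector `e_α`. -/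
def intMul (α : Idx n) : Module.End R (Finset (Idx n) → R) where
  toFun a K := if α ∈ K then 0 else idxSign α K • a (insert α K)
  map_add' a b := by ext K; by_cases h : α ∈ K <;> simp [h]
  map_smul' c a := by ext K; by_cases h : α ∈ K <;> simp [h, mul_left_comm]

theorem extMul_apply (α : Idx n) (a : Finset (Idx n) → R) (K : Finset (Idx n)) :
    extMul α a K = if α ∈ K then idxSign α (K.erase α) • a (K.erase α) else 0 := rfl

theorem intMul_apply (α : Idx n) (a : Finset (Idx n) → R) (K : Finset (Idx n)) :
    intMul α a K = if α ∈ K then 0 else idxSign α K • a (insert α K) := rfl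

theorem extMul_insert {α : Idx n} {K : Finset (Idx n)} (h : α ∉ K) (a : Finset (Idx n) → R) :
    extMul α a (insert α K) = idxSign α K • a K := by
  rw [extMul_apply, if_pos (Finset.mem_insert_self _ _), Finset.erase_insert h]

theorem extMul_of_notMem {α : Idx n} {K : Finset (Idx n)} (h : α ∉ K)
    (a : Finset (Idx n) → R) : extMul α a K = 0 := by
  rw [extMul_apply, if_neg h]

theorem intMul_of_notMem {α : Idx n} {K : Finset (Idx n)} (h : α ∉ K)
    (a : Finset (Idx n) → R) : intMul α a K = idxSign α K • a (insert α K) := by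
  rw [intMul_apply, if_neg h]

theorem intMul_of_mem {α : Idx n} {K : Finset (Idx n)} (h : α ∈ K)
    (a : Finset (Idx n) → R) : intMul α a K = 0 := by
  rw [intMul_apply, if_pos h]

theorem extMul_mul_self (α : Idx n) :
    (extMul α * extMul α : Module.End R (Finset (Idx n) → R)) = 0 := by
  refine LinearMap.ext fun a => funext fun K => ?_
  change _ = (0 : R)
  by_cases h : α ∈ K <;> simp [Module.End.mul_apply, extMul_apply, h]

theorem intMul_mul_self (α : Idx n) :
    (intMul α * intMul α : Module.End R (Finset (Idx n) → R)) = 0 := by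
  refine LinearMap.ext fun a => funext fun K => ?_
  change _ = (0 : R)
  by_cases h : α ∈ K <;> simp [Module.End.mul_apply, intMul_apply, h]

theorem extMul_anticomm (α β : Idx n) :
    (extMul α * extMul β : Module.End R (Finset (Idx n) → R)) = -(extMul β * extMul α) := by
  rcases eq_or_ne α β with rfl | hne
  · rw [extMul_mul_self, neg_zero]
  refine LinearMap.ext fun a => funext fun K => ?_
  change extMul α (extMul β a) K = -extMul β (extMul α a) K
  by_cases hα : α ∈ K
  · by_cases hβ : β ∈ K
    · obtain ⟨J, hαJ, hβJ, rfl⟩ : ∃ J : Finset (Idx n), α ∉ J ∧ β ∉ J ∧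
          K = insert α (insert β J) :=
        ⟨(K.erase α).erase β, by simp, by simp, by
          rw [Finset.insert_erase (by simp [hβ, hne.symm]), Finset.insert_erase hα]⟩
      rw [extMul_insert (by simp [hne, hαJ]), extMul_insert hβJ, Finset.insert_comm,
        extMul_insert (by simp [hne.symm, hβJ]), extMul_insert hαJ, smul_smul, smul_smul,
        idxSign_insert_mul hne hαJ hβJ, neg_smul]
    · rw [extMul_of_notMem hβ, extMul_apply, extMul_of_notMem (by simp [hβ])]
      simp
  · rw [extMul_of_notMem hα, extMul_apply, extMul_of_notMem (by simp [hα])]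
    simp

theorem intMul_anticomm (α β : Idx n) :
    (intMul α * intMul β : Module.End R (Finset (Idx n) → R)) = -(intMul β * intMul α) := by
  rcases eq_or_ne α β with rfl | hne
  · rw [intMul_mul_self, neg_zero]
  refine LinearMap.ext fun a => funext fun K => ?_
  change intMul α (intMul β a) K = -intMul β (intMul α a) K
  by_cases hα : α ∈ K
  · rw [intMul_of_mem hα, intMul_apply, intMul_of_mem (by simp [hα])]
    simp
  by_cases hβ : β ∈ K
  · rw [intMul_of_mem hβ, intMul_apply, intMul_of_mem (by simp [hβ])]
    simp
  rw [intMul_of_notMem hα, intMul_of_notMem (by simp [hne.symm, hβ]), intMul_of_notMem hβ,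
    intMul_of_notMem (by simp [hne, hα]), smul_smul, smul_smul, Finset.insert_comm,
    mul_comm (idxSign α K), mul_comm (idxSign β K), idxSign_insert_mul hne hα hβ, neg_smul, neg_neg]

/-- The canonical anticommutation relation between exterior and interior multiplication. -/
theorem intMul_mul_extMul (α β : Idx n) :
    (intMul α * extMul β : Module.End R (Finset (Idx n) → R)) =
      (if α = β then 1 else 0) - extMul β * intMul α := by
  refine LinearMap.ext fun a => funext fun K => ?_
  rcases eq_or_ne α β with rfl | hne
  · rw [if_pos rfl]
    change intMul α (extMul α a) K = a K - extMul α (intMul α a) K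
    by_cases hα : α ∈ K
    · obtain ⟨J, hJ, rfl⟩ : ∃ J : Finset (Idx n), α ∉ J ∧ K = insert α J :=
        ⟨K.erase α, by simp, (Finset.insert_erase hα).symm⟩
      rw [intMul_of_mem hα, extMul_insert hJ, intMul_of_notMem hJ, smul_smul, idxSign_mul_self,
        one_smul, sub_self]
    · rw [intMul_of_notMem hα, extMul_insert hα, extMul_of_notMem hα, smul_smul,
        idxSign_mul_self, one_smul, sub_zero]
  · rw [if_neg hne]
    change intMul α (extMul β a) K = 0 - extMul β (intMul α a) K
    by_cases hβ : β ∈ K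
    · by_cases hα : α ∈ K
      · rw [intMul_of_mem hα, extMul_apply, intMul_of_mem (by simp [hα, hne])]
        simp
      · obtain ⟨J, hJ, rfl⟩ : ∃ J : Finset (Idx n), β ∉ J ∧ K = insert β J :=
          ⟨K.erase β, by simp, (Finset.insert_erase hβ).symm⟩
        have hα' : α ∉ J := fun h => hα (Finset.mem_insert_of_mem h)
        rw [intMul_of_notMem hα, Finset.insert_comm, extMul_insert (by simp [hne.symm, hJ]),
          extMul_insert hJ, intMul_of_notMem hα', smul_smul, smul_smul, zero_sub,
          mul_comm (idxSign α (insert β J)), idxSign_insert_mul_insert hne.symm hJ hα', neg_smul]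
    · rw [extMul_of_notMem hβ, intMul_apply]
      split_ifs with hα
      · simp
      · rw [extMul_of_notMem (by simp [hne.symm, hβ])]
        simp

/-- A product of two exterior multiplications is even, so it commutes with exterior
multiplications. -/
theorem extMul_mul_extMul_comm (α β γ : Idx n) :
    (extMul α * (extMul β * extMul γ) : Module.End R (Finset (Idx n) → R)) =
      extMul β * extMul γ * extMul α := by
  rw [← mul_assoc, extMul_anticomm α β, neg_mul, mul_assoc, extMul_anticomm α γ, mul_neg, neg_neg,
    mul_assoc]

/-- Interior multiplication is an antiderivation of the exterior algebra. -/
theorem intMul_mul_extMul_extMul (μ β γ : Idx n) :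
    (intMul μ * (extMul β * extMul γ) : Module.End R (Finset (Idx n) → R)) =
      extMul β * extMul γ * intMul μ +
        ((if μ = β then extMul γ else 0) - (if μ = γ then extMul β else 0)) := by
  rw [← mul_assoc, intMul_mul_extMul, sub_mul, mul_assoc (extMul β), intMul_mul_extMul, mul_sub]
  split_ifs <;> noncomm_ring

end ExteriorOperators

/-! ### The exterior differential as an operator -/

theorem sum_sum_eq_zero_of_antisymm {ι M : Type*} [Fintype ι] [AddCommGroup M] (f : ι → ι → M)
    (h : ∀ a b, f a b = -f b a) (h0 : ∀ a, f a a = 0) : ∑ a, ∑ b, f a b = 0 := by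
  classical
  rw [← Finset.sum_product']
  refine Finset.sum_involution (fun x _ => x.swap) ?_ ?_ (by simp) (by simp)
  · rintro ⟨a, b⟩ -
    simp only [Prod.swap]
    rw [h a b]
    exact neg_add_cancel _
  · rintro ⟨a, b⟩ - hne heq
    simp only [Prod.swap, Prod.mk.injEq] at heq
    exact hne (by rw [heq.1]; exact h0 a)

section Differential

variable {n : ℕ} {R : Type*} [CommRing R]

/-- Exterior multiplication by the two-form `de^τ = k^τ_{αγ} e^α ∧ e^γ`. -/
def dGen (k : Idx n → Idx n → Idx n → R) (τ : Idx n) : Module.End R (Finset (Idx n) → R) :=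
  ∑ α, ∑ γ, k τ α γ • (extMul α * extMul γ)

/-- The antiderivation of the exterior algebra that kills scalars and sends `e^τ` to
`de^τ = k^τ_{αγ} e^α ∧ e^γ`. -/
def dOp (k : Idx n → Idx n → Idx n → R) : Module.End R (Finset (Idx n) → R) :=
  ∑ τ, dGen k τ * intMul τ

theorem extMul_mul_dGen (k : Idx n → Idx n → Idx n → R) (τ β : Idx n) :
    extMul β * dGen k τ = dGen k τ * extMul β := by
  simp only [dGen, Finset.mul_sum, Finset.sum_mul, mul_smul_comm, smul_mul_assoc,
    extMul_mul_extMul_comm]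

theorem dGen_comm (k : Idx n → Idx n → Idx n → R) (σ τ : Idx n) :
    dGen k σ * dGen k τ = dGen k τ * dGen k σ := by
  conv_lhs => rw [dGen]
  conv_rhs => rw [dGen.eq_def k σ]
  simp only [Finset.mul_sum, Finset.sum_mul, mul_smul_comm, smul_mul_assoc]
  refine Finset.sum_congr rfl fun α _ => Finset.sum_congr rfl fun γ _ => ?_
  rw [mul_assoc, extMul_mul_dGen, ← mul_assoc, extMul_mul_dGen, mul_assoc]

/-- The operator `dOp` is an antiderivation: its graded commutator with `e^β ∧` is `de^β ∧`. -/
theorem extMul_mul_dOp_add (k : Idx n → Idx n → Idx n → R) (β : Idx n) :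
    extMul β * dOp k + dOp k * extMul β = dGen k β := by
  have h : ∀ τ, extMul β * (dGen k τ * intMul τ) + dGen k τ * intMul τ * extMul β =
      if τ = β then dGen k τ else 0 := by
    intro τ
    rw [mul_assoc (dGen k τ), intMul_mul_extMul, mul_sub, ← mul_assoc, extMul_mul_dGen,
      mul_assoc]
    split_ifs <;> simp
  rw [dOp, Finset.mul_sum, Finset.sum_mul, ← Finset.sum_add_distrib,
    Finset.sum_congr rfl fun τ _ => h τ]
  simp

/-- The contraction of the two-form `de^ν` appears as the commutator of `ι_μ` with `de^ν ∧`. -/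
theorem intMul_mul_dGen (k : Idx n → Idx n → Idx n → R) (μ ν : Idx n) :
    intMul μ * dGen k ν = dGen k ν * intMul μ +
      ∑ α, ∑ γ, k ν α γ • ((if μ = α then extMul γ else 0) - (if μ = γ then extMul α else 0)) := by
  simp only [dGen, Finset.mul_sum, Finset.sum_mul, mul_smul_comm, smul_mul_assoc,
    intMul_mul_extMul_extMul, smul_add, Finset.sum_add_distrib]

/-- The square of the antiderivation is again of the form `(two-form) ι_ν`: the terms with two
interior multiplications cancel, since two-forms commute and interior multiplications
anticommute. -/
theorem dOp_mul_dOp (k : Idx n → Idx n → Idx n → R) :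
    dOp k * dOp k = ∑ ν, (∑ α, ∑ γ, k ν α γ •
      (dGen k α * extMul γ - dGen k γ * extMul α)) * intMul ν := by
  have h0 : ∑ μ, ∑ ν, dGen k μ * (dGen k ν * intMul μ) * intMul ν = 0 := by
    refine sum_sum_eq_zero_of_antisymm _ (fun μ ν => ?_) fun μ => ?_
    · rw [← mul_assoc, ← mul_assoc, mul_assoc _ (intMul μ), mul_assoc _ (intMul ν),
        intMul_anticomm, dGen_comm, mul_neg]
    · rw [mul_assoc, mul_assoc, intMul_mul_self, mul_zero, mul_zero]
  have h1 : ∀ μ ν, dGen k μ * intMul μ * (dGen k ν * intMul ν) =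
      dGen k μ * (dGen k ν * intMul μ) * intMul ν + (∑ α, ∑ γ, k ν α γ •
        ((if μ = α then dGen k μ * extMul γ else 0) -
          (if μ = γ then dGen k μ * extMul α else 0))) * intMul ν := by
    intro μ ν
    rw [mul_assoc, ← mul_assoc (intMul μ), intMul_mul_dGen, add_mul, mul_add, ← mul_assoc,
      ← mul_assoc (dGen k μ) (∑ _, _)]
    simp only [Finset.mul_sum, mul_smul_comm, mul_sub, mul_ite, mul_zero]
  calc dOp k * dOp k = ∑ μ, ∑ ν, dGen k μ * intMul μ * (dGen k ν * intMul ν) := by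
        rw [dOp, Finset.sum_mul]
        simp only [Finset.mul_sum]
    _ = ∑ ν, (∑ α, ∑ γ, ∑ μ, k ν α γ •
        ((if μ = α then dGen k μ * extMul γ else 0) -
          (if μ = γ then dGen k μ * extMul α else 0))) * intMul ν := by
        simp only [h1, Finset.sum_add_distrib, h0, zero_add]
        rw [Finset.sum_comm]
        refine Finset.sum_congr rfl fun ν _ => ?_
        rw [← Finset.sum_mul, Finset.sum_comm]
        refine congrArg (· * _) (Finset.sum_congr rfl fun α _ => Finset.sum_comm)
    _ = _ := by
        simp only [← Finset.smul_sum, Finset.sum_sub_distrib, Finset.sum_ite_eq',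
          Finset.mem_univ, if_true]

/-- The differential squares to zero on the generators `e^τ`: if `k^τ_{βαγ}` are the derivatives
of the `k^τ_{αγ}` along the frame, `k^τ_{αγ} = 0` unless `e^γ` is closed, and the functions whose
differentials are `k^τ_{αγ} e^α` satisfy `d² = 0`, then the total contribution of the forms to
the square of a connection vanishes. -/
theorem extMul_dOp_add_dOp_mul_dOp (k : Idx n → Idx n → Idx n → R)
    (k2 : Idx n → Idx n → Idx n → Idx n → R) (h0 : ∀ τ α γ, k τ α γ • dGen k γ = 0)
    (h2 : ∀ τ γ, ∑ β, ∑ α, k2 β τ α γ • (extMul β * extMul α) = -∑ σ, k τ σ γ • dGen k σ) :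
    ∑ β, extMul β * dOp (k2 β) + dOp k * dOp k = 0 := by
  have h3 : ∑ β, extMul β * dOp (k2 β) =
      ∑ ν, (∑ γ, (∑ β, ∑ α, k2 β ν α γ • (extMul β * extMul α)) * extMul γ) * intMul ν := by
    simp only [dOp, dGen, Finset.mul_sum, Finset.sum_mul, smul_mul_assoc, mul_smul_comm]
    rw [Finset.sum_comm]
    refine Finset.sum_congr rfl fun ν _ => ?_
    calc _ = ∑ β, ∑ γ, ∑ α, k2 β ν α γ • (extMul β * (extMul α * extMul γ * intMul ν)) :=
          Finset.sum_congr rfl fun β _ => Finset.sum_comm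
      _ = _ := by
          rw [Finset.sum_comm]
          simp only [mul_assoc]
  rw [h3, dOp_mul_dOp, ← Finset.sum_add_distrib]
  refine Finset.sum_eq_zero fun ν _ => ?_
  rw [← add_mul]
  convert zero_mul _
  simp only [h2, neg_mul, Finset.sum_mul, smul_mul_assoc, Finset.sum_neg_distrib, smul_sub]
  have h4 : ∀ α γ, k ν α γ • (dGen k γ * extMul α) = 0 := fun α γ => by
    rw [← smul_mul_assoc, h0, zero_mul]
  simp only [h4, sub_zero]
  rw [Finset.sum_comm, neg_add_cancel]

end Differential

/-! ### Products of forms with two-forms -/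

section FormMul

variable {n : ℕ}

theorem formSign_empty_left (J : Finset (Idx n)) : formSign ∅ J = 1 := by simp [formSign]

/-- The sign `formSign` splits off the first factor of a product of coframe elements. -/
theorem formSign_insert_left {α : Idx n} {I : Finset (Idx n)} (J : Finset (Idx n)) (h : α ∉ I) :
    formSign (insert α I) J = idxSign α J * formSign I J := by
  unfold formSign idxSign
  rw [← pow_add]
  congr 1
  have : (insert α I) ×ˢ J = (J.map ⟨Prod.mk α, Prod.mk_right_injective α⟩) ∪ I ×ˢ J := by
    ext ⟨x, y⟩
    simp
    tauto
  rw [this, Finset.filter_union, Finset.card_union_of_disjoint, Finset.filter_map,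
    Finset.card_map]
  · rfl
  · rw [Finset.disjoint_left]
    rintro ⟨x, y⟩ hx hy
    simp only [Finset.mem_filter, Finset.mem_map, Finset.mem_product,
      Function.Embedding.coeFn_mk, Prod.mk.injEq] at hx hy
    obtain ⟨⟨b, -, rfl, -⟩, -⟩ := hx
    exact h hy.1.1

theorem formSign_comm {I J : Finset (Idx n)} (h : Disjoint I J) :
    formSign J I = (-1) ^ (I.card * J.card) * formSign I J := by
  have hcard : ((J ×ˢ I).filter fun p => p.2.pos < p.1.pos).card +
      ((I ×ˢ J).filter fun p => p.2.pos < p.1.pos).card = I.card * J.card := by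
    rw [← Finset.card_product, ← Finset.card_filter_add_card_filter_not
      (s := I ×ˢ J) (fun p => p.1.pos < p.2.pos)]
    congr 1
    · refine Finset.card_bij (fun p _ => p.swap) ?_ ?_ ?_
      · rintro ⟨x, y⟩ hx
        simp_all
      · rintro ⟨x, y⟩ _ ⟨z, w⟩ _ h
        simp_all
      · rintro ⟨x, y⟩ hx
        exact ⟨(y, x), by simp_all, rfl⟩
    · congr 1
      refine Finset.filter_congr ?_
      rintro ⟨x, y⟩ hx
      rw [Finset.mem_product] at hx
      have : x.pos ≠ y.pos := fun e =>
        Finset.disjoint_left.1 h hx.1 (Idx.pos_injective e ▸ hx.2)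
      simp only
      omega
  -- The number of pairs in the wrong order for `(I, J)` is counted twice, so its sign drops out.
  unfold formSign
  rw [← hcard, pow_add, mul_assoc, ← pow_add, ← two_mul, pow_mul]
  simp

theorem formMul_monoForm_left {m : WickFibre n → WickFibre n → WickFibre n}
    (hm : ∀ x, m 0 x = 0) (I : Finset (Idx n)) (f : WickFibre n) (b : WickForm n)
    (K : Finset (Idx n)) :
    formMul m (monoForm I f) b K =
      if I ⊆ K then formSign I (K \ I) • m f (b (K \ I)) else 0 := by
  unfold formMul monoForm
  split_ifs with h
  · rw [Finset.sum_eq_single I]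
    · simp
    · intro J _ hJ
      simp [Pi.single_eq_of_ne hJ, hm]
    · simp [h]
  · refine Finset.sum_eq_zero fun J hJ => ?_
    have hne : J ≠ I := by
      rintro rfl
      exact h (Finset.mem_powerset.1 hJ)
    simp [Pi.single_eq_of_ne hne, hm]

theorem formMul_monoForm_right {m : WickFibre n → WickFibre n → WickFibre n}
    (hm : ∀ x, m x 0 = 0) (I : Finset (Idx n)) (f : WickFibre n) (b : WickForm n)
    (K : Finset (Idx n)) :
    formMul m b (monoForm I f) K =
      if I ⊆ K then formSign (K \ I) I • m (b (K \ I)) f else 0 := by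
  unfold formMul monoForm
  split_ifs with h
  · rw [Finset.sum_eq_single (K \ I)]
    · simp [Finset.inter_eq_right.2 h]
    · intro J hJ hne
      have : K \ J ≠ I := by
        rintro rfl
        exact hne (by simp [Finset.inter_eq_right.2 (Finset.mem_powerset.1 hJ)])
      simp [Pi.single_eq_of_ne this, hm]
    · simp
  · refine Finset.sum_eq_zero fun J hJ => ?_
    have hne : K \ J ≠ I := by
      rintro rfl
      exact h Finset.sdiff_subset
    simp [Pi.single_eq_of_ne hne, hm]

theorem wedge_coframeForm (α : Idx n) (a : WickForm n) :
    wedge (coframeForm α) a = extMul α a := by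
  funext K
  rw [wedge, coframeForm, formMul_monoForm_left (fun x => zero_mul x), extMul_apply]
  simp only [Finset.singleton_subset_iff, one_mul, Finset.sdiff_singleton_eq_erase]
  rw [← insert_empty_eq α, formSign_insert_left _ (Finset.notMem_empty α), formSign_empty_left,
    mul_one]

theorem coframeForm_eq (α : Idx n) :
    (coframeForm α : WickForm n) = extMul α (monoForm ∅ 1) := by
  funext K
  rw [coframeForm, monoForm, extMul_apply]
  split_ifs with h
  · by_cases hK : K = {α}
    · subst hK
      simp [monoForm, idxSign]
    · have : K.erase α ≠ ∅ := fun e => by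
        rw [Finset.erase_eq_empty_iff] at e
        rcases e with rfl | e
        · simp at h
        · exact hK e
      rw [Pi.single_eq_of_ne hK, monoForm, Pi.single_eq_of_ne this, smul_zero]
  · rw [Pi.single_eq_of_ne]
    rintro rfl
    simp at h

theorem coframeForm_wedge_self (α : Idx n) :
    wedge (coframeForm α) (coframeForm α) = (0 : WickForm n) := by
  rw [wedge_coframeForm, coframeForm_eq]
  exact LinearMap.congr_fun (extMul_mul_self α) _

theorem coframeForm_wedge {α β : Idx n} (h : α ≠ β) :
    wedge (coframeForm α) (coframeForm β) =
      (monoForm {α, β} (idxSign α {β} : WickFibre n) : WickForm n) := by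
  rw [wedge_coframeForm]
  funext K
  rw [extMul_apply, coframeForm, monoForm, monoForm]
  by_cases hα : α ∈ K
  · rw [if_pos hα]
    by_cases hK : K = {α, β}
    · have : K.erase α = {β} := by
        rw [hK, Finset.erase_insert (by simpa using h)]
      rw [this, hK]
      simp
    · have : K.erase α ≠ {β} := fun e => hK (by rw [← Finset.insert_erase hα, e])
      rw [Pi.single_eq_of_ne this, Pi.single_eq_of_ne hK, smul_zero]
  · rw [if_neg hα, Pi.single_eq_of_ne]
    rintro rfl
    simp at hα

theorem extMul_extMul_apply {α β : Idx n} (h : α ≠ β) (x : WickForm n) (K : Finset (Idx n)) :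
    extMul α (extMul β x) K = if {α, β} ⊆ K then
      (idxSign α {β} * formSign {α, β} (K \ {α, β})) • x (K \ {α, β}) else 0 := by
  split_ifs with hK
  · obtain ⟨J, hαJ, hβJ, rfl⟩ : ∃ J : Finset (Idx n), α ∉ J ∧ β ∉ J ∧
        K = insert α (insert β J) := by
      have hα : α ∈ K := hK (by simp)
      have hβ : β ∈ K := hK (by simp)
      exact ⟨(K.erase α).erase β, by simp, by simp, by
        rw [Finset.insert_erase (by simp [hβ, h.symm]), Finset.insert_erase hα]⟩
    have hd : insert α (insert β J) \ {α, β} = J := by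
      ext x
      simp only [Finset.mem_sdiff, Finset.mem_insert, Finset.mem_singleton]
      constructor
      · tauto
      · intro hx
        exact ⟨Or.inr (Or.inr hx), by rintro (rfl | rfl) <;> contradiction⟩
    rw [hd, extMul_insert (by simp [h, hαJ]), extMul_insert hβJ, smul_smul,
      formSign_insert_left _ (by simpa using h), ← insert_empty_eq β,
      formSign_insert_left _ (Finset.notMem_empty β), formSign_empty_left, idxSign_insert hβJ,
      idxSign_insert (Finset.notMem_empty β)]
    congr 1
    simp [idxSign]
  · rw [extMul_apply]
    split_ifs with hα
    · rw [extMul_of_notMem, smul_zero]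
      intro hβ
      refine hK ?_
      intro x hx
      rcases Finset.mem_insert.1 hx with rfl | hx
      · exact hα
      · rw [Finset.mem_singleton.1 hx]
        exact Finset.mem_of_mem_erase hβ
    · rfl

/-- Left multiplication by a two-form with values in the coefficients, for any biadditive product of
the coefficients. -/
theorem formMul_twoForm_left {m : WickFibre n → WickFibre n → WickFibre n}
    (hm : ∀ x y z, m (x + y) z = m x z + m y z) (f : WickFibre n) (α β : Idx n)
    (b : WickForm n) :
    formMul m (f • wedge (coframeForm α) (coframeForm β)) b =
      extMul α (extMul β fun I => m f (b I)) := by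
  have h0 : ∀ z, m 0 z = 0 := fun z => by simpa using hm 0 0 z
  rcases eq_or_ne α β with rfl | h
  · rw [coframeForm_wedge_self, smul_zero, ← Module.End.mul_apply, extMul_mul_self]
    funext K
    simp [formMul, h0]
  · funext K
    rw [coframeForm_wedge h, monoForm, ← Pi.single_smul, ← monoForm,
      formMul_monoForm_left h0, extMul_extMul_apply h]
    split_ifs
    · have : f • (idxSign α {β} : WickFibre n) = idxSign α {β} • f := by
        rw [smul_eq_mul, mul_comm, zsmul_eq_mul]
      rw [this, (AddMonoidHom.mk' (fun x => m x (b (K \ {α, β}))) (fun x y => hm x y _)).map_zsmul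
        (idxSign α {β}) f |> fun h => (h : m _ _ = _ • m _ _), smul_smul, mul_comm]
    · rfl

/-- Right multiplication by a two-form: as two-forms are even, no sign appears. -/
theorem formMul_twoForm_right {m : WickFibre n → WickFibre n → WickFibre n}
    (hm : ∀ x y z, m z (x + y) = m z x + m z y) (f : WickFibre n) (α β : Idx n)
    (b : WickForm n) :
    formMul m b (f • wedge (coframeForm α) (coframeForm β)) =
      extMul α (extMul β fun I => m (b I) f) := by
  have h0 : ∀ z, m z 0 = 0 := fun z => by simpa using hm 0 0 z
  rcases eq_or_ne α β with rfl | h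
  · rw [coframeForm_wedge_self, smul_zero, ← Module.End.mul_apply, extMul_mul_self]
    funext K
    simp [formMul, h0]
  · funext K
    rw [coframeForm_wedge h, monoForm, ← Pi.single_smul, ← monoForm,
      formMul_monoForm_right h0, extMul_extMul_apply h]
    split_ifs
    · have : f • (idxSign α {β} : WickFibre n) = idxSign α {β} • f := by
        rw [smul_eq_mul, mul_comm, zsmul_eq_mul]
      rw [this, (AddMonoidHom.mk' (fun x => m (b (K \ {α, β})) x) (fun x y => hm x y _)).map_zsmul
        (idxSign α {β}) f |> fun h => (h : m _ _ = _ • m _ _), smul_smul,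
        formSign_comm Finset.disjoint_sdiff, Finset.card_pair h, pow_mul, neg_one_sq, one_pow,
        one_mul, mul_comm]
    · rfl

theorem formMul_add_left {m : WickFibre n → WickFibre n → WickFibre n}
    (hm : ∀ x y z, m (x + y) z = m x z + m y z) (a b c : WickForm n) :
    formMul m (a + b) c = formMul m a c + formMul m b c := by
  funext K
  simp only [formMul, Pi.add_apply, hm, smul_add, Finset.sum_add_distrib]

theorem formMul_add_right {m : WickFibre n → WickFibre n → WickFibre n}
    (hm : ∀ x y z, m z (x + y) = m z x + m z y) (a b c : WickForm n) :
    formMul m c (a + b) = formMul m c a + formMul m c b := by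
  funext K
  simp only [formMul, Pi.add_apply, hm, smul_add, Finset.sum_add_distrib]

theorem formMul_sum_left {m : WickFibre n → WickFibre n → WickFibre n}
    (hm : ∀ x y z, m (x + y) z = m x z + m y z) {ι : Type*} (s : Finset ι) (a : ι → WickForm n)
    (c : WickForm n) : formMul m (∑ i ∈ s, a i) c = ∑ i ∈ s, formMul m (a i) c :=
  map_sum (AddMonoidHom.mk' (fun x => formMul m x c) fun x y => formMul_add_left hm x y c) a s

theorem formMul_sum_right {m : WickFibre n → WickFibre n → WickFibre n}
    (hm : ∀ x y z, m z (x + y) = m z x + m z y) {ι : Type*} (s : Finset ι) (a : ι → WickForm n)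
    (c : WickForm n) : formMul m c (∑ i ∈ s, a i) = ∑ i ∈ s, formMul m c (a i) :=
  map_sum (AddMonoidHom.mk' (fun x => formMul m c x) fun x y => formMul_add_right hm x y c) a s

/-- Operators on coefficients commute with exterior multiplication. -/
theorem extMul_map {R S : Type*} [CommRing R] [CommRing S] (T : R →+ S) (α : Idx n)
    (a : Finset (Idx n) → R) :
    (fun I => T (extMul α a I)) = extMul α fun I => T (a I) := by
  funext K
  simp only [extMul_apply]
  split_ifs <;> simp [-zsmul_eq_mul, map_zsmul]

/-- Operators on coefficients commute with interior multiplication. -/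
theorem intMul_map {R S : Type*} [CommRing R] [CommRing S] (T : R →+ S) (α : Idx n)
    (a : Finset (Idx n) → R) :
    (fun I => T (intMul α a I)) = intMul α fun I => T (a I) := by
  funext K
  simp only [intMul_apply]
  split_ifs <;> simp [-zsmul_eq_mul, map_zsmul]

end FormMul

/-! ### Derivations of the fibre and the formal Wick commutator -/

section Fibre

variable {n : ℕ}

theorem scalar_add (c d : ℂ) : (scalar (c + d) : WickFibre n) = scalar c + scalar d := by
  simp [scalar]

theorem scalar_mul (c d : ℂ) : (scalar (c * d) : WickFibre n) = scalar c * scalar d := by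
  simp [scalar]

theorem scalar_zero : (scalar 0 : WickFibre n) = 0 := by simp [scalar]

theorem scalar_one : (scalar 1 : WickFibre n) = 1 := by simp [scalar]

theorem scalar_neg (c : ℂ) : (scalar (-c) : WickFibre n) = -scalar c := by simp [scalar]

theorem scalar_sub (c d : ℂ) : (scalar (c - d) : WickFibre n) = scalar c - scalar d := by
  simp [scalar]

theorem scalar_sum {ι : Type*} (s : Finset ι) (c : ι → ℂ) :
    (scalar (∑ i ∈ s, c i) : WickFibre n) = ∑ i ∈ s, scalar (c i) := by
  simp [scalar]

theorem coeff_scalar_mul (c : ℂ) (f : WickFibre n) (r : ℕ) :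
    PowerSeries.coeff r (scalar c * f) = c • PowerSeries.coeff r f := by
  rw [scalar, PowerSeries.coeff_C_mul, MvPowerSeries.smul_eq_C_mul]

theorem coeff_zDeriv (α : Idx n) (f : WickFibre n) (r : ℕ) :
    PowerSeries.coeff r (zDeriv α f) = MvPowerSeries.pderiv ℂ α (PowerSeries.coeff r f) := by
  rw [zDeriv, PowerSeries.coeff_mk]

/-- `∂ / ∂z^α` as an additive map. -/
def zDerivHom (α : Idx n) : WickFibre n →+ WickFibre n where
  toFun := zDeriv α
  map_zero' := by ext1 r; simp [coeff_zDeriv]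
  map_add' f g := by ext1 r; simp [coeff_zDeriv]

theorem zDeriv_add (α : Idx n) (f g : WickFibre n) :
    zDeriv α (f + g) = zDeriv α f + zDeriv α g := (zDerivHom α).map_add f g

theorem zDeriv_sub (α : Idx n) (f g : WickFibre n) :
    zDeriv α (f - g) = zDeriv α f - zDeriv α g := (zDerivHom α).map_sub f g

theorem zDeriv_sum (α : Idx n) {ι : Type*} (s : Finset ι) (f : ι → WickFibre n) :
    zDeriv α (∑ i ∈ s, f i) = ∑ i ∈ s, zDeriv α (f i) := map_sum (zDerivHom α) f s

theorem zDeriv_C_mul (α : Idx n) (f : MvPowerSeries (Idx n) ℂ) (g : WickFibre n) :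
    zDeriv α (PowerSeries.C f * g) =
      PowerSeries.C (MvPowerSeries.pderiv ℂ α f) * g + PowerSeries.C f * zDeriv α g := by
  ext1 r
  simp only [coeff_zDeriv, PowerSeries.coeff_C_mul, Derivation.leibniz, map_add, smul_eq_mul]
  ring

theorem zDeriv_scalar_mul (α : Idx n) (c : ℂ) (g : WickFibre n) :
    zDeriv α (scalar c * g) = scalar c * zDeriv α g := by
  rw [scalar, zDeriv_C_mul, MvPowerSeries.pderiv_C]
  simp

theorem zDeriv_zVar_mul (α β : Idx n) (g : WickFibre n) :
    zDeriv α (zVar β * g) = (if α = β then g else 0) + zVar β * zDeriv α g := by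
  rw [zVar, zDeriv_C_mul, MvPowerSeries.pderiv_X]
  rcases eq_or_ne α β with rfl | h
  · simp
  · simp [h]

theorem pderiv_comm (α β : Idx n) (f : MvPowerSeries (Idx n) ℂ) :
    MvPowerSeries.pderiv ℂ α (MvPowerSeries.pderiv ℂ β f) =
      MvPowerSeries.pderiv ℂ β (MvPowerSeries.pderiv ℂ α f) := by
  rcases eq_or_ne α β with rfl | h
  · rfl
  ext m
  simp only [MvPowerSeries.coeff_pderiv, Finsupp.add_apply, Finsupp.single_eq_of_ne h,
    Finsupp.single_eq_of_ne h.symm, add_zero]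
  rw [add_right_comm]
  ring

theorem zDeriv_comm (α β : Idx n) (f : WickFibre n) :
    zDeriv α (zDeriv β f) = zDeriv β (zDeriv α f) := by
  ext1 r
  simp only [coeff_zDeriv, pderiv_comm α β]

theorem bidiff_add_left (M : Idx n → Idx n → ℂ) (r : ℕ) (f f' g : MvPowerSeries (Idx n) ℂ) :
    bidiff M r (f + f') g = bidiff M r f g + bidiff M r f' g := by
  induction r generalizing f f' g with
  | zero => simp [bidiff, add_mul]
  | succ r ih => simp only [bidiff, map_add, ih, smul_add, Finset.sum_add_distrib]

theorem bidiff_swap (M : Idx n → Idx n → ℂ) (r : ℕ) (f g : MvPowerSeries (Idx n) ℂ) :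
    bidiff M r f g = bidiff (fun α β => M β α) r g f := by
  induction r generalizing f g with
  | zero => simp [bidiff, mul_comm]
  | succ r ih =>
    simp only [bidiff]
    rw [Finset.sum_comm]
    simp only [ih]

theorem bidiff_zero_left (M : Idx n → Idx n → ℂ) (r : ℕ) (g : MvPowerSeries (Idx n) ℂ) :
    bidiff M r 0 g = 0 := by
  simpa using bidiff_add_left M r 0 0 g

/-- Exchanging the factors of the Wick product amounts to transposing `M`. -/
theorem wickMul_swap (M : Idx n → Idx n → ℂ) (a b : WickFibre n) :
    wickMul M a b = wickMul (fun α β => M β α) b a := by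
  unfold wickMul
  congr 1
  funext s
  refine Finset.sum_congr rfl fun x _ => ?_
  rw [← Finset.Nat.sum_antidiagonal_swap]
  refine Finset.sum_congr rfl fun y _ => ?_
  rw [bidiff_swap]
  rfl

theorem wickMul_add_left (M : Idx n → Idx n → ℂ) (a a' b : WickFibre n) :
    wickMul M (a + a') b = wickMul M a b + wickMul M a' b := by
  ext1 s
  simp only [wickMul, map_add, PowerSeries.coeff_mk, bidiff_add_left, smul_add,
    Finset.sum_add_distrib]

theorem wickMul_add_right (M : Idx n → Idx n → ℂ) (a a' b : WickFibre n) :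
    wickMul M b (a + a') = wickMul M b a + wickMul M b a' := by
  rw [wickMul_swap, wickMul_add_left, wickMul_swap M b a, wickMul_swap M b a']

/-- The bidifferential operator of order `r` applied to a series `f` without `v`, coefficient by
coefficient in the powers of `v`. -/
def bidiffSeries (M : Idx n → Idx n → ℂ) (r : ℕ) (f : MvPowerSeries (Idx n) ℂ)
    (b : WickFibre n) : WickFibre n :=
  PowerSeries.mk fun s => bidiff M r f (PowerSeries.coeff s b)

theorem bidiffSeries_zero (M : Idx n → Idx n → ℂ) (f : MvPowerSeries (Idx n) ℂ)
    (b : WickFibre n) : bidiffSeries M 0 f b = PowerSeries.C f * b := by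
  ext1 s
  simp [bidiffSeries, bidiff, PowerSeries.coeff_C_mul]

theorem bidiffSeries_succ (M : Idx n → Idx n → ℂ) (r : ℕ) (f : MvPowerSeries (Idx n) ℂ)
    (b : WickFibre n) :
    bidiffSeries M (r + 1) f b = ∑ α, ∑ β,
      scalar (M α β) * bidiffSeries M r (MvPowerSeries.pderiv ℂ α f) (zDeriv β b) := by
  ext1 s
  simp only [bidiffSeries, PowerSeries.coeff_mk, bidiff, map_sum, coeff_scalar_mul, coeff_zDeriv]

/-- The exponential in the Wick product breaks off when the left factor is quadratic in `z`. -/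
theorem wickMul_C_left (M : Idx n → Idx n → ℂ) (f : MvPowerSeries (Idx n) ℂ)
    (hf : ∀ α β γ, MvPowerSeries.pderiv ℂ α (MvPowerSeries.pderiv ℂ β
      (MvPowerSeries.pderiv ℂ γ f)) = 0) (b : WickFibre n) :
    wickMul M (PowerSeries.C f) b = bidiffSeries M 0 f b
      + vVar n * (scalar (Complex.I / 2) * bidiffSeries M 1 f b)
      + vVar n ^ 2 * (scalar ((Complex.I / 2) ^ 2 / 2) * bidiffSeries M 2 f b) := by
  -- All terms with at least three derivatives of `f` vanish.
  have h3 : ∀ r (g : MvPowerSeries (Idx n) ℂ), bidiff M (r + 3) f g = 0 := by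
    intro r g
    simp only [bidiff, hf, bidiff_zero_left, smul_zero, Finset.sum_const_zero]
  have hs : ∀ s, PowerSeries.coeff s (wickMul M (PowerSeries.C f) b) =
      ∑ x ∈ Finset.HasAntidiagonal.antidiagonal s,
        ((Complex.I / 2) ^ x.1 / (x.1.factorial : ℂ)) •
          bidiff M x.1 f (PowerSeries.coeff x.2 b) := by
    intro s
    rw [wickMul, PowerSeries.coeff_mk]
    refine Finset.sum_congr rfl fun x _ => ?_
    rw [Finset.sum_eq_single (0, x.2)]
    · simp
    · rintro ⟨p, q⟩ hpq hne
      have hp : p ≠ 0 := by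
        rintro rfl
        rw [Finset.HasAntidiagonal.mem_antidiagonal, zero_add] at hpq
        exact hne (by rw [← hpq])
      rw [PowerSeries.coeff_C, if_neg hp, bidiff_zero_left, smul_zero]
    · intro h
      simp at h
  ext1 s
  rw [hs, Finset.Nat.sum_antidiagonal_eq_sum_range_succ_mk]
  simp only [map_add, vVar]
  match s with
  | 0 =>
    simp [bidiffSeries, PowerSeries.coeff_zero_X_mul, pow_two, mul_assoc]
  | 1 =>
    rw [PowerSeries.coeff_succ_X_mul, pow_two, mul_assoc, PowerSeries.coeff_succ_X_mul,
      PowerSeries.coeff_zero_X_mul, coeff_scalar_mul]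
    simp [bidiffSeries, Finset.sum_range_succ]
  | s + 2 =>
    rw [PowerSeries.coeff_succ_X_mul, pow_two, mul_assoc, PowerSeries.coeff_succ_X_mul,
      PowerSeries.coeff_succ_X_mul, coeff_scalar_mul, coeff_scalar_mul,
      ← Finset.sum_subset (Finset.range_mono (show 3 ≤ (s + 2).succ by omega))]
    · simp [bidiffSeries, Finset.sum_range_succ]
    · intro r _ hr
      obtain ⟨k, rfl⟩ := Nat.exists_eq_add_of_le' (not_lt.1 fun h => hr (Finset.mem_range.2 h))
      rw [h3, smul_zero]

theorem bidiffSeries_one (M : Idx n → Idx n → ℂ) (f : MvPowerSeries (Idx n) ℂ)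
    (b : WickFibre n) : bidiffSeries M 1 f b = ∑ α, ∑ β,
      scalar (M α β) * (PowerSeries.C (MvPowerSeries.pderiv ℂ α f) * zDeriv β b) := by
  rw [bidiffSeries_succ]
  simp only [bidiffSeries_zero]

theorem bidiffSeries_two (M : Idx n → Idx n → ℂ) (f : MvPowerSeries (Idx n) ℂ)
    (b : WickFibre n) : bidiffSeries M 2 f b = ∑ α, ∑ β, ∑ γ, ∑ δ,
      scalar (M α β * M γ δ) * (PowerSeries.C (MvPowerSeries.pderiv ℂ γ
        (MvPowerSeries.pderiv ℂ α f)) * zDeriv δ (zDeriv β b)) := by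
  rw [bidiffSeries_succ]
  simp only [bidiffSeries_one, Finset.mul_sum, scalar_mul, mul_assoc]

/-- The Wick commutator with a quadratic polynomial in `z`. -/
theorem wickMul_sub_wickMul (M : Idx n → Idx n → ℂ) (f : MvPowerSeries (Idx n) ℂ)
    (hf : ∀ α β γ, MvPowerSeries.pderiv ℂ α (MvPowerSeries.pderiv ℂ β
      (MvPowerSeries.pderiv ℂ γ f)) = 0) (b : WickFibre n) :
    wickMul M (PowerSeries.C f) b - wickMul M b (PowerSeries.C f) =
      vVar n * (scalar (Complex.I / 2) * ∑ α, ∑ β, scalar (M α β - M β α) *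
        (PowerSeries.C (MvPowerSeries.pderiv ℂ α f) * zDeriv β b))
      + vVar n ^ 2 * (scalar ((Complex.I / 2) ^ 2 / 2) * ∑ α, ∑ β, ∑ γ, ∑ δ,
        scalar (M α β * M γ δ - M β α * M δ γ) * (PowerSeries.C (MvPowerSeries.pderiv ℂ γ
          (MvPowerSeries.pderiv ℂ α f)) * zDeriv δ (zDeriv β b))) := by
  rw [wickMul_swap M b, wickMul_C_left M f hf, wickMul_C_left _ f hf]
  simp only [bidiffSeries_zero, bidiffSeries_one, bidiffSeries_two, scalar_sub, sub_mul,
    Finset.sum_sub_distrib]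
  ring

/-- The linear form `t_γ z^γ`. -/
def linForm (t : Idx n → ℂ) : MvPowerSeries (Idx n) ℂ :=
  ∑ γ, MvPowerSeries.C (t γ) * MvPowerSeries.X γ

/-- The quadratic form `S_{γφ} z^γ z^φ`. -/
def quadForm (S : Idx n → Idx n → ℂ) : MvPowerSeries (Idx n) ℂ :=
  ∑ γ, ∑ φ, MvPowerSeries.C (S γ φ) * (MvPowerSeries.X γ * MvPowerSeries.X φ)

theorem pderiv_C_mul (α : Idx n) (c : ℂ) (f : MvPowerSeries (Idx n) ℂ) :
    MvPowerSeries.pderiv ℂ α (MvPowerSeries.C c * f) =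
      MvPowerSeries.C c * MvPowerSeries.pderiv ℂ α f := by
  simp

theorem pderiv_linForm (α : Idx n) (t : Idx n → ℂ) :
    MvPowerSeries.pderiv ℂ α (linForm t) = MvPowerSeries.C (t α) := by
  simp only [linForm, map_sum, pderiv_C_mul, MvPowerSeries.pderiv_X]
  rw [Finset.sum_eq_single α]
  · simp
  · intro γ _ h
    simp [h]
  · simp

theorem pderiv_quadForm (α : Idx n) (S : Idx n → Idx n → ℂ) (hS : ∀ γ φ, S γ φ = S φ γ) :
    MvPowerSeries.pderiv ℂ α (quadForm S) = linForm fun φ => 2 * S α φ := by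
  have h : ∀ γ φ, MvPowerSeries.pderiv ℂ α (MvPowerSeries.C (S γ φ) *
      (MvPowerSeries.X γ * MvPowerSeries.X φ)) =
      (if γ = α then MvPowerSeries.C (S γ φ) * MvPowerSeries.X φ else 0) +
        (if φ = α then MvPowerSeries.C (S γ φ) * MvPowerSeries.X γ else 0) := by
    intro γ φ
    rw [pderiv_C_mul, Derivation.leibniz, MvPowerSeries.pderiv_X, MvPowerSeries.pderiv_X]
    by_cases h1 : γ = α <;> by_cases h2 : φ = α
    · subst h1 h2
      simp [mul_add]
    · subst h1
      simp [h2]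
    · subst h2
      simp [h1]
    · simp [h1, h2]
  simp only [quadForm, map_sum, h, Finset.sum_add_distrib]
  rw [Finset.sum_comm (f := fun γ φ => if γ = α then _ else _)]
  simp only [Finset.sum_ite_eq', Finset.mem_univ, if_true]
  rw [← Finset.sum_add_distrib, linForm]
  refine Finset.sum_congr rfl fun φ _ => ?_
  rw [hS φ α, map_mul, map_ofNat]
  ring

theorem wickMul_linForm_sub (M : Idx n → Idx n → ℂ) (t : Idx n → ℂ) (b : WickFibre n) :
    wickMul M (PowerSeries.C (linForm t)) b - wickMul M b (PowerSeries.C (linForm t)) =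
      vVar n * (scalar (Complex.I / 2) * ∑ β, scalar (∑ α, (M α β - M β α) * t α) *
        zDeriv β b) := by
  rw [wickMul_sub_wickMul M _ (by simp [pderiv_linForm])]
  simp only [pderiv_linForm, MvPowerSeries.pderiv_C, map_zero, zero_mul, mul_zero,
    Finset.sum_const_zero, add_zero]
  rw [Finset.sum_comm]
  simp only [scalar_sum, scalar_mul, Finset.sum_mul, mul_assoc]
  rfl

/-- The Wick commutator with a quadratic form is a derivation when the coefficients of second
order vanish. -/
theorem wickMul_quadForm_sub (M S : Idx n → Idx n → ℂ) (hS : ∀ γ φ, S γ φ = S φ γ)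
    (h2 : ∀ β δ, ∑ α, ∑ γ, (M α β * M γ δ - M β α * M δ γ) * S α γ = 0) (b : WickFibre n) :
    wickMul M (PowerSeries.C (quadForm S)) b - wickMul M b (PowerSeries.C (quadForm S)) =
      vVar n * (scalar Complex.I * ∑ β, ∑ φ, scalar (∑ α, (M α β - M β α) * S α φ) *
        zVar φ * zDeriv β b) := by
  rw [wickMul_sub_wickMul M _ (by simp [pderiv_linForm, pderiv_quadForm _ S hS])]
  simp only [pderiv_quadForm _ S hS, pderiv_linForm]
  have hsecond : ∑ α, ∑ β, ∑ γ, ∑ δ, scalar (M α β * M γ δ - M β α * M δ γ) *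
      (PowerSeries.C (MvPowerSeries.C (2 * S α γ)) * zDeriv δ (zDeriv β b)) = 0 := by
    rw [Finset.sum_comm]
    refine Finset.sum_eq_zero fun β _ => ?_
    calc _ = ∑ α, ∑ δ, ∑ γ, scalar (M α β * M γ δ - M β α * M δ γ) *
          (PowerSeries.C (MvPowerSeries.C (2 * S α γ)) * zDeriv δ (zDeriv β b)) :=
          Finset.sum_congr rfl fun α _ => Finset.sum_comm
      _ = ∑ δ, scalar (2 * ∑ α, ∑ γ, (M α β * M γ δ - M β α * M δ γ) * S α γ) *
          zDeriv δ (zDeriv β b) := by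
          rw [Finset.sum_comm]
          refine Finset.sum_congr rfl fun δ _ => ?_
          simp only [Finset.mul_sum, scalar_sum, Finset.sum_mul]
          refine Finset.sum_congr rfl fun α _ => Finset.sum_congr rfl fun γ _ => ?_
          rw [← mul_assoc, mul_left_comm, scalar_mul, ← scalar, mul_comm (scalar _)]
      _ = 0 := by simp only [h2, mul_zero, scalar_zero, zero_mul, Finset.sum_const_zero]
  rw [hsecond, mul_zero, mul_zero, add_zero, Finset.sum_comm]
  congr 1
  simp only [linForm, scalar_sum, map_sum, map_mul, Finset.sum_mul, Finset.mul_sum]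
  refine Finset.sum_congr rfl fun β _ => ?_
  rw [Finset.sum_comm]
  refine Finset.sum_congr rfl fun φ _ => Finset.sum_congr rfl fun α _ => ?_
  have : (scalar (Complex.I / 2) : WickFibre n) * scalar 2 = scalar Complex.I := by
    rw [← scalar_mul]
    congr 1
    ring
  rw [← this, scalar_mul]
  simp only [scalar, zVar]
  ring

theorem wedge_coframeForm_apply_of_card_ne (α β : Idx n) {I : Finset (Idx n)} (hI : I.card ≠ 2) :
    wedge (coframeForm α) (coframeForm β) I = (0 : WickFibre n) := by
  rcases eq_or_ne α β with rfl | h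
  · rw [coframeForm_wedge_self]
    rfl
  · rw [coframeForm_wedge h, monoForm, Pi.single_eq_of_ne]
    rintro rfl
    exact hI (Finset.card_pair h)

theorem sum_degPart (a : Coord n → WickForm n) (u : Coord n) :
    ∑ q ∈ Finset.range (2 * n + 1), degPart q a u = a u := by
  funext I
  rw [Finset.sum_apply, Finset.sum_eq_single I.card]
  · simp [degPart]
  · intro q _ hq
    rw [degPart, if_neg hq.symm]
  · intro h
    refine absurd (Finset.mem_range.2 ?_) h
    have := Finset.card_le_univ I
    simp only [Fintype.card_sum, Fintype.card_fin] at this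
    omega

/-- The graded commutator with a two-form is taken coefficient by coefficient. -/
theorem adWick_twoForm (L : Coord n → ℝ) (T a : Coord n → WickForm n) (u : Coord n)
    (Q : Idx n → Idx n → WickFibre n)
    (hT : T u = ∑ α, ∑ β, Q α β • wedge (coframeForm α) (coframeForm β)) :
    adWick L T a u = ∑ α, ∑ β, extMul α (extMul β fun I =>
      wickMul (wickTensor L u) (Q α β) (a u I) - wickMul (wickTensor L u) (a u I) (Q α β)) := by
  have hl := wickMul_add_left (wickTensor L u)
  have hr := wickMul_add_right (wickTensor L u)
  have hr' : ∀ x y z, wickMul (wickTensor L u) z (x + y) =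
      wickMul (wickTensor L u) z x + wickMul (wickTensor L u) z y := fun x y z => hr x y z
  -- A two-form has no components in other degrees, and its degree makes the graded sign trivial.
  have hdeg : ∀ p, p ≠ 2 → degPart p T u = 0 := by
    intro p hp
    funext I
    rw [degPart]
    split_ifs with h
    · rw [hT]
      simp only [Finset.sum_apply, Pi.smul_apply]
      refine Finset.sum_eq_zero fun α _ => Finset.sum_eq_zero fun β _ => ?_
      rw [wedge_coframeForm_apply_of_card_ne _ _ (by omega), smul_zero]
    · rfl
  have hterm : ∀ p q, (wick L (degPart p T) (degPart q a) -
      (-1 : ℤ) ^ (p * q) • wick L (degPart q a) (degPart p T)) u =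
      formMul (wickMul (wickTensor L u)) (degPart p T u) (degPart q a u) -
        formMul (wickMul (wickTensor L u)) (degPart q a u) (degPart p T u) := by
    intro p q
    rw [Pi.sub_apply, Pi.smul_apply]
    simp only [wick]
    by_cases hp : p = 2
    · rw [hp, pow_mul, neg_one_sq, one_pow, one_smul]
    · have h0 : formMul (wickMul (wickTensor L u)) (degPart q a u) 0 = 0 := by
        simpa using formMul_add_right hr' 0 0 (degPart q a u)
      rw [hdeg p hp, h0, smul_zero]
  have hmain : adWick L T a u = formMul (wickMul (wickTensor L u)) (T u) (a u) -
      formMul (wickMul (wickTensor L u)) (a u) (T u) := by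
    rw [adWick]
    simp only [Finset.sum_apply]
    rw [Finset.sum_congr rfl fun p _ => Finset.sum_congr rfl fun q _ => hterm p q]
    simp only [Finset.sum_sub_distrib]
    rw [← sum_degPart T u, ← sum_degPart a u]
    simp only [formMul_sum_left hl, formMul_sum_right hr']
    exact congrArg (_ - ·) Finset.sum_comm
  rw [hmain, hT]
  simp only [formMul_sum_left hl, formMul_sum_right hr', formMul_twoForm_left hl,
    formMul_twoForm_right hr', ← Finset.sum_sub_distrib, ← map_sub]
  rfl

end Fibre

/-! ### Smoothness of the geometric objects -/

section Smoothness

variable {n : ℕ} {L : Coord n → ℝ} {U : Set (Coord n)}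

theorem contDiffOn_fderiv_apply {F : Type*} [NormedAddCommGroup F] [NormedSpace ℝ F]
    {f : Coord n → F} {X : Coord n → Coord n} (hU : IsOpen U) (hf : ContDiffOn ℝ ∞ f U)
    (hX : ContDiffOn ℝ ∞ X U) : ContDiffOn ℝ ∞ (fun u => fderiv ℝ f u (X u)) U :=
  (hf.fderiv_of_isOpen hU le_rfl).clm_apply hX

theorem contDiffOn_pd {f : Coord n → ℝ} (hU : IsOpen U) (hf : ContDiffOn ℝ ∞ f U) (α : Idx n) :
    ContDiffOn ℝ ∞ (pd α f) U :=
  contDiffOn_fderiv_apply hU hf contDiffOn_const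

theorem contDiffOn_vHessian (hU : IsOpen U) (hL : ContDiffOn ℝ ∞ L U) (i j : Fin n) :
    ContDiffOn ℝ ∞ (fun u => vHessian L u i j) U :=
  contDiffOn_const.mul (contDiffOn_pd hU (contDiffOn_pd hU hL _) _)

theorem contDiffOn_det {m : Type*} [Fintype m] [DecidableEq m] {A : Coord n → Matrix m m ℝ}
    (hA : ∀ i j, ContDiffOn ℝ ∞ (fun u => A u i j) U) :
    ContDiffOn ℝ ∞ (fun u => (A u).det) U := by
  simp only [Matrix.det_apply]
  exact ContDiffOn.sum fun σ _ => (contDiffOn_prod fun i _ => hA _ _).const_smul _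

/-- Smoothness of the inverse matrix, by Cramer's rule. -/
theorem contDiffOn_matrix_inv {m : Type*} [Fintype m] [DecidableEq m]
    {A : Coord n → Matrix m m ℝ} (hA : ∀ i j, ContDiffOn ℝ ∞ (fun u => A u i j) U)
    (hdet : ∀ u ∈ U, (A u).det ≠ 0) (i j : m) : ContDiffOn ℝ ∞ (fun u => (A u)⁻¹ i j) U := by
  simp only [Matrix.inv_def, Ring.inverse_eq_inv', Matrix.smul_apply, smul_eq_mul,
    Matrix.adjugate_apply]
  refine ((contDiffOn_det hA).inv hdet).mul (contDiffOn_det fun k l => ?_)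
  simp only [Matrix.updateRow_apply]
  split_ifs
  · exact contDiffOn_const
  · exact hA _ _

theorem contDiffOn_semispray (hU : IsOpen U) (hL : ContDiffOn ℝ ∞ L U)
    (hreg : ∀ u ∈ U, (vHessian L u).det ≠ 0) (i : Fin n) : ContDiffOn ℝ ∞ (semispray L i) U := by
  refine contDiffOn_const.mul (ContDiffOn.sum fun j _ => ?_)
  refine (contDiffOn_matrix_inv (contDiffOn_vHessian hU hL) hreg i j).mul (ContDiffOn.sub ?_ ?_)
  · exact ContDiffOn.sum fun k _ => (contDiffOn_pd hU (contDiffOn_pd hU hL _) _).mul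
      (contDiff_apply ℝ ℝ (Sum.inr k)).contDiffOn
  · exact contDiffOn_pd hU hL _

theorem contDiffOn_nConn (hU : IsOpen U) (hL : ContDiffOn ℝ ∞ L U)
    (hreg : ∀ u ∈ U, (vHessian L u).det ≠ 0) (a i : Fin n) : ContDiffOn ℝ ∞ (nConn L a i) U :=
  contDiffOn_pd hU (contDiffOn_semispray hU hL hreg a) _

/-- The coefficients `N_i^a`, extended by zero to all pairs of indices, so that
`e_α = ∂_α - N^τ_α ∂_τ` and `e^τ = du^τ + N^τ_α du^α`. -/
def nFull (L : Coord n → ℝ) (τ α : Idx n) (u : Coord n) : ℝ :=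
  match τ, α with
  | Sum.inr a, Sum.inl i => nConn L a i u
  | Sum.inr _, Sum.inr _ => 0
  | Sum.inl _, _ => 0

theorem contDiffOn_nFull (hU : IsOpen U) (hL : ContDiffOn ℝ ∞ L U)
    (hreg : ∀ u ∈ U, (vHessian L u).det ≠ 0) (τ α : Idx n) : ContDiffOn ℝ ∞ (nFull L τ α) U := by
  rcases τ with i | a <;> rcases α with j | b
  · exact contDiffOn_const
  · exact contDiffOn_const
  · exact contDiffOn_nConn hU hL hreg a j
  · exact contDiffOn_const

theorem frame_eq (L : Coord n → ℝ) (α : Idx n) (u : Coord n) :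
    frame L α u = coordVec α - ∑ τ, nFull L τ α u • coordVec τ := by
  rcases α with i | a <;> simp [frame, nFull, Fintype.sum_sum_type]

theorem coframe_eq (L : Coord n → ℝ) (τ : Idx n) (u w : Coord n) :
    coframe L τ u w = w τ + ∑ γ, nFull L τ γ u * w γ := by
  rcases τ with i | a <;> simp [coframe, nFull, Fintype.sum_sum_type]

theorem contDiffOn_frame (hU : IsOpen U) (hL : ContDiffOn ℝ ∞ L U)
    (hreg : ∀ u ∈ U, (vHessian L u).det ≠ 0) (α : Idx n) : ContDiffOn ℝ ∞ (frame L α) U := by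
  have : frame L α = fun u => coordVec α - ∑ τ, nFull L τ α u • coordVec τ :=
    funext (frame_eq L α)
  rw [this]
  exact contDiffOn_const.sub (ContDiffOn.sum fun τ _ =>
    (contDiffOn_nFull hU hL hreg τ α).smul contDiffOn_const)

theorem contDiffOn_frameD {F : Type*} [NormedAddCommGroup F] [NormedSpace ℝ F] {f : Coord n → F}
    (hU : IsOpen U) (hL : ContDiffOn ℝ ∞ L U) (hreg : ∀ u ∈ U, (vHessian L u).det ≠ 0)
    (hf : ContDiffOn ℝ ∞ f U) (α : Idx n) : ContDiffOn ℝ ∞ (frameD L α f) U :=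
  contDiffOn_fderiv_apply hU hf (contDiffOn_frame hU hL hreg α)

theorem contDiffOn_normalConn (hU : IsOpen U) (hL : ContDiffOn ℝ ∞ L U)
    (hreg : ∀ u ∈ U, (vHessian L u).det ≠ 0) (γ β α : Idx n) :
    ContDiffOn ℝ ∞ (normalConn L γ β α) U := by
  have hh := contDiffOn_vHessian hU hL
  have hinv := contDiffOn_matrix_inv hh hreg
  have h1 : ∀ i j k, ContDiffOn ℝ ∞ (hCoef L i j k) U := fun i j k =>
    contDiffOn_const.mul (ContDiffOn.sum fun h _ => (hinv i h).mul
      (((contDiffOn_frameD hU hL hreg (hh j h) _).add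
        (contDiffOn_frameD hU hL hreg (hh h k) _)).sub (contDiffOn_frameD hU hL hreg (hh j k) _)))
  have h2 : ∀ i j k, ContDiffOn ℝ ∞ (vCoef L i j k) U := fun i j k =>
    contDiffOn_const.mul (ContDiffOn.sum fun h _ => (hinv i h).mul
      (((contDiffOn_pd hU (hh j h) _).add
        (contDiffOn_pd hU (hh h k) _)).sub (contDiffOn_pd hU (hh j k) _)))
  rcases γ with i | i <;> rcases β with j | j <;> rcases α with k | k
  · exact h1 i j k
  · exact h2 i j k
  · exact contDiffOn_const
  · exact contDiffOn_const
  · exact contDiffOn_const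
  · exact contDiffOn_const
  · exact h1 i j k
  · exact h2 i j k

end Smoothness

/-! ### The adapted frame and its structure functions -/

section Frame

variable {n : ℕ} (L : Coord n → ℝ)

/-- The extended `N` sends horizontal to vertical indices only, so its square is zero. -/
theorem nFull_mul_nFull (τ γ β : Idx n) (u w : Coord n) : nFull L τ γ u * nFull L γ β w = 0 := by
  rcases τ with i | a <;> rcases γ with j | b <;> simp [nFull]

theorem coframe_sub (τ : Idx n) (u v w : Coord n) :
    coframe L τ u (v - w) = coframe L τ u v - coframe L τ u w := by
  simp only [coframe_eq, Pi.sub_apply, mul_sub, Finset.sum_sub_distrib]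
  ring

theorem coframe_sum_smul {ι : Type*} (s : Finset ι) (τ : Idx n) (u : Coord n) (c : ι → ℝ)
    (v : ι → Coord n) :
    coframe L τ u (∑ i ∈ s, c i • v i) = ∑ i ∈ s, c i * coframe L τ u (v i) := by
  simp only [coframe_eq, Finset.sum_apply, Pi.smul_apply, smul_eq_mul, mul_add,
    Finset.sum_add_distrib, Finset.mul_sum]
  rw [Finset.sum_comm (s := s)]
  simp only [mul_left_comm]

theorem coordVec_apply (α β : Idx n) : coordVec α β = if β = α then (1 : ℝ) else 0 := by
  simp [coordVec, Pi.single_apply]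

theorem frame_apply (α β : Idx n) (u : Coord n) :
    frame L α u β = (if β = α then 1 else 0) - nFull L β α u := by
  simp [frame_eq, coordVec_apply, -Fintype.sum_sum_type]

theorem coframe_frame (α β : Idx n) (u : Coord n) :
    coframe L α u (frame L β u) = if α = β then 1 else 0 := by
  simp [coframe_eq, frame_apply, mul_sub, nFull_mul_nFull]

theorem coframe_sum_smul_frame (τ : Idx n) (u : Coord n) (c : Idx n → ℝ) :
    coframe L τ u (∑ γ, c γ • frame L γ u) = c τ := by
  simp [coframe_sum_smul, coframe_frame, -Fintype.sum_sum_type]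

theorem sum_coframe_smul_frame (u w : Coord n) :
    ∑ τ, coframe L τ u w • frame L τ u = w := by
  funext ρ
  simp only [Finset.sum_apply, Pi.smul_apply, smul_eq_mul, frame_apply, mul_sub,
    Finset.sum_sub_distrib, coframe_eq, add_mul, Finset.sum_add_distrib, Finset.sum_mul]
  have h : ∀ x i, nFull L x i u * w i * nFull L ρ x u = 0 := fun x i => by
    rw [mul_right_comm, mul_comm (nFull L x i u), nFull_mul_nFull, zero_mul]
  simp [h, mul_comm (nFull L ρ _ u), -Fintype.sum_sum_type]

/-- The structure functions of the frame: `[e_β, e_α] = c^τ_{βα} e_τ`. -/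
def structCoef (τ β α : Idx n) (u : Coord n) : ℝ :=
  coframe L τ u (VectorField.lieBracket ℝ (frame L β) (frame L α) u)

theorem lieBracket_frame (β α : Idx n) (u : Coord n) :
    VectorField.lieBracket ℝ (frame L β) (frame L α) u =
      ∑ τ, structCoef L τ β α u • frame L τ u :=
  (sum_coframe_smul_frame L u _).symm

variable {L} {U : Set (Coord n)}

/-- The structure functions in terms of the derivatives of `N`. The brackets of frame fields are
vertical, so passing to the coframe changes nothing. -/
theorem structCoef_eq (hU : IsOpen U) (hL : ContDiffOn ℝ ∞ L U)
    (hreg : ∀ u ∈ U, (vHessian L u).det ≠ 0) (τ β α : Idx n) {u : Coord n} (hu : u ∈ U) :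
    structCoef L τ β α u = frameD L α (nFull L τ β) u - frameD L β (nFull L τ α) u := by
  have hd : ∀ σ γ, DifferentiableAt ℝ (nFull L σ γ) u := fun σ γ =>
    ((contDiffOn_nFull hU hL hreg σ γ).contDiffAt (hU.mem_nhds hu)).differentiableAt (by simp)
  have hf : ∀ γ w, fderiv ℝ (frame L γ) u w = -∑ σ, fderiv ℝ (nFull L σ γ) u w • coordVec σ := by
    intro γ w
    have : HasFDerivAt (frame L γ)
        (0 - ∑ σ, (fderiv ℝ (nFull L σ γ) u).smulRight (coordVec σ)) u := by
      rw [show frame L γ = fun u => coordVec γ - ∑ σ, nFull L σ γ u • coordVec σ from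
        funext (frame_eq L γ)]
      exact (hasFDerivAt_const _ _).sub (HasFDerivAt.fun_sum fun σ _ =>
        (hd σ γ).hasFDerivAt.smul_const _)
    rw [this.fderiv]
    simp
  have hb : VectorField.lieBracket ℝ (frame L β) (frame L α) u =
      fun σ => frameD L α (nFull L σ β) u - frameD L β (nFull L σ α) u := by
    rw [VectorField.lieBracket, hf, hf]
    funext ρ
    simp [coordVec_apply, frameD, -Fintype.sum_sum_type]
    ring
  have h0 : ∀ γ δ ε, nFull L τ γ u * frameD L δ (nFull L γ ε) u = 0 := by
    intro γ δ ε
    rcases γ with i | a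
    · have : nFull L (Sum.inl i) ε = fun _ => 0 := by
        funext w
        rcases ε with j | b <;> rfl
      simp [this, frameD]
    · rcases τ with j | b <;> simp [nFull]
  rw [structCoef, hb, coframe_eq]
  simp [mul_sub, h0]

/-- The symmetry of second derivatives, in the adapted frame. -/
theorem frameD_comm {F : Type*} [NormedAddCommGroup F] [NormedSpace ℝ F] {f : Coord n → F}
    (hU : IsOpen U) (hL : ContDiffOn ℝ ∞ L U) (hreg : ∀ u ∈ U, (vHessian L u).det ≠ 0)
    (hf : ContDiffOn ℝ ∞ f U) (β α : Idx n) {u : Coord n} (hu : u ∈ U) :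
    frameD L β (frameD L α f) u - frameD L α (frameD L β f) u =
      ∑ τ, structCoef L τ β α u • frameD L τ f u := by
  have hd : ∀ γ, DifferentiableAt ℝ (frame L γ) u := fun γ =>
    ((contDiffOn_frame hU hL hreg γ).contDiffAt (hU.mem_nhds hu)).differentiableAt (by simp)
  have h := VectorField.fderiv_apply_lieBracket (𝕜 := ℝ) (n := ∞)
    (hf.contDiffAt (hU.mem_nhds hu)) 
    (by simpa using WithTop.coe_le_coe.2 (le_top : (2 : ℕ∞) ≤ ⊤)) (hd α) (hd β)
  rw [lieBracket_frame, map_sum] at h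
  simp only [map_smul] at h
  exact h.symm

end Frame

/-! ### Torsion and curvature coefficients -/

section Coefficients

variable {n : ℕ} (L : Coord n → ℝ)

theorem covD_frame_sum (β : Idx n) (f : Idx n → Coord n → ℝ) (u : Coord n) :
    covD L (frame L β) (fun w => ∑ γ, f γ w • frame L γ w) u =
      ∑ γ, (frameD L β (f γ) u + ∑ σ, normalConn L γ σ β u * f σ u) • frame L γ u := by
  simp only [covD, coframe_frame, coframe_sum_smul_frame, ite_mul, one_mul, zero_mul,
    Finset.sum_ite_eq', Finset.mem_univ, if_true]

theorem covD_apply_frame (X : Coord n → Coord n) (φ : Idx n) (u : Coord n) :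
    covD L X (frame L φ) u =
      ∑ γ, (∑ α, coframe L α u (X u) * normalConn L γ φ α u) • frame L γ u := by
  have h : ∀ α γ : Idx n, frameD L α (fun _ => if γ = φ then (1 : ℝ) else 0) u = 0 :=
    fun α γ => by simp [frameD]
  simp only [covD, coframe_frame, h, mul_ite, mul_one, mul_zero, Finset.sum_ite_eq',
    Finset.mem_univ, if_true, zero_add]

theorem covD_frame_frame (β φ : Idx n) (u : Coord n) :
    covD L (frame L β) (frame L φ) u = ∑ γ, normalConn L γ φ β u • frame L γ u := by
  simp only [covD_apply_frame, coframe_frame, ite_mul, one_mul, zero_mul, Finset.sum_ite_eq',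
    Finset.mem_univ, if_true]

theorem torsionCoef_eq (τ α β : Idx n) (u : Coord n) :
    torsionCoef L τ α β u =
      normalConn L τ α β u - normalConn L τ β α u - structCoef L τ β α u := by
  rw [torsionCoef, torsion, coframe_sub, coframe_sub, covD_frame_frame, covD_frame_frame,
    coframe_sum_smul_frame, coframe_sum_smul_frame]
  rfl

theorem curvatureCoef_eq (τ φ α β : Idx n) (u : Coord n) :
    curvatureCoef L τ φ α β u =
      (frameD L β (normalConn L τ φ α) u + ∑ σ, normalConn L τ σ β u * normalConn L σ φ α u)
      - (frameD L α (normalConn L τ φ β) u + ∑ σ, normalConn L τ σ α u * normalConn L σ φ β u)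
      - ∑ σ, structCoef L σ β α u * normalConn L τ φ σ u := by
  have h : ∀ α, covD L (frame L α) (frame L φ) =
      fun w => ∑ γ, normalConn L γ φ α w • frame L γ w := fun α =>
    funext fun u => covD_frame_frame L α φ u
  rw [curvatureCoef, curvature, coframe_sub, coframe_sub, h, h, covD_frame_sum, covD_frame_sum,
    covD_apply_frame, coframe_sum_smul_frame, coframe_sum_smul_frame, coframe_sum_smul_frame]
  rfl

variable {L} {U : Set (Coord n)}

theorem contDiffOn_structCoef (hU : IsOpen U) (hL : ContDiffOn ℝ ∞ L U)
    (hreg : ∀ u ∈ U, (vHessian L u).det ≠ 0) (τ β α : Idx n) :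
    ContDiffOn ℝ ∞ (structCoef L τ β α) U :=
  ((contDiffOn_frameD hU hL hreg (contDiffOn_nFull hU hL hreg τ β) α).sub
    (contDiffOn_frameD hU hL hreg (contDiffOn_nFull hU hL hreg τ α) β)).congr
    fun _ hu => structCoef_eq hU hL hreg τ β α hu

theorem contDiffOn_torsionCoef (hU : IsOpen U) (hL : ContDiffOn ℝ ∞ L U)
    (hreg : ∀ u ∈ U, (vHessian L u).det ≠ 0) (τ α β : Idx n) :
    ContDiffOn ℝ ∞ (torsionCoef L τ α β) U :=
  (((contDiffOn_normalConn hU hL hreg τ α β).sub (contDiffOn_normalConn hU hL hreg τ β α)).sub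
    (contDiffOn_structCoef hU hL hreg τ β α)).congr fun u _ => torsionCoef_eq L τ α β u

theorem contDiffOn_curvatureCoef (hU : IsOpen U) (hL : ContDiffOn ℝ ∞ L U)
    (hreg : ∀ u ∈ U, (vHessian L u).det ≠ 0) (τ φ α β : Idx n) :
    ContDiffOn ℝ ∞ (curvatureCoef L τ φ α β) U := by
  have hΓ := contDiffOn_normalConn hU hL hreg
  have hc := contDiffOn_structCoef hU hL hreg
  have h1 : ∀ α β, ContDiffOn ℝ ∞ (fun u => frameD L β (normalConn L τ φ α) u +
      ∑ σ, normalConn L τ σ β u * normalConn L σ φ α u) U := fun α β =>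
    (contDiffOn_frameD hU hL hreg (hΓ τ φ α) β).add
      (ContDiffOn.sum fun σ _ => (hΓ τ σ β).mul (hΓ σ φ α))
  exact (((h1 α β).sub (h1 β α)).sub (ContDiffOn.sum fun σ _ =>
    (hc σ β α).mul (hΓ τ φ σ))).congr fun u _ => curvatureCoef_eq L τ φ α β u

theorem contDiffOn_metric (hU : IsOpen U) (hL : ContDiffOn ℝ ∞ L U) (α β : Idx n) :
    ContDiffOn ℝ ∞ (fun u => metric L u α β) U := by
  rcases α with i | i <;> rcases β with j | j
  · exact contDiffOn_vHessian hU hL i j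
  · exact contDiffOn_const
  · exact contDiffOn_const
  · exact contDiffOn_vHessian hU hL i j

theorem contDiffOn_theta (hU : IsOpen U) (hL : ContDiffOn ℝ ∞ L U) (α β : Idx n) :
    ContDiffOn ℝ ∞ (fun u => theta L u α β) U :=
  ContDiffOn.sum fun γ _ => contDiffOn_const.mul (contDiffOn_metric hU hL γ β)

end Coefficients

/-! ### Compatibility of the normal connection with the metric and the complex structure -/

section Compatibility

variable {n : ℕ} {L : Coord n → ℝ} {U : Set (Coord n)}

theorem vHessian_symm (hU : IsOpen U) (hL : ContDiffOn ℝ ∞ L U) (i j : Fin n) {u : Coord n}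
    (hu : u ∈ U) : vHessian L u i j = vHessian L u j i := by
  have h := VectorField.fderiv_apply_lieBracket (𝕜 := ℝ) (n := ∞)
    (V := fun _ => coordVec (Sum.inr i)) (W := fun _ => coordVec (Sum.inr j))
    (hL.contDiffAt (hU.mem_nhds hu)) (by simpa using WithTop.coe_le_coe.2 (le_top : (2 : ℕ∞) ≤ ⊤))
    (differentiableAt_const _) (differentiableAt_const _)
  have h0 : VectorField.lieBracket ℝ (fun _ : Coord n => (coordVec (Sum.inr i) : Coord n))
      (fun _ => coordVec (Sum.inr j)) u = 0 := by
    simp [VectorField.lieBracket]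
  rw [h0, map_zero] at h
  exact congrArg (1 / 2 * ·) (sub_eq_zero.1 h.symm)

theorem frameD_congr {F : Type*} [NormedAddCommGroup F] [NormedSpace ℝ F] {f g : Coord n → F}
    (hU : IsOpen U) (h : ∀ w ∈ U, f w = g w) (α : Idx n) {u : Coord n} (hu : u ∈ U) :
    frameD L α f u = frameD L α g u := by
  rw [frameD, frameD, Filter.EventuallyEq.fderiv_eq (Filter.eventuallyEq_of_mem (hU.mem_nhds hu) h)]

/-- The defining property of Christoffel symbols formed with symmetric symbols `D k i j`, which
stand for the derivative of `h_{ij}` in the direction `k`. -/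
theorem christoffel_compat {h : Matrix (Fin n) (Fin n) ℝ} (hdet : h.det ≠ 0)
    (hsymm : ∀ i j, h i j = h j i) (D : Fin n → Fin n → Fin n → ℝ)
    (hD : ∀ k i j, D k i j = D k j i) (Γ : Fin n → Fin n → Fin n → ℝ)
    (hΓ : ∀ i j k, Γ i j k = (1 / 2) * ∑ l, h⁻¹ i l * (D k j l + D j l k - D l j k))
    (k i j : Fin n) : D k i j = ∑ m, (h i m * Γ m j k + Γ m i k * h m j) := by
  have hlow : ∀ i j, ∑ m, h i m * Γ m j k = (1 / 2) * (D k j i + D j i k - D i j k) := by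
    intro i j
    have h1 : ∀ l, ∑ m, h i m * h⁻¹ m l = if i = l then 1 else 0 := by
      intro l
      rw [← Matrix.mul_apply, Matrix.mul_nonsing_inv _ (isUnit_iff_ne_zero.2 hdet),
        Matrix.one_apply]
    calc ∑ m, h i m * Γ m j k
        = (1 / 2) * ∑ l, (∑ m, h i m * h⁻¹ m l) * (D k j l + D j l k - D l j k) := by
          simp only [hΓ, Finset.mul_sum, Finset.sum_mul]
          rw [Finset.sum_comm]
          refine Finset.sum_congr rfl fun l _ => Finset.sum_congr rfl fun m _ => ?_
          ring
      _ = _ := by simp [h1]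
  rw [Finset.sum_add_distrib, hlow, Finset.sum_congr rfl fun m _ =>
    (by rw [hsymm m j, mul_comm] : Γ m i k * h m j = h j m * Γ m i k), hlow, hD k j i, hD i j k,
    hD j i k]
  ring

/-- The normal d-connection is metric. -/
theorem frameD_metric (hU : IsOpen U) (hL : ContDiffOn ℝ ∞ L U)
    (hreg : ∀ u ∈ U, (vHessian L u).det ≠ 0) (α β γ : Idx n) {u : Coord n} (hu : u ∈ U) :
    frameD L α (fun w => metric L w β γ) u = ∑ σ, (metric L u β σ * normalConn L σ γ α u +
      normalConn L σ β α u * metric L u σ γ) := by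
  have hs : ∀ i j, vHessian L u i j = vHessian L u j i := fun i j => vHessian_symm hU hL i j hu
  have hDs : ∀ α i j, frameD L α (fun w => vHessian L w i j) u =
      frameD L α (fun w => vHessian L w j i) u := fun α i j =>
    frameD_congr hU (fun w hw => vHessian_symm hU hL i j hw) α hu
  have hH := christoffel_compat (hreg u hu) hs
    (fun k i j => frameD L (Sum.inl k) (fun w => vHessian L w i j) u) (fun k => hDs _)
    (fun i j k => hCoef L i j k u) (fun i j k => rfl)
  have hV := christoffel_compat (hreg u hu) hs
    (fun k i j => frameD L (Sum.inr k) (fun w => vHessian L w i j) u) (fun k => hDs _)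
    (fun i j k => vCoef L i j k u) (fun i j k => rfl)
  rw [Fintype.sum_sum_type]
  rcases α with k | k <;> rcases β with i | i <;> rcases γ with j | j
  · simpa [metric, normalConn] using hH k i j
  · simp [metric, normalConn, frameD]
  · simp [metric, normalConn, frameD]
  · simpa [metric, normalConn] using hH k i j
  · simpa [metric, normalConn] using hV k i j
  · simp [metric, normalConn, frameD]
  · simp [metric, normalConn, frameD]
  · simpa [metric, normalConn] using hV k i j

/-- The matrix `Γ^γ_{βα}` of the connection in the direction `α`. -/
def connMatrix (L : Coord n → ℝ) (α : Idx n) (u : Coord n) : Matrix (Idx n) (Idx n) ℝ :=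
  Matrix.of fun γ β => normalConn L γ β α u

/-- The matrix `R^τ_{φαβ}` of the curvature on the pair of directions `α`, `β`. -/
def curvMatrix (L : Coord n → ℝ) (α β : Idx n) (u : Coord n) : Matrix (Idx n) (Idx n) ℝ :=
  Matrix.of fun τ φ => curvatureCoef L τ φ α β u

/-- The derivative along `e_β` of the connection matrix in the direction `α`. -/
def connMatrixD (L : Coord n → ℝ) (β α : Idx n) (u : Coord n) : Matrix (Idx n) (Idx n) ℝ :=
  Matrix.of fun τ φ => frameD L β (normalConn L τ φ α) u

theorem curvMatrix_eq (L : Coord n → ℝ) (α β : Idx n) (u : Coord n) :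
    curvMatrix L α β u = connMatrixD L β α u - connMatrixD L α β u +
      (connMatrix L β u * connMatrix L α u - connMatrix L α u * connMatrix L β u) -
      ∑ σ, structCoef L σ β α u • connMatrix L σ u := by
  ext τ φ
  simp only [curvMatrix, connMatrix, connMatrixD, Matrix.of_apply, Matrix.add_apply,
    Matrix.sub_apply, Matrix.mul_apply, Matrix.sum_apply, Matrix.smul_apply, smul_eq_mul,
    curvatureCoef_eq]
  ring

theorem almostComplex_mul_connMatrix (L : Coord n → ℝ) (α : Idx n) (u : Coord n) :
    almostComplex n * connMatrix L α u = connMatrix L α u * almostComplex n := by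
  obtain ⟨B, hB⟩ : ∃ B : Matrix (Fin n) (Fin n) ℝ,
      connMatrix L α u = Matrix.fromBlocks B 0 0 B := by
    refine ⟨Matrix.of fun i j => normalConn L (Sum.inl i) (Sum.inl j) α u, ?_⟩
    ext (i | i) (j | j) <;> rcases α with k | k <;> simp [connMatrix, normalConn]
  rw [hB, almostComplex, Matrix.fromBlocks_multiply, Matrix.fromBlocks_multiply]
  simp

theorem almostComplex_mul_connMatrixD (L : Coord n → ℝ) (β α : Idx n) (u : Coord n) :
    almostComplex n * connMatrixD L β α u = connMatrixD L β α u * almostComplex n := by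
  obtain ⟨B, hB⟩ : ∃ B : Matrix (Fin n) (Fin n) ℝ,
      connMatrixD L β α u = Matrix.fromBlocks B 0 0 B := by
    refine ⟨Matrix.of fun i j => frameD L β (normalConn L (Sum.inl i) (Sum.inl j) α) u, ?_⟩
    have h0 : frameD L β (fun _ => (0 : ℝ)) u = 0 := by simp [frameD]
    ext (i | i) (j | j)
    · rfl
    · exact h0
    · exact h0
    · rcases α with k | k <;> rfl
  rw [hB, almostComplex, Matrix.fromBlocks_multiply, Matrix.fromBlocks_multiply]
  simp

/-- The curvature commutes with the almost complex structure. -/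
theorem almostComplex_mul_curvMatrix (L : Coord n → ℝ) (α β : Idx n) (u : Coord n) :
    almostComplex n * curvMatrix L α β u = curvMatrix L α β u * almostComplex n := by
  have h2 : ∀ α β, almostComplex n * (connMatrix L α u * connMatrix L β u) =
      connMatrix L α u * connMatrix L β u * almostComplex n := fun α β => by
    rw [← mul_assoc, almostComplex_mul_connMatrix, mul_assoc, almostComplex_mul_connMatrix,
      mul_assoc]
  simp only [curvMatrix_eq, mul_sub, mul_add, sub_mul, add_mul, Finset.mul_sum, Finset.sum_mul,
    mul_smul_comm, smul_mul_assoc, almostComplex_mul_connMatrixD, almostComplex_mul_connMatrix, h2]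

theorem frameD_sum_mul_add_mul (hU : IsOpen U) (β : Idx n) {u : Coord n} (hu : u ∈ U)
    {a b c d : Idx n → Coord n → ℝ} (ha : ∀ σ, ContDiffOn ℝ ∞ (a σ) U)
    (hb : ∀ σ, ContDiffOn ℝ ∞ (b σ) U) (hc : ∀ σ, ContDiffOn ℝ ∞ (c σ) U)
    (hd : ∀ σ, ContDiffOn ℝ ∞ (d σ) U) :
    frameD L β (fun w => ∑ σ, (a σ w * b σ w + c σ w * d σ w)) u =
      ∑ σ, ((frameD L β (a σ) u * b σ u + a σ u * frameD L β (b σ) u) +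
        (frameD L β (c σ) u * d σ u + c σ u * frameD L β (d σ) u)) := by
  have hdiff : ∀ {f : Coord n → ℝ}, ContDiffOn ℝ ∞ f U → HasFDerivAt f (fderiv ℝ f u) u :=
    fun hf => ((hf.contDiffAt (hU.mem_nhds hu)).differentiableAt (by simp)).hasFDerivAt
  have h := HasFDerivAt.fun_sum (u := Finset.univ) fun σ _ =>
    ((hdiff (ha σ)).mul (hdiff (hb σ))).add ((hdiff (hc σ)).mul (hdiff (hd σ)))
  rw [frameD]
  erw [h.fderiv]
  simp only [sum_apply, add_apply, smul_apply, smul_eq_mul]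
  refine Finset.sum_congr rfl fun σ _ => ?_
  simp only [frameD]
  ring

/-- The curvature of a metric connection is skew-symmetric for the metric. -/
theorem metric_mul_curvMatrix (hU : IsOpen U) (hL : ContDiffOn ℝ ∞ L U)
    (hreg : ∀ u ∈ U, (vHessian L u).det ≠ 0) (α β : Idx n) {u : Coord n} (hu : u ∈ U) :
    metric L u * curvMatrix L α β u + (curvMatrix L α β u).transpose * metric L u = 0 := by
  set G := metric L u with hG
  set A : Idx n → Matrix (Idx n) (Idx n) ℝ := fun α => connMatrix L α u with hA
  let dG : Idx n → Matrix (Idx n) (Idx n) ℝ := fun α =>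
    Matrix.of fun i j => frameD L α (fun w => metric L w i j) u
  let ddG : Idx n → Idx n → Matrix (Idx n) (Idx n) ℝ := fun β α =>
    Matrix.of fun i j => frameD L β (frameD L α (fun w => metric L w i j)) u
  have hdG : ∀ α, dG α = G * A α + (A α).transpose * G := by
    intro α
    ext i j
    change frameD L α (fun w => metric L w i j) u = _
    rw [frameD_metric hU hL hreg α i j hu, Finset.sum_add_distrib]
    rfl
  have hddG : ∀ β α, ddG β α = dG β * A α + G * connMatrixD L β α u +
      ((connMatrixD L β α u).transpose * G + (A α).transpose * dG β) := by
    intro β α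
    ext i j
    change frameD L β (frameD L α (fun w => metric L w i j)) u = _
    rw [frameD_congr hU (fun w hw => frameD_metric hU hL hreg α i j hw) β hu,
      frameD_sum_mul_add_mul hU β hu (fun σ => contDiffOn_metric hU hL i σ)
        (fun σ => contDiffOn_normalConn hU hL hreg σ j α)
        (fun σ => contDiffOn_normalConn hU hL hreg σ i α)
        (fun σ => contDiffOn_metric hU hL σ j)]
    simp only [Finset.sum_add_distrib]
    rfl
  -- The second derivatives of the metric commute up to the structure functions; expanding both
  -- sides by metricity leaves the asserted identity.
  have hcomm : ddG β α - ddG α β = ∑ σ, structCoef L σ β α u • dG σ := by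
    ext i j
    simp only [Matrix.sum_apply]
    exact frameD_comm hU hL hreg (contDiffOn_metric hU hL i j) β α hu
  have hsum : ∑ σ, structCoef L σ β α u • dG σ =
      G * (∑ σ, structCoef L σ β α u • A σ) +
        (∑ σ, structCoef L σ β α u • A σ).transpose * G := by
    simp only [hdG, smul_add, Finset.sum_add_distrib, Finset.mul_sum, Matrix.transpose_sum,
      Finset.sum_mul, Matrix.transpose_smul, mul_smul_comm, smul_mul_assoc]
  rw [hsum, hddG, hddG, hdG, hdG] at hcomm
  rw [curvMatrix_eq]
  simp only [Matrix.transpose_sub, Matrix.transpose_add, Matrix.transpose_mul]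
  rw [← sub_eq_zero] at hcomm
  rw [← hcomm]
  noncomm_ring

end Compatibility

/-! ### The almost symplectic form -/

section Symplectic

variable {n : ℕ} {L : Coord n → ℝ} {U : Set (Coord n)}

/-- The matrix of the almost symplectic form. -/
def thetaMatrix (L : Coord n → ℝ) (u : Coord n) : Matrix (Idx n) (Idx n) ℝ := Matrix.of (theta L u)

/-- The matrix of the form `θ^{αβ}`. -/
def thetaUpMatrix (L : Coord n → ℝ) (u : Coord n) : Matrix (Idx n) (Idx n) ℝ :=
  Matrix.of (thetaUp L u)

theorem thetaMatrix_eq (L : Coord n → ℝ) (u : Coord n) :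
    thetaMatrix L u = (almostComplex n).transpose * metric L u := by
  ext α β
  rfl

theorem thetaUpMatrix_eq (L : Coord n → ℝ) (u : Coord n) :
    thetaUpMatrix L u = invMetric L u * thetaMatrix L u * (invMetric L u).transpose := by
  ext α β
  simp only [thetaUpMatrix, thetaMatrix, thetaUp, Matrix.mul_apply, Matrix.of_apply,
    Matrix.transpose_apply, Finset.sum_mul]
  rw [Finset.sum_comm]
  refine Finset.sum_congr rfl fun δ _ => Finset.sum_congr rfl fun γ _ => ?_
  ring

theorem almostComplex_transpose : (almostComplex n).transpose = -almostComplex n := by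
  rw [almostComplex, Matrix.fromBlocks_transpose, Matrix.fromBlocks_neg]
  simp

theorem almostComplex_mul_self : almostComplex n * almostComplex n = -1 := by
  rw [almostComplex, Matrix.fromBlocks_multiply, ← Matrix.fromBlocks_one, Matrix.fromBlocks_neg]
  simp

theorem almostComplex_mul_metric (u : Coord n) :
    almostComplex n * metric L u = metric L u * almostComplex n := by
  rw [almostComplex, metric, Matrix.fromBlocks_multiply, Matrix.fromBlocks_multiply]
  simp

theorem metric_transpose (hU : IsOpen U) (hL : ContDiffOn ℝ ∞ L U) {u : Coord n} (hu : u ∈ U) :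
    (metric L u).transpose = metric L u := by
  have : (vHessian L u).transpose = vHessian L u := by
    ext i j
    exact vHessian_symm hU hL j i hu
  rw [metric, Matrix.fromBlocks_transpose, this]
  simp

theorem isUnit_det_metric (hreg : ∀ u ∈ U, (vHessian L u).det ≠ 0) {u : Coord n} (hu : u ∈ U) :
    IsUnit (metric L u).det := by
  rw [metric, Matrix.det_fromBlocks_zero₂₁]
  exact isUnit_iff_ne_zero.2 (mul_ne_zero (hreg u hu) (hreg u hu))

theorem invMetric_transpose (hU : IsOpen U) (hL : ContDiffOn ℝ ∞ L U) {u : Coord n}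
    (hu : u ∈ U) : (invMetric L u).transpose = invMetric L u := by
  rw [invMetric, Matrix.transpose_nonsing_inv, metric_transpose hU hL hu]

theorem thetaUpMatrix_eq_neg_mul (hU : IsOpen U) (hL : ContDiffOn ℝ ∞ L U)
    (hreg : ∀ u ∈ U, (vHessian L u).det ≠ 0) {u : Coord n} (hu : u ∈ U) :
    thetaUpMatrix L u = -(almostComplex n * invMetric L u) := by
  rw [thetaUpMatrix_eq, invMetric_transpose hU hL hu, thetaMatrix_eq, almostComplex_transpose,
    neg_mul, almostComplex_mul_metric, mul_neg, ← mul_assoc, invMetric,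
    Matrix.nonsing_inv_mul _ (isUnit_det_metric hreg hu), one_mul, neg_mul]

theorem almostComplex_mul_invMetric (hreg : ∀ u ∈ U, (vHessian L u).det ≠ 0) {u : Coord n}
    (hu : u ∈ U) : almostComplex n * invMetric L u = invMetric L u * almostComplex n := by
  have h1 := Matrix.nonsing_inv_mul _ (isUnit_det_metric hreg hu)
  have h2 := Matrix.mul_nonsing_inv _ (isUnit_det_metric hreg hu)
  calc almostComplex n * (metric L u)⁻¹
      = (metric L u)⁻¹ * (metric L u * almostComplex n) * (metric L u)⁻¹ := by
        rw [← mul_assoc, h1, one_mul]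
    _ = _ := by
        rw [← almostComplex_mul_metric, mul_assoc, mul_assoc, h2, mul_one]
        rfl

theorem thetaUpMatrix_transpose (hU : IsOpen U) (hL : ContDiffOn ℝ ∞ L U)
    (hreg : ∀ u ∈ U, (vHessian L u).det ≠ 0) {u : Coord n} (hu : u ∈ U) :
    (thetaUpMatrix L u).transpose = -thetaUpMatrix L u := by
  rw [thetaUpMatrix_eq_neg_mul hU hL hreg hu, Matrix.transpose_neg, Matrix.transpose_mul,
    invMetric_transpose hU hL hu, almostComplex_transpose, mul_neg,
    almostComplex_mul_invMetric hreg hu]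

/-- The bivector `θ^{αβ}` inverts the form `θ_{αβ}`, up to the transposition in
`θ^{αβ} θ_{ατ} = δ^β_τ`. -/
theorem thetaUpMatrix_transpose_mul (hU : IsOpen U) (hL : ContDiffOn ℝ ∞ L U)
    (hreg : ∀ u ∈ U, (vHessian L u).det ≠ 0) {u : Coord n} (hu : u ∈ U) :
    (thetaUpMatrix L u).transpose * thetaMatrix L u = 1 := by
  rw [thetaUpMatrix_transpose hU hL hreg hu, thetaUpMatrix_eq_neg_mul hU hL hreg hu, neg_neg,
    thetaMatrix_eq, almostComplex_transpose, neg_mul, almostComplex_mul_metric, mul_neg,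
    mul_assoc, ← mul_assoc (invMetric L u), invMetric,
    Matrix.nonsing_inv_mul _ (isUnit_det_metric hreg hu), one_mul, almostComplex_mul_self, neg_neg]

theorem wickTensor_eq (u : Coord n) (α β : Idx n) :
    wickTensor L u α β = (thetaUpMatrix L u α β : ℂ) - Complex.I * (invMetric L u α β : ℂ) := rfl

theorem wickTensor_swap (hU : IsOpen U) (hL : ContDiffOn ℝ ∞ L U)
    (hreg : ∀ u ∈ U, (vHessian L u).det ≠ 0) {u : Coord n} (hu : u ∈ U) (α β : Idx n) :
    wickTensor L u β α = -(thetaUpMatrix L u α β : ℂ) - Complex.I * (invMetric L u α β : ℂ) := by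
  have h1 : thetaUpMatrix L u β α = -thetaUpMatrix L u α β := by
    have := congrFun (congrFun (thetaUpMatrix_transpose hU hL hreg hu) α) β
    simpa using this
  have h2 : invMetric L u β α = invMetric L u α β :=
    congrFun (congrFun (invMetric_transpose hU hL hu) α) β
  rw [wickTensor_eq, h1, h2, Complex.ofReal_neg]

/-- The difference `Λ^{αβ} - Λ^{βα} = 2θ^{αβ}` cancels the lowering of an index by `θ`. -/
theorem sum_wickTensor_mul_theta (hU : IsOpen U) (hL : ContDiffOn ℝ ∞ L U)
    (hreg : ∀ u ∈ U, (vHessian L u).det ≠ 0) {u : Coord n} (hu : u ∈ U) (c : ℝ)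
    (T : Idx n → ℝ) (β : Idx n) :
    ∑ α, (wickTensor L u α β - wickTensor L u β α) * ((∑ τ, c * theta L u α τ * T τ : ℝ) : ℂ) =
      ((2 * c * T β : ℝ) : ℂ) := by
  have h : ∑ α, thetaUpMatrix L u α β * ∑ τ, c * theta L u α τ * T τ = c * T β := by
    have h1 : ∀ τ, ∑ α, thetaUpMatrix L u α β * theta L u α τ = if β = τ then 1 else 0 := by
      intro τ
      have := congrFun (congrFun (thetaUpMatrix_transpose_mul hU hL hreg hu) β) τ
      rwa [Matrix.one_apply] at this
    calc _ = ∑ τ, (∑ α, thetaUpMatrix L u α β * theta L u α τ) * (c * T τ) := by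
          simp only [Finset.mul_sum, Finset.sum_mul]
          rw [Finset.sum_comm]
          refine Finset.sum_congr rfl fun τ _ => Finset.sum_congr rfl fun α _ => ?_
          ring
      _ = _ := by simp [h1, -Fintype.sum_sum_type]
  rw [mul_assoc, ← h]
  push_cast
  rw [Finset.mul_sum]
  refine Finset.sum_congr rfl fun α _ => ?_
  rw [wickTensor_swap hU hL hreg hu α β, wickTensor_eq]
  ring

/-- The curvature with its first index lowered by `θ` is symmetric: it is skew for `g`, and the
complex structure, which commutes with the curvature, is skew as well. -/
theorem theta_curvature_symm (hU : IsOpen U) (hL : ContDiffOn ℝ ∞ L U)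
    (hreg : ∀ u ∈ U, (vHessian L u).det ≠ 0) {u : Coord n} (hu : u ∈ U) (α β : Idx n) :
    (thetaMatrix L u * curvMatrix L α β u).transpose = thetaMatrix L u * curvMatrix L α β u := by
  have h := metric_mul_curvMatrix hU hL hreg α β hu
  have hJ := almostComplex_mul_curvMatrix L α β u
  have h' : (curvMatrix L α β u).transpose * metric L u = -(metric L u * curvMatrix L α β u) :=
    eq_neg_of_add_eq_zero_right h
  rw [thetaMatrix_eq, Matrix.transpose_mul, Matrix.transpose_mul, Matrix.transpose_transpose,
    metric_transpose hU hL hu, ← mul_assoc, h', almostComplex_transpose, neg_mul, neg_mul,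
    neg_mul, almostComplex_mul_metric, mul_assoc, mul_assoc, hJ]

/-- Skew-symmetry of the curvature makes the terms of second order in the Wick commutator with the
curvature element vanish. -/
theorem sum_wickTensor_mul_curvature (hU : IsOpen U) (hL : ContDiffOn ℝ ∞ L U)
    (hreg : ∀ u ∈ U, (vHessian L u).det ≠ 0) {u : Coord n} (hu : u ∈ U) (c : ℝ)
    (μ ν β δ : Idx n) :
    ∑ α, ∑ γ, (wickTensor L u α β * wickTensor L u γ δ - wickTensor L u β α * wickTensor L u δ γ) *
      ((c * (thetaMatrix L u * curvMatrix L μ ν u) α γ : ℝ) : ℂ) = 0 := by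
  set S := thetaMatrix L u * curvMatrix L μ ν u with hS
  set t := thetaUpMatrix L u with ht
  set g := invMetric L u with hg
  set R := curvMatrix L μ ν u with hR
  have hg1 := Matrix.nonsing_inv_mul _ (isUnit_det_metric hreg hu)
  have hg2 := Matrix.mul_nonsing_inv _ (isUnit_det_metric hreg hu)
  have htS : t.transpose * S = R := by
    rw [hS, ← mul_assoc, thetaUpMatrix_transpose_mul hU hL hreg hu, one_mul]
  have hSt : S * t = R.transpose := by
    rw [← htS, Matrix.transpose_mul, Matrix.transpose_transpose,
      theta_curvature_symm hU hL hreg hu]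
  have hRg : R * g + g * R.transpose = 0 := by
    have h := congrArg (fun M => g * M * g) (metric_mul_curvMatrix hU hL hreg μ ν hu)
    simp only [mul_add, add_mul, mul_zero, zero_mul] at h
    rw [← mul_assoc, hg, invMetric, hg1, one_mul, mul_assoc, mul_assoc, hg2, mul_one] at h
    exact h
  have hzero : t.transpose * S * g + g.transpose * S * t = 0 := by
    rw [htS, hg, invMetric_transpose hU hL hu, mul_assoc, hSt]
    exact hRg
  have hentry : ∑ α, ∑ γ, (t α β * g γ δ + g α β * t γ δ) * S α γ = 0 := by
    have := congrFun (congrFun hzero β) δ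
    simp only [Matrix.add_apply, Matrix.mul_apply, Matrix.transpose_apply, Matrix.zero_apply,
      Finset.sum_mul] at this
    rw [Finset.sum_comm, ← this]
    simp only [← Finset.sum_add_distrib]
    refine Finset.sum_congr rfl fun α _ => Finset.sum_congr rfl fun γ _ => ?_
    ring
  calc _ = -2 * Complex.I * c * ((∑ α, ∑ γ, (t α β * g γ δ + g α β * t γ δ) * S α γ : ℝ) : ℂ) := by
        push_cast
        simp only [Finset.mul_sum]
        refine Finset.sum_congr rfl fun α _ => Finset.sum_congr rfl fun γ _ => ?_
        rw [wickTensor_swap hU hL hreg hu α β, wickTensor_swap hU hL hreg hu γ δ, wickTensor_eq,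
          wickTensor_eq]
        ring
    _ = 0 := by rw [hentry, Complex.ofReal_zero, mul_zero]

end Symplectic

/-! ### Differential calculus of series-valued functions -/

section SeriesCalculus

variable {n : ℕ} {L : Coord n → ℝ} {U : Set (Coord n)}

/-- A function with values in the formal series is smooth on `U` if all its coefficients are. -/
def SmoothSeries (U : Set (Coord n)) (f : Coord n → WickFibre n) : Prop :=
  ∀ (r : ℕ) (m : Idx n →₀ ℕ),
    ContDiffOn ℝ ∞ (fun u => MvPowerSeries.coeff m (PowerSeries.coeff r (f u))) U

namespace SmoothSeries

theorem const (c : WickFibre n) : SmoothSeries U fun _ => c := fun _ _ => contDiffOn_const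

theorem add {f g : Coord n → WickFibre n} (hf : SmoothSeries U f) (hg : SmoothSeries U g) :
    SmoothSeries U fun u => f u + g u := fun r m => by
  simpa only [map_add] using (hf r m).add (hg r m)

theorem sub {f g : Coord n → WickFibre n} (hf : SmoothSeries U f) (hg : SmoothSeries U g) :
    SmoothSeries U fun u => f u - g u := fun r m => by
  simpa only [map_sub] using (hf r m).sub (hg r m)

theorem sum {ι : Type*} {s : Finset ι} {f : ι → Coord n → WickFibre n}
    (hf : ∀ i ∈ s, SmoothSeries U (f i)) : SmoothSeries U fun u => ∑ i ∈ s, f i u := fun r m => by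
  simpa only [map_sum] using ContDiffOn.sum fun i hi => hf i hi r m

theorem mul {f g : Coord n → WickFibre n} (hf : SmoothSeries U f) (hg : SmoothSeries U g) :
    SmoothSeries U fun u => f u * g u := fun r m => by
  simp only [PowerSeries.coeff_mul, MvPowerSeries.coeff_mul, map_sum]
  exact ContDiffOn.sum fun x _ => ContDiffOn.sum fun y _ => (hf _ _).mul (hg _ _)

theorem zDeriv {f : Coord n → WickFibre n} (hf : SmoothSeries U f) (α : Idx n) :
    SmoothSeries U fun u => zDeriv α (f u) := fun r m => by
  simp only [coeff_zDeriv, MvPowerSeries.coeff_pderiv]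
  exact (hf _ _).mul contDiffOn_const

theorem zsmul {f : Coord n → WickFibre n} (hf : SmoothSeries U f) (k : ℤ) :
    SmoothSeries U fun u => k • f u := by
  simpa only [zsmul_eq_mul] using (const _).mul hf

end SmoothSeries

theorem coeff_coeff_scalar (c : ℂ) (r : ℕ) (m : Idx n →₀ ℕ) :
    MvPowerSeries.coeff m (PowerSeries.coeff r (scalar c : WickFibre n)) =
      (if r = 0 ∧ m = 0 then 1 else 0) * c := by
  classical
  rw [scalar, PowerSeries.coeff_C]
  by_cases hr : r = 0
  · by_cases hm : m = 0
    · simp [hr, hm]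
    · simp [hr, hm, MvPowerSeries.coeff_C]
  · simp [hr]

theorem smoothSeries_scalar {f : Coord n → ℝ} (hf : ContDiffOn ℝ ∞ f U) :
    SmoothSeries U fun u => scalar (f u : ℂ) := fun r m => by
  simp only [coeff_coeff_scalar]
  exact contDiffOn_const.mul (Complex.ofRealCLM.contDiff.comp_contDiffOn hf)

theorem coeff_fibreFrameD (L : Coord n → ℝ) (α : Idx n) (a : Coord n → WickFibre n) (u : Coord n)
    (r : ℕ) (m : Idx n →₀ ℕ) :
    MvPowerSeries.coeff m (PowerSeries.coeff r (fibreFrameD L α a u)) =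
      frameD L α (fun w => MvPowerSeries.coeff m (PowerSeries.coeff r (a w))) u := by
  exact congrArg (MvPowerSeries.coeff m) (PowerSeries.coeff_mk r _)

theorem SmoothSeries.fibreFrameD (hU : IsOpen U) (hL : ContDiffOn ℝ ∞ L U)
    (hreg : ∀ u ∈ U, (vHessian L u).det ≠ 0) {a : Coord n → WickFibre n} (ha : SmoothSeries U a)
    (α : Idx n) : SmoothSeries U (fibreFrameD L α a) := fun r m => by
  simp only [coeff_fibreFrameD]
  exact contDiffOn_frameD hU hL hreg (ha r m) α

theorem SmoothSeries.hasFDerivAt (hU : IsOpen U) {a : Coord n → WickFibre n}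
    (ha : SmoothSeries U a) {u : Coord n} (hu : u ∈ U) (r : ℕ) (m : Idx n →₀ ℕ) :
    HasFDerivAt (fun w => MvPowerSeries.coeff m (PowerSeries.coeff r (a w)))
      (fderiv ℝ (fun w => MvPowerSeries.coeff m (PowerSeries.coeff r (a w))) u) u :=
  (((ha r m).contDiffAt (hU.mem_nhds hu)).differentiableAt (by simp)).hasFDerivAt

theorem wickFibre_ext {f g : WickFibre n}
    (h : ∀ r m, MvPowerSeries.coeff m (PowerSeries.coeff r f) =
      MvPowerSeries.coeff m (PowerSeries.coeff r g)) : f = g :=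
  PowerSeries.ext fun r => MvPowerSeries.ext fun m => h r m

theorem fibreFrameD_sub (hU : IsOpen U) {a b : Coord n → WickFibre n} (ha : SmoothSeries U a)
    (hb : SmoothSeries U b) (α : Idx n) {u : Coord n} (hu : u ∈ U) :
    fibreFrameD L α (fun w => a w - b w) u = fibreFrameD L α a u - fibreFrameD L α b u := by
  refine wickFibre_ext fun r m => ?_
  simp only [map_sub, coeff_fibreFrameD, frameD]
  erw [((ha.hasFDerivAt hU hu r m).sub (hb.hasFDerivAt hU hu r m)).fderiv]
  rfl

theorem fibreFrameD_sum (hU : IsOpen U) {ι : Type*} {s : Finset ι}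
    {a : ι → Coord n → WickFibre n} (ha : ∀ i ∈ s, SmoothSeries U (a i)) (α : Idx n)
    {u : Coord n} (hu : u ∈ U) :
    fibreFrameD L α (fun w => ∑ i ∈ s, a i w) u = ∑ i ∈ s, fibreFrameD L α (a i) u := by
  refine wickFibre_ext fun r m => ?_
  simp only [map_sum, coeff_fibreFrameD, frameD]
  rw [(HasFDerivAt.fun_sum fun i hi => (ha i hi).hasFDerivAt hU hu r m).fderiv, sum_apply]

theorem fibreFrameD_mul (hU : IsOpen U) {a b : Coord n → WickFibre n} (ha : SmoothSeries U a)
    (hb : SmoothSeries U b) (α : Idx n) {u : Coord n} (hu : u ∈ U) :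
    fibreFrameD L α (fun w => a w * b w) u =
      fibreFrameD L α a u * b u + a u * fibreFrameD L α b u := by
  refine wickFibre_ext fun r m => ?_
  simp only [map_add, PowerSeries.coeff_mul, MvPowerSeries.coeff_mul, map_sum, coeff_fibreFrameD,
    frameD, ← Finset.sum_add_distrib]
  rw [(HasFDerivAt.fun_sum fun x _ => HasFDerivAt.fun_sum fun y _ =>
    (ha.hasFDerivAt hU hu x.1 y.1).mul (hb.hasFDerivAt hU hu x.2 y.2)).fderiv]
  simp only [sum_apply, add_apply, smul_apply, smul_eq_mul]
  refine Finset.sum_congr rfl fun x _ => Finset.sum_congr rfl fun y _ => ?_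
  ring

theorem fibreFrameD_const (c : WickFibre n) (α : Idx n) (u : Coord n) :
    fibreFrameD L α (fun _ => c) u = 0 := by
  refine wickFibre_ext fun r m => ?_
  rw [coeff_fibreFrameD]
  simp [frameD]

theorem fibreFrameD_scalar (hU : IsOpen U) {f : Coord n → ℝ} (hf : ContDiffOn ℝ ∞ f U)
    (α : Idx n) {u : Coord n} (hu : u ∈ U) :
    fibreFrameD L α (fun w => scalar (f w : ℂ)) u = scalar ((frameD L α f u : ℝ) : ℂ) := by
  refine wickFibre_ext fun r m => ?_
  have h : HasFDerivAt f (fderiv ℝ f u) u :=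
    ((hf.contDiffAt (hU.mem_nhds hu)).differentiableAt (by simp)).hasFDerivAt
  have h' : HasFDerivAt (fun w => ((if r = 0 ∧ m = 0 then 1 else 0 : ℂ)) * (f w : ℂ))
      ((if r = 0 ∧ m = 0 then 1 else 0 : ℂ) • Complex.ofRealCLM.comp (fderiv ℝ f u)) u :=
    (Complex.ofRealCLM.hasFDerivAt.comp u h).const_mul _
  simp only [coeff_fibreFrameD, coeff_coeff_scalar, frameD]
  rw [h'.fderiv]
  rfl

theorem fibreFrameD_zDeriv (hU : IsOpen U) {a : Coord n → WickFibre n} (ha : SmoothSeries U a)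
    (α γ : Idx n) {u : Coord n} (hu : u ∈ U) :
    fibreFrameD L α (fun w => zDeriv γ (a w)) u = zDeriv γ (fibreFrameD L α a u) := by
  refine wickFibre_ext fun r m => ?_
  simp only [coeff_fibreFrameD, coeff_zDeriv, MvPowerSeries.coeff_pderiv, frameD]
  rw [((ha.hasFDerivAt hU hu r _).mul_const _).fderiv, smul_apply, smul_eq_mul, mul_comm]

theorem fibreFrameD_comm (hU : IsOpen U) (hL : ContDiffOn ℝ ∞ L U)
    (hreg : ∀ u ∈ U, (vHessian L u).det ≠ 0) {a : Coord n → WickFibre n} (ha : SmoothSeries U a)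
    (β α : Idx n) {u : Coord n} (hu : u ∈ U) :
    fibreFrameD L β (fibreFrameD L α a) u - fibreFrameD L α (fibreFrameD L β a) u =
      ∑ τ, scalar (structCoef L τ β α u : ℂ) * fibreFrameD L τ a u := by
  refine wickFibre_ext fun r m => ?_
  simp only [map_sub, map_sum, coeff_scalar_mul, MvPowerSeries.coeff_smul, coeff_fibreFrameD]
  have := frameD_comm hU hL hreg (ha r m) β α hu
  simp only [Complex.real_smul] at this
  exact this

/-- The linear vector field `A^τ_φ z^φ ∂ / ∂z^τ` of a matrix `A`, as an operator on series. -/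
def linearField (A : Matrix (Idx n) (Idx n) ℝ) (x : WickFibre n) : WickFibre n :=
  ∑ φ, ∑ τ, scalar (A τ φ : ℂ) * zVar φ * zDeriv τ x

theorem linearField_add (A B : Matrix (Idx n) (Idx n) ℝ) (x : WickFibre n) :
    linearField (A + B) x = linearField A x + linearField B x := by
  simp only [linearField, Matrix.add_apply, Complex.ofReal_add, scalar_add, add_mul,
    Finset.sum_add_distrib]

theorem linearField_sub (A B : Matrix (Idx n) (Idx n) ℝ) (x : WickFibre n) :
    linearField (A - B) x = linearField A x - linearField B x := by
  simp only [linearField, Matrix.sub_apply, Complex.ofReal_sub, scalar_sub, sub_mul,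
    Finset.sum_sub_distrib]

theorem linearField_sum_smul {ι : Type*} (s : Finset ι) (c : ι → ℝ)
    (A : ι → Matrix (Idx n) (Idx n) ℝ) (x : WickFibre n) :
    linearField (∑ i ∈ s, c i • A i) x = ∑ i ∈ s, scalar (c i : ℂ) * linearField (A i) x := by
  have h : ∀ τ φ, (∑ i ∈ s, c i • A i) τ φ = ∑ i ∈ s, c i * A i τ φ := fun τ φ => by
    simp [Matrix.sum_apply]
  simp only [linearField, h, Complex.ofReal_sum, Complex.ofReal_mul, scalar_sum, scalar_mul,
    Finset.sum_mul, Finset.mul_sum, mul_assoc]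
  calc _ = ∑ φ, ∑ i ∈ s, ∑ τ, _ := Finset.sum_congr rfl fun φ _ => Finset.sum_comm
    _ = _ := Finset.sum_comm

theorem linearField_map_sub (A : Matrix (Idx n) (Idx n) ℝ) (x y : WickFibre n) :
    linearField A (x - y) = linearField A x - linearField A y := by
  simp only [linearField, zDeriv_sub, mul_sub, Finset.sum_sub_distrib]

/-- The commutator of a derivation `d γ` with a linear vector field, in any commutative ring with
commuting operators `d α` that behave like the partial derivatives in variables `z α` and treat the
entries of `A` as constants. -/
theorem deriv_linearField {ι R : Type*} [Fintype ι] [DecidableEq ι] [CommRing R] (z : ι → R)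
    (d : ι → R →+ R) (hz : ∀ α β x, d α (z β * x) = (if α = β then x else 0) + z β * d α x)
    (hcomm : ∀ α β x, d α (d β x) = d β (d α x)) (A : ι → ι → R)
    (hA : ∀ τ φ γ x, d γ (A τ φ * x) = A τ φ * d γ x) (γ : ι) (x : R) :
    d γ (∑ φ, ∑ τ, A τ φ * z φ * d τ x) =
      ∑ τ, A τ γ * d τ x + ∑ φ, ∑ τ, A τ φ * z φ * d τ (d γ x) := by
  have h : ∀ φ τ, d γ (A τ φ * z φ * d τ x) =
      (if γ = φ then A τ φ * d τ x else 0) + A τ φ * z φ * d τ (d γ x) := by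
    intro φ τ
    rw [mul_assoc, hA, hz, hcomm γ τ]
    split_ifs <;> ring
  simp only [map_sum, h, Finset.sum_add_distrib]
  congr 1
  rw [Finset.sum_comm]
  simp

/-- Linear vector fields represent matrices contravariantly. -/
theorem sum_deriv_comm_of_linear {ι R : Type*} [Fintype ι] [DecidableEq ι] [CommRing R] (z : ι → R)
    (d : ι → R →+ R) (hz : ∀ α β x, d α (z β * x) = (if α = β then x else 0) + z β * d α x)
    (hcomm : ∀ α β x, d α (d β x) = d β (d α x)) (A B : ι → ι → R)
    (hA : ∀ τ φ γ x, d γ (A τ φ * x) = A τ φ * d γ x)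
    (hB : ∀ τ φ γ x, d γ (B τ φ * x) = B τ φ * d γ x) (x : R) :
    ∑ φ, ∑ τ, A τ φ * z φ * d τ (∑ φ, ∑ τ, B τ φ * z φ * d τ x) -
      ∑ φ, ∑ τ, B τ φ * z φ * d τ (∑ φ, ∑ τ, A τ φ * z φ * d τ x) =
      ∑ φ, ∑ τ, (∑ σ, B τ σ * A σ φ - ∑ σ, A τ σ * B σ φ) * z φ * d τ x := by
  have h : ∀ A B : ι → ι → R, (∀ τ φ γ x, d γ (B τ φ * x) = B τ φ * d γ x) →
      ∑ φ, ∑ τ, A τ φ * z φ * d τ (∑ φ, ∑ τ, B τ φ * z φ * d τ x) =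
      ∑ φ, ∑ τ, (∑ σ, B τ σ * A σ φ) * z φ * d τ x + ∑ p : ι × ι, ∑ q : ι × ι,
        A p.2 p.1 * B q.2 q.1 * (z p.1 * z q.1) * d p.2 (d q.2 x) := by
    intro A B hB
    simp only [deriv_linearField z d hz hcomm B hB, mul_add, Finset.sum_add_distrib,
      Fintype.sum_prod_type]
    congr 1
    · refine Finset.sum_congr rfl fun σ _ => ?_
      simp only [Finset.sum_mul, Finset.mul_sum]
      rw [Finset.sum_comm]
      refine Finset.sum_congr rfl fun τ _ => Finset.sum_congr rfl fun ρ _ => ?_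
      ring
    · refine Finset.sum_congr rfl fun σ _ => Finset.sum_congr rfl fun ρ _ => ?_
      simp only [Finset.mul_sum]
      refine Finset.sum_congr rfl fun φ _ => Finset.sum_congr rfl fun τ _ => ?_
      rw [hcomm τ ρ]
      ring
  -- The terms with two derivatives of `x` are symmetric in `A` and `B`.
  have hsymm : ∑ p : ι × ι, ∑ q : ι × ι,
        A p.2 p.1 * B q.2 q.1 * (z p.1 * z q.1) * d p.2 (d q.2 x) =
      ∑ p : ι × ι, ∑ q : ι × ι,
        B p.2 p.1 * A q.2 q.1 * (z p.1 * z q.1) * d p.2 (d q.2 x) := by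
    rw [Finset.sum_comm]
    refine Finset.sum_congr rfl fun p _ => Finset.sum_congr rfl fun q _ => ?_
    rw [hcomm]
    ring
  rw [h A B hB, h B A hA, hsymm, add_sub_add_right_eq_sub, ← Finset.sum_sub_distrib]
  refine Finset.sum_congr rfl fun φ _ => ?_
  rw [← Finset.sum_sub_distrib]
  refine Finset.sum_congr rfl fun τ _ => ?_
  ring

theorem zDeriv_linearField (A : Matrix (Idx n) (Idx n) ℝ) (γ : Idx n) (x : WickFibre n) :
    zDeriv γ (linearField A x) =
      ∑ τ, scalar (A τ γ : ℂ) * zDeriv τ x + linearField A (zDeriv γ x) :=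
  deriv_linearField zVar zDerivHom zDeriv_zVar_mul zDeriv_comm (fun τ φ => scalar (A τ φ : ℂ))
    (fun _ _ _ _ => zDeriv_scalar_mul _ _ _) γ x

theorem linearField_comm (A B : Matrix (Idx n) (Idx n) ℝ) (x : WickFibre n) :
    linearField A (linearField B x) - linearField B (linearField A x) =
      linearField (B * A - A * B) x := by
  refine (sum_deriv_comm_of_linear zVar zDerivHom zDeriv_zVar_mul zDeriv_comm
    (fun τ φ => scalar (A τ φ : ℂ)) (fun τ φ => scalar (B τ φ : ℂ))
    (fun _ _ _ _ => zDeriv_scalar_mul _ _ _) (fun _ _ _ _ => zDeriv_scalar_mul _ _ _) x).trans ?_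
  unfold linearField
  refine Finset.sum_congr rfl fun φ _ => Finset.sum_congr rfl fun τ _ => ?_
  have h : (scalar (((B * A - A * B) τ φ : ℝ) : ℂ) : WickFibre n) =
      ∑ σ, scalar (B τ σ : ℂ) * scalar (A σ φ : ℂ) -
        ∑ σ, scalar (A τ σ : ℂ) * scalar (B σ φ : ℂ) := by
    rw [Matrix.sub_apply, Matrix.mul_apply, Matrix.mul_apply]
    push_cast
    simp only [scalar_sub, scalar_sum, scalar_mul]
  rw [h]
  rfl

theorem SmoothSeries.linearField {A : Coord n → Matrix (Idx n) (Idx n) ℝ}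
    (hA : ∀ τ φ, ContDiffOn ℝ ∞ (fun u => A u τ φ) U) {a : Coord n → WickFibre n}
    (ha : SmoothSeries U a) : SmoothSeries U fun u => linearField (A u) (a u) :=
  SmoothSeries.sum fun φ _ => SmoothSeries.sum fun τ _ =>
    ((smoothSeries_scalar (hA τ φ)).mul (SmoothSeries.const _)).mul (ha.zDeriv τ)

theorem fibreFrameD_linearField (hU : IsOpen U) {A : Coord n → Matrix (Idx n) (Idx n) ℝ}
    (hA : ∀ τ φ, ContDiffOn ℝ ∞ (fun u => A u τ φ) U) {a : Coord n → WickFibre n}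
    (ha : SmoothSeries U a) (β : Idx n) {u : Coord n} (hu : u ∈ U) :
    fibreFrameD L β (fun w => linearField (A w) (a w)) u =
      linearField (Matrix.of fun τ φ => frameD L β (fun w => A w τ φ) u) (a u) +
        linearField (A u) (fibreFrameD L β a u) := by
  simp only [linearField]
  have h1 : ∀ τ φ, SmoothSeries U fun u => scalar (A u τ φ : ℂ) * zVar φ := fun τ φ =>
    (smoothSeries_scalar (hA τ φ)).mul (SmoothSeries.const _)
  rw [fibreFrameD_sum hU (fun φ _ => SmoothSeries.sum fun τ _ => (h1 τ φ).mul (ha.zDeriv τ)) β hu,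
    ← Finset.sum_add_distrib]
  refine Finset.sum_congr rfl fun φ _ => ?_
  rw [fibreFrameD_sum hU (fun τ _ => (h1 τ φ).mul (ha.zDeriv τ)) β hu, ← Finset.sum_add_distrib]
  refine Finset.sum_congr rfl fun τ _ => ?_
  rw [fibreFrameD_mul hU (h1 τ φ) (ha.zDeriv τ) β hu,
    fibreFrameD_mul hU (smoothSeries_scalar (hA τ φ)) (SmoothSeries.const _) β hu,
    fibreFrameD_scalar hU (hA τ φ) β hu, fibreFrameD_const, fibreFrameD_zDeriv hU ha β τ hu,
    mul_zero, add_zero]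
  rfl

/-! ### The covariant derivative of series-valued functions -/

theorem fibreCovD_eq (α : Idx n) (a : Coord n → WickFibre n) (u : Coord n) :
    fibreCovD L α a u = fibreFrameD L α a u - linearField (connMatrix L α u) (a u) := rfl

theorem SmoothSeries.fibreCovD (hU : IsOpen U) (hL : ContDiffOn ℝ ∞ L U)
    (hreg : ∀ u ∈ U, (vHessian L u).det ≠ 0) {a : Coord n → WickFibre n} (ha : SmoothSeries U a)
    (α : Idx n) : SmoothSeries U (fibreCovD L α a) :=
  (ha.fibreFrameD hU hL hreg α).sub
    (SmoothSeries.linearField (fun τ φ => contDiffOn_normalConn hU hL hreg τ φ α) ha)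

theorem fibreCovD_sum (hU : IsOpen U) {ι : Type*} {s : Finset ι}
    {a : ι → Coord n → WickFibre n} (ha : ∀ i ∈ s, SmoothSeries U (a i)) (α : Idx n)
    {u : Coord n} (hu : u ∈ U) :
    fibreCovD L α (fun w => ∑ i ∈ s, a i w) u = ∑ i ∈ s, fibreCovD L α (a i) u := by
  have h : linearField (connMatrix L α u) (∑ i ∈ s, a i u) =
      ∑ i ∈ s, linearField (connMatrix L α u) (a i u) := by
    simp only [linearField, zDeriv_sum, Finset.mul_sum]
    rw [Finset.sum_comm]
    refine (Finset.sum_congr rfl fun τ _ => Finset.sum_comm).trans ?_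
    rw [Finset.sum_comm]
    refine Finset.sum_congr rfl fun i _ => Finset.sum_comm
  simp only [fibreCovD_eq, Finset.sum_sub_distrib, fibreFrameD_sum hU ha α hu, h]

theorem fibreCovD_scalar_mul (hU : IsOpen U) {f : Coord n → ℝ} (hf : ContDiffOn ℝ ∞ f U)
    {a : Coord n → WickFibre n} (ha : SmoothSeries U a) (α : Idx n) {u : Coord n} (hu : u ∈ U) :
    fibreCovD L α (fun w => scalar (f w : ℂ) * a w) u =
      scalar ((frameD L α f u : ℝ) : ℂ) * a u + scalar (f u : ℂ) * fibreCovD L α a u := by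
  rw [fibreCovD_eq, fibreFrameD_mul hU (smoothSeries_scalar hf) ha α hu,
    fibreFrameD_scalar hU hf α hu, fibreCovD_eq, mul_sub, add_sub_assoc]
  congr 2
  simp only [linearField, zDeriv_scalar_mul, Finset.mul_sum]
  refine Finset.sum_congr rfl fun φ _ => Finset.sum_congr rfl fun τ _ => ?_
  ring

theorem fibreCovD_zsmul (hU : IsOpen U) (k : ℤ) {a : Coord n → WickFibre n}
    (ha : SmoothSeries U a) (α : Idx n) {u : Coord n} (hu : u ∈ U) :
    fibreCovD L α (fun w => k • a w) u = k • fibreCovD L α a u := by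
  have hk : ∀ x : WickFibre n, k • x = scalar ((k : ℝ) : ℂ) * x := fun x => by
    rw [zsmul_eq_mul]
    simp [scalar]
  simp only [hk]
  rw [fibreCovD_scalar_mul hU contDiffOn_const ha α hu]
  simp [frameD, scalar_zero]

/-- The commutator of a covariant derivative with `∂ / ∂z^γ`. -/
theorem fibreCovD_zDeriv (hU : IsOpen U) {a : Coord n → WickFibre n} (ha : SmoothSeries U a)
    (α γ : Idx n) {u : Coord n} (hu : u ∈ U) :
    fibreCovD L α (fun w => zDeriv γ (a w)) u = zDeriv γ (fibreCovD L α a u) +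
      ∑ τ, scalar (normalConn L τ γ α u : ℂ) * zDeriv τ (a u) := by
  rw [fibreCovD_eq, fibreCovD_eq, fibreFrameD_zDeriv hU ha α γ hu, zDeriv_sub, zDeriv_linearField]
  simp only [connMatrix, Matrix.of_apply]
  ring

/-- The Ricci identity on series-valued functions. -/
theorem fibreCovD_comm (hU : IsOpen U) (hL : ContDiffOn ℝ ∞ L U)
    (hreg : ∀ u ∈ U, (vHessian L u).det ≠ 0) {a : Coord n → WickFibre n} (ha : SmoothSeries U a)
    (β α : Idx n) {u : Coord n} (hu : u ∈ U) :
    fibreCovD L β (fibreCovD L α a) u - fibreCovD L α (fibreCovD L β a) u -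
        ∑ τ, scalar (structCoef L τ β α u : ℂ) * fibreCovD L τ a u =
      -linearField (curvMatrix L α β u) (a u) := by
  have h : ∀ β α, fibreCovD L β (fibreCovD L α a) u =
      fibreFrameD L β (fibreFrameD L α a) u - linearField (connMatrixD L β α u) (a u)
        - linearField (connMatrix L α u) (fibreFrameD L β a u)
        - linearField (connMatrix L β u) (fibreFrameD L α a u)
        + linearField (connMatrix L β u) (linearField (connMatrix L α u) (a u)) := by
    intro β α
    have hA : ∀ τ φ, ContDiffOn ℝ ∞ (fun u => connMatrix L α u τ φ) U := fun τ φ =>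
      contDiffOn_normalConn hU hL hreg τ φ α
    rw [fibreCovD_eq β]
    change fibreFrameD L β (fun w => fibreFrameD L α a w - linearField (connMatrix L α w) (a w)) u -
      linearField _ (fibreFrameD L α a u - linearField (connMatrix L α u) (a u)) = _
    rw [fibreFrameD_sub hU (ha.fibreFrameD hU hL hreg α) (SmoothSeries.linearField hA ha) β hu,
      fibreFrameD_linearField hU hA ha β hu, linearField_map_sub]
    change _ - (linearField (connMatrixD L β α u) (a u) + _) - _ = _
    ring
  have hc := fibreFrameD_comm hU hL hreg ha β α hu
  have hA := linearField_comm (connMatrix L β u) (connMatrix L α u) (a u)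
  rw [linearField_sub] at hA
  rw [h β α, h α β, curvMatrix_eq]
  simp only [linearField_sub, linearField_add, linearField_sum_smul, fibreCovD_eq, mul_sub,
    Finset.sum_sub_distrib, ← hc]
  linear_combination hA

end SeriesCalculus

/-! ### The connection on form-valued sections -/

section Forms

variable {n : ℕ} {L : Coord n → ℝ} {U : Set (Coord n)}

/-- The covariant derivative along `e_α` of the coefficients of a form. -/
def formCovD (L : Coord n → ℝ) (α : Idx n) (a : Coord n → WickForm n) (u : Coord n) : WickForm n :=
  fun I => fibreCovD L α (fun w => a w I) u

/-- The coefficients `e_α(N^τ_γ)` of `de^τ = e_α(N^τ_γ) e^α ∧ e^γ`. -/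
def dCoef (L : Coord n → ℝ) (u : Coord n) (τ α γ : Idx n) : WickFibre n :=
  scalar ((frameD L α (nFull L τ γ) u : ℝ) : ℂ)

theorem mem_sections_iff {a : Coord n → WickForm n} :
    a ∈ sections U ↔ ∀ I, SmoothSeries U fun u => a u I := Iff.rfl

theorem sum_mem_sections {ι : Type*} {s : Finset ι} {a : ι → Coord n → WickForm n}
    (ha : ∀ i ∈ s, a i ∈ sections U) : (fun u => ∑ i ∈ s, a i u) ∈ sections U := by
  refine mem_sections_iff.2 fun I => ?_
  simp only [Finset.sum_apply]
  exact SmoothSeries.sum fun i hi => ha i hi I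

theorem add_mem_sections {a b : Coord n → WickForm n} (ha : a ∈ sections U)
    (hb : b ∈ sections U) : (fun u => a u + b u) ∈ sections U :=
  mem_sections_iff.2 fun I => SmoothSeries.add (ha I) (hb I)

theorem smul_mem_sections {f : Coord n → WickFibre n} {a : Coord n → WickForm n}
    (hf : SmoothSeries U f) (ha : a ∈ sections U) : (fun u => f u • a u) ∈ sections U :=
  mem_sections_iff.2 fun I => SmoothSeries.mul hf (ha I)

theorem extMul_mem_sections {a : Coord n → WickForm n} (ha : a ∈ sections U) (α : Idx n) :
    (fun u => extMul α (a u)) ∈ sections U := by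
  refine mem_sections_iff.2 fun I => ?_
  simp only [extMul_apply]
  split_ifs
  · exact (mem_sections_iff.1 ha _).zsmul _
  · exact SmoothSeries.const 0

theorem intMul_mem_sections {a : Coord n → WickForm n} (ha : a ∈ sections U) (α : Idx n) :
    (fun u => intMul α (a u)) ∈ sections U := by
  refine mem_sections_iff.2 fun I => ?_
  simp only [intMul_apply]
  split_ifs
  · exact SmoothSeries.const 0
  · exact (mem_sections_iff.1 ha _).zsmul _

theorem zDeriv_mem_sections {a : Coord n → WickForm n} (ha : a ∈ sections U) (α : Idx n) :
    (fun u I => zDeriv α (a u I)) ∈ sections U :=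
  mem_sections_iff.2 fun I => (mem_sections_iff.1 ha I).zDeriv α

theorem formCovD_mem_sections (hU : IsOpen U) (hL : ContDiffOn ℝ ∞ L U)
    (hreg : ∀ u ∈ U, (vHessian L u).det ≠ 0) {a : Coord n → WickForm n} (ha : a ∈ sections U)
    (α : Idx n) : formCovD L α a ∈ sections U :=
  mem_sections_iff.2 fun I => (mem_sections_iff.1 ha I).fibreCovD hU hL hreg α

theorem smoothSeries_dCoef (hU : IsOpen U) (hL : ContDiffOn ℝ ∞ L U)
    (hreg : ∀ u ∈ U, (vHessian L u).det ≠ 0) (τ α γ : Idx n) :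
    SmoothSeries U fun u => dCoef L u τ α γ :=
  smoothSeries_scalar (contDiffOn_frameD hU hL hreg (contDiffOn_nFull hU hL hreg τ γ) α)

theorem dOp_apply (k : Idx n → Idx n → Idx n → WickFibre n) (x : WickForm n) :
    dOp k x = ∑ τ, ∑ α, ∑ γ, k τ α γ • extMul α (extMul γ (intMul τ x)) := by
  simp only [dOp, dGen, LinearMap.sum_apply, Module.End.mul_apply, LinearMap.smul_apply]

theorem dGen_apply (k : Idx n → Idx n → Idx n → WickFibre n) (τ : Idx n) (x : WickForm n) :
    dGen k τ x = ∑ α, ∑ γ, k τ α γ • extMul α (extMul γ x) := by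
  simp only [dGen, LinearMap.sum_apply, Module.End.mul_apply, LinearMap.smul_apply]

theorem dOp_mem_sections (hU : IsOpen U) (hL : ContDiffOn ℝ ∞ L U)
    (hreg : ∀ u ∈ U, (vHessian L u).det ≠ 0) {a : Coord n → WickForm n} (ha : a ∈ sections U) :
    (fun u => dOp (dCoef L u) (a u)) ∈ sections U := by
  simp only [dOp_apply]
  exact sum_mem_sections fun τ _ => sum_mem_sections fun α _ => sum_mem_sections fun γ _ =>
    smul_mem_sections (smoothSeries_dCoef hU hL hreg τ α γ)
      (extMul_mem_sections (extMul_mem_sections (intMul_mem_sections ha τ) γ) α)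

theorem nFull_inl_left (j : Fin n) (γ : Idx n) : nFull L (Sum.inl j) γ = fun _ => 0 := by
  funext u
  rcases γ with k | k <;> rfl

theorem nFull_inr_right (τ : Idx n) (b : Fin n) : nFull L τ (Sum.inr b) = fun _ => 0 := by
  funext u
  rcases τ with k | k <;> rfl

theorem dCoef_inl_left (u : Coord n) (i : Fin n) (α γ : Idx n) : dCoef L u (Sum.inl i) α γ = 0 := by
  rw [dCoef, nFull_inl_left]
  simp [frameD, scalar]

theorem dCoef_inr_right (u : Coord n) (τ α : Idx n) (b : Fin n) :
    dCoef L u τ α (Sum.inr b) = 0 := by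
  rw [dCoef, nFull_inr_right]
  simp [frameD, scalar]

theorem dGen_dCoef_inl (u : Coord n) (i : Fin n) : dGen (dCoef L u) (Sum.inl i) = 0 := by
  simp only [dGen, dCoef_inl_left, zero_smul, Finset.sum_const_zero]

theorem wedge_dCoframe (μ : Idx n) (u : Coord n) (x : WickForm n) :
    wedge (dCoframe L μ u) x = dGen (dCoef L u) μ x := by
  rcases μ with i | a
  · rw [dGen_dCoef_inl]
    funext K
    simp [wedge, dCoframe, formMul]
  · rw [dGen_apply, wedge, dCoframe]
    simp only [formMul_sum_left (fun x y z : WickFibre n => add_mul x y z),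
      formMul_twoForm_left (fun x y z : WickFibre n => add_mul x y z)]
    rw [Finset.sum_comm]
    refine Finset.sum_congr rfl fun α _ => ?_
    rw [Fintype.sum_sum_type]
    simp only [dCoef_inr_right, zero_smul, Finset.sum_const_zero, add_zero]
    refine Finset.sum_congr rfl fun i _ => ?_
    rw [← map_smul, ← map_smul]
    rfl

theorem intMul_monoForm (μ : Idx n) (I : Finset (Idx n)) :
    intMul μ (monoForm I 1 : WickForm n) =
      if μ ∈ I then idxSign μ I • monoForm (I.erase μ) 1 else 0 := by
  funext K
  rw [intMul_apply]
  by_cases hK : μ ∈ K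
  · rw [if_pos hK]
    split_ifs
    · rw [Pi.smul_apply, monoForm, Pi.single_eq_of_ne, smul_zero]
      rintro rfl
      exact Finset.notMem_erase μ I hK
    · rfl
  · rw [if_neg hK]
    split_ifs with hI
    · rw [Pi.smul_apply]
      by_cases h : K = I.erase μ
      · subst h
        rw [Finset.insert_erase hI, monoForm, monoForm, Pi.single_eq_same, Pi.single_eq_same]
        conv_rhs => rw [← Finset.insert_erase hI, idxSign_insert (Finset.notMem_erase μ I)]
        simp
      · rw [monoForm, monoForm, Pi.single_eq_of_ne h, Pi.single_eq_of_ne, smul_zero, smul_zero]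
        intro e
        exact h (by rw [← e, Finset.erase_insert hK])
    · rw [monoForm, Pi.single_eq_of_ne, smul_zero]
      · rfl
      · rintro rfl
        exact hI (Finset.mem_insert_self _ _)

/-- The Leibniz rule for `d(e^I)` says that `d` acts on constant-coefficient forms as `dOp`. -/
theorem dBasis_eq (I : Finset (Idx n)) (u : Coord n) :
    dBasis L I u = dOp (dCoef L u) (monoForm I 1) := by
  simp only [dBasis, dOp, LinearMap.sum_apply, Module.End.mul_apply, intMul_monoForm,
    wedge_dCoframe]
  rw [← Finset.sum_filter_add_sum_filter_not Finset.univ (· ∈ I),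
    Finset.sum_eq_zero (s := Finset.univ.filter fun μ => μ ∉ I), add_zero]
  · rw [Finset.filter_mem_eq_inter, Finset.univ_inter]
    refine Finset.sum_congr rfl fun μ hμ => ?_
    rw [if_pos hμ, map_zsmul]
    rfl
  · intro μ hμ
    rw [if_neg (Finset.mem_filter.1 hμ).2, map_zero]

theorem sum_monoForm (x : WickForm n) : ∑ I, monoForm I (x I) = x := Finset.univ_sum_single x

/-- The extended connection in terms of exterior and interior multiplication:
`D = e^α ∧ ∇_α + de^τ ∧ ι_τ`. -/
theorem extD_eq (a : Coord n → WickForm n) (u : Coord n) :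
    extD L a u = ∑ α, extMul α (formCovD L α a u) + dOp (dCoef L u) (a u) := by
  simp only [extD, Finset.sum_add_distrib, wedge_coframeForm, dBasis_eq]
  congr 1
  · rw [Finset.sum_comm]
    refine Finset.sum_congr rfl fun α _ => ?_
    rw [← map_sum]
    exact congrArg _ (sum_monoForm (formCovD L α a u))
  · conv_rhs => rw [← sum_monoForm (a u), map_sum]
    refine Finset.sum_congr rfl fun I _ => ?_
    rw [← map_smul, monoForm, monoForm, ← Pi.single_smul, smul_eq_mul, mul_one]

theorem fedosovDelta_eq (a : Coord n → WickForm n) (u : Coord n) :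
    fedosovDelta a u = ∑ γ, extMul γ fun I => zDeriv γ (a u I) := by
  simp only [fedosovDelta, wedge_coframeForm]

theorem extD_mem_sections (hU : IsOpen U) (hL : ContDiffOn ℝ ∞ L U)
    (hreg : ∀ u ∈ U, (vHessian L u).det ≠ 0) {a : Coord n → WickForm n} (ha : a ∈ sections U) :
    extD L a ∈ sections U := by
  rw [funext (extD_eq a)]
  exact add_mem_sections (sum_mem_sections fun α _ =>
    extMul_mem_sections (formCovD_mem_sections hU hL hreg ha α) α) (dOp_mem_sections hU hL hreg ha)

theorem fedosovDelta_mem_sections {a : Coord n → WickForm n} (ha : a ∈ sections U) :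
    fedosovDelta a ∈ sections U := by
  rw [funext (fedosovDelta_eq a)]
  exact sum_mem_sections fun γ _ => extMul_mem_sections (zDeriv_mem_sections ha γ) γ

theorem formCovD_sum (hU : IsOpen U) {ι : Type*} {s : Finset ι} {a : ι → Coord n → WickForm n}
    (ha : ∀ i ∈ s, a i ∈ sections U) (β : Idx n) {u : Coord n} (hu : u ∈ U) :
    formCovD L β (fun w => ∑ i ∈ s, a i w) u = ∑ i ∈ s, formCovD L β (a i) u := by
  funext I
  simp only [formCovD, Finset.sum_apply]
  exact fibreCovD_sum hU (fun i hi => ha i hi I) β hu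

theorem formCovD_add (hU : IsOpen U) {a b : Coord n → WickForm n} (ha : a ∈ sections U)
    (hb : b ∈ sections U) (β : Idx n) {u : Coord n} (hu : u ∈ U) :
    formCovD L β (fun w => a w + b w) u = formCovD L β a u + formCovD L β b u := by
  have h := formCovD_sum (L := L) hU (s := Finset.univ) (a := fun i : Bool => cond i a b)
    (by rintro (_ | _) -; exacts [hb, ha]) β hu
  simpa using h

theorem formCovD_extMul (hU : IsOpen U) {a : Coord n → WickForm n} (ha : a ∈ sections U)
    (β α : Idx n) {u : Coord n} (hu : u ∈ U) :
    formCovD L β (fun w => extMul α (a w)) u = extMul α (formCovD L β a u) := by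
  funext I
  simp only [formCovD, extMul_apply]
  split_ifs
  · exact fibreCovD_zsmul hU _ (ha _) β hu
  · simpa using fibreCovD_zsmul (L := L) hU 0 (ha I) β hu

theorem formCovD_intMul (hU : IsOpen U) {a : Coord n → WickForm n} (ha : a ∈ sections U)
    (β α : Idx n) {u : Coord n} (hu : u ∈ U) :
    formCovD L β (fun w => intMul α (a w)) u = intMul α (formCovD L β a u) := by
  funext I
  simp only [formCovD, intMul_apply]
  split_ifs
  · simpa using fibreCovD_zsmul (L := L) hU 0 (ha I) β hu
  · exact fibreCovD_zsmul hU _ (ha _) β hu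

theorem formCovD_scalar_smul (hU : IsOpen U) {f : Coord n → ℝ} (hf : ContDiffOn ℝ ∞ f U)
    {a : Coord n → WickForm n} (ha : a ∈ sections U) (β : Idx n) {u : Coord n} (hu : u ∈ U) :
    formCovD L β (fun w => (scalar (f w : ℂ) : WickFibre n) • a w) u =
      (scalar ((frameD L β f u : ℝ) : ℂ) : WickFibre n) • a u +
        (scalar (f u : ℂ) : WickFibre n) • formCovD L β a u := by
  funext I
  exact fibreCovD_scalar_mul hU hf (ha I) β hu

/-- The second derivatives `e_β(e_α(N^τ_γ))`. -/
def dCoefD (L : Coord n → ℝ) (u : Coord n) (β τ α γ : Idx n) : WickFibre n :=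
  scalar ((frameD L β (frameD L α (nFull L τ γ)) u : ℝ) : ℂ)

theorem formCovD_dOp (hU : IsOpen U) (hL : ContDiffOn ℝ ∞ L U)
    (hreg : ∀ u ∈ U, (vHessian L u).det ≠ 0) {a : Coord n → WickForm n} (ha : a ∈ sections U)
    (β : Idx n) {u : Coord n} (hu : u ∈ U) :
    formCovD L β (fun w => dOp (dCoef L w) (a w)) u =
      dOp (dCoefD L u β) (a u) + dOp (dCoef L u) (formCovD L β a u) := by
  have hk : ∀ τ α γ, ContDiffOn ℝ ∞ (frameD L α (nFull L τ γ)) U := fun τ α γ =>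
    contDiffOn_frameD hU hL hreg (contDiffOn_nFull hU hL hreg τ γ) α
  have hs : ∀ τ α γ, (fun w => dCoef L w τ α γ • extMul α (extMul γ (intMul τ (a w)))) ∈
      sections U := fun τ α γ =>
    smul_mem_sections (smoothSeries_dCoef hU hL hreg τ α γ)
      (extMul_mem_sections (extMul_mem_sections (intMul_mem_sections ha τ) γ) α)
  simp only [dOp_apply]
  rw [formCovD_sum hU (fun τ _ => sum_mem_sections fun α _ => sum_mem_sections fun γ _ =>
    hs τ α γ) β hu, ← Finset.sum_add_distrib]
  refine Finset.sum_congr rfl fun τ _ => ?_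
  rw [formCovD_sum hU (fun α _ => sum_mem_sections fun γ _ => hs τ α γ) β hu,
    ← Finset.sum_add_distrib]
  refine Finset.sum_congr rfl fun α _ => ?_
  rw [formCovD_sum hU (fun γ _ => hs τ α γ) β hu, ← Finset.sum_add_distrib]
  refine Finset.sum_congr rfl fun γ _ => ?_
  have h1 := intMul_mem_sections ha τ
  have h2 := extMul_mem_sections h1 γ
  have h3 := extMul_mem_sections h2 α
  refine (formCovD_scalar_smul hU (hk τ α γ) h3 β hu).trans ?_
  rw [formCovD_extMul hU h2 β α hu, formCovD_extMul hU h1 β γ hu, formCovD_intMul hU ha β τ hu]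
  rfl

theorem wickForm_eq_of_add_self_eq {x y : WickForm n} (h : x + x = y + y) : x = y := by
  funext I
  refine wickFibre_ext fun r m => ?_
  have h' := congrArg (fun z => MvPowerSeries.coeff m (PowerSeries.coeff r (z I))) h
  simp only [Pi.add_apply, map_add] at h'
  linear_combination h' / 2

/-- Contraction with the two-forms `e^β ∧ e^α` sees only the antisymmetric part. -/
theorem sum_extMul_extMul_add_self (X : Idx n → Idx n → WickForm n) :
    ∑ β, ∑ α, extMul β (extMul α (X β α)) + ∑ β, ∑ α, extMul β (extMul α (X β α)) =
      ∑ β, ∑ α, extMul β (extMul α (X β α - X α β)) := by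
  have h : ∑ β, ∑ α, extMul β (extMul α (X α β)) = -∑ β, ∑ α, extMul β (extMul α (X β α)) := by
    rw [Finset.sum_comm, ← Finset.sum_neg_distrib]
    refine Finset.sum_congr rfl fun β _ => ?_
    rw [← Finset.sum_neg_distrib]
    refine Finset.sum_congr rfl fun α _ => ?_
    exact LinearMap.congr_fun (extMul_anticomm α β) (X β α)
  simp only [map_sub, Finset.sum_sub_distrib, h, sub_neg_eq_add]

/-- The two-forms `de^τ` are given by the structure functions: `2 de^τ = -c^τ_{βα} e^β ∧ e^α`. -/
theorem dGen_add_self (hU : IsOpen U) (hL : ContDiffOn ℝ ∞ L U)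
    (hreg : ∀ u ∈ U, (vHessian L u).det ≠ 0) (τ : Idx n) {u : Coord n} (hu : u ∈ U)
    (x : WickForm n) :
    dGen (dCoef L u) τ x + dGen (dCoef L u) τ x =
      -∑ β, ∑ α, (scalar (structCoef L τ β α u : ℂ) : WickFibre n) • extMul β (extMul α x) := by
  have h : dGen (dCoef L u) τ x = ∑ β, ∑ α, extMul β (extMul α (dCoef L u τ β α • x)) := by
    simp only [dGen_apply, map_smul]
  rw [h, sum_extMul_extMul_add_self, ← Finset.sum_neg_distrib]
  refine Finset.sum_congr rfl fun β _ => ?_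
  rw [← Finset.sum_neg_distrib]
  refine Finset.sum_congr rfl fun α _ => ?_
  rw [structCoef_eq hU hL hreg τ β α hu, Complex.ofReal_sub, scalar_sub, ← sub_smul, map_smul,
    map_smul, ← neg_smul, neg_sub]
  rfl

/-- The identity `d² f = 0` for the functions `N^τ_γ`. -/
theorem sum_dCoefD (hU : IsOpen U) (hL : ContDiffOn ℝ ∞ L U)
    (hreg : ∀ u ∈ U, (vHessian L u).det ≠ 0) (τ γ : Idx n) {u : Coord n} (hu : u ∈ U) :
    ∑ β, ∑ α, dCoefD L u β τ α γ • (extMul β * extMul α) =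
      -∑ σ, dCoef L u τ σ γ • dGen (dCoef L u) σ := by
  refine LinearMap.ext fun x => wickForm_eq_of_add_self_eq ?_
  have hl : (∑ β, ∑ α, dCoefD L u β τ α γ • (extMul β * extMul α) :
      Module.End (WickFibre n) (WickForm n)) x =
      ∑ β, ∑ α, extMul β (extMul α (dCoefD L u β τ α γ • x)) := by
    simp only [LinearMap.sum_apply, LinearMap.smul_apply, Module.End.mul_apply, map_smul]
  have hr : (-∑ σ, dCoef L u τ σ γ • dGen (dCoef L u) σ :
      Module.End (WickFibre n) (WickForm n)) x =
      -∑ σ, dCoef L u τ σ γ • dGen (dCoef L u) σ x :=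
    congrArg Neg.neg (LinearMap.sum_apply Finset.univ _ x)
  rw [hl, hr, sum_extMul_extMul_add_self, ← neg_add, ← Finset.sum_add_distrib]
  simp only [← smul_add, dGen_add_self hU hL hreg _ hu, smul_neg, Finset.sum_neg_distrib, neg_neg,
    Finset.smul_sum]
  conv_rhs => rw [Finset.sum_comm]
  refine Finset.sum_congr rfl fun β _ => ?_
  conv_rhs => rw [Finset.sum_comm]
  refine Finset.sum_congr rfl fun α _ => ?_
  have h := frameD_comm hU hL hreg (contDiffOn_nFull hU hL hreg τ γ) β α hu
  have h' : dCoefD L u β τ α γ - dCoefD L u α τ β γ =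
      ∑ σ, dCoef L u τ σ γ * scalar (structCoef L σ β α u : ℂ) := by
    rw [dCoefD, dCoefD, ← scalar_sub, ← Complex.ofReal_sub, h]
    simp only [smul_eq_mul, Complex.ofReal_sum, Complex.ofReal_mul, scalar_sum, scalar_mul, dCoef,
      mul_comm]
  rw [← sub_smul, h', map_smul, map_smul, Finset.sum_smul]
  simp only [smul_smul]

/-- The form part of the square of the connection vanishes, as `d² e^τ = 0`. -/
theorem extMul_dOp_dCoefD_add (hU : IsOpen U) (hL : ContDiffOn ℝ ∞ L U)
    (hreg : ∀ u ∈ U, (vHessian L u).det ≠ 0) {u : Coord n} (hu : u ∈ U) (x : WickForm n) :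
    ∑ β, extMul β (dOp (dCoefD L u β) x) + dOp (dCoef L u) (dOp (dCoef L u) x) = 0 := by
  have h0 : ∀ τ α γ, dCoef L u τ α γ • dGen (dCoef L u) γ = 0 := by
    rintro τ α (i | b)
    · rw [dGen_dCoef_inl, smul_zero]
    · rw [dCoef_inr_right, zero_smul]
  have h := LinearMap.congr_fun (extMul_dOp_add_dOp_mul_dOp (dCoef L u) (dCoefD L u) h0
    fun τ γ => sum_dCoefD hU hL hreg τ γ hu) x
  rw [LinearMap.add_apply, LinearMap.sum_apply] at h
  exact h

/-! ### The square of the connection and its commutator with the Fedosov operator -/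

/-- The square of the connection is a second-order expression in the covariant derivatives; the
terms without derivatives cancel. -/
theorem extD_extD (hU : IsOpen U) (hL : ContDiffOn ℝ ∞ L U)
    (hreg : ∀ u ∈ U, (vHessian L u).det ≠ 0) {a : Coord n → WickForm n} (ha : a ∈ sections U)
    {u : Coord n} (hu : u ∈ U) :
    extD L (extD L a) u =
      ∑ β, ∑ α, extMul β (extMul α (formCovD L β (formCovD L α a) u)) +
        ∑ τ, dGen (dCoef L u) τ (formCovD L τ a u) := by
  have hD : ∀ α, formCovD L α a ∈ sections U := fun α => formCovD_mem_sections hU hL hreg ha α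
  have hcov : ∀ β, formCovD L β (extD L a) u =
      ∑ α, extMul α (formCovD L β (formCovD L α a) u) +
        (dOp (dCoefD L u β) (a u) + dOp (dCoef L u) (formCovD L β a u)) := by
    intro β
    rw [funext (extD_eq a), formCovD_add hU (sum_mem_sections fun α _ =>
      extMul_mem_sections (hD α) α) (dOp_mem_sections hU hL hreg ha) β hu,
      formCovD_sum hU (fun α _ => extMul_mem_sections (hD α) α) β hu,
      formCovD_dOp hU hL hreg ha β hu]
    refine congrArg (· + _) (Finset.sum_congr rfl fun α _ => ?_)
    exact formCovD_extMul hU (hD α) β α hu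
  -- First-order derivatives of `a` multiplied by the form operator combine to `de^β ∧ ∇_β`.
  have hgen : ∀ β, extMul β (dOp (dCoef L u) (formCovD L β a u)) +
      dOp (dCoef L u) (extMul β (formCovD L β a u)) =
      dGen (dCoef L u) β (formCovD L β a u) := fun β =>
    LinearMap.congr_fun (extMul_mul_dOp_add (dCoef L u) β) (formCovD L β a u)
  rw [extD_eq]
  simp only [hcov, map_add, map_sum, Finset.sum_add_distrib]
  rw [extD_eq a, map_add, map_sum, ← Finset.sum_congr rfl fun β _ => hgen β,
    Finset.sum_add_distrib]
  have h := extMul_dOp_dCoefD_add hU hL hreg hu (a u)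
  rw [eq_neg_of_add_eq_zero_left h]
  abel

/-- The square of the connection is the contraction with the curvature. -/
theorem extD_extD_add_self (hU : IsOpen U) (hL : ContDiffOn ℝ ∞ L U)
    (hreg : ∀ u ∈ U, (vHessian L u).det ≠ 0) {a : Coord n → WickForm n} (ha : a ∈ sections U)
    {u : Coord n} (hu : u ∈ U) :
    extD L (extD L a) u + extD L (extD L a) u = ∑ α, ∑ β, extMul α (extMul β
      fun I => linearField (curvMatrix L α β u) (a u I)) := by
  have hricci : ∀ β α, formCovD L β (formCovD L α a) u - formCovD L α (formCovD L β a) u =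
      ∑ τ, (scalar (structCoef L τ β α u : ℂ) : WickFibre n) • formCovD L τ a u -
        fun I => linearField (curvMatrix L α β u) (a u I) := by
    intro β α
    funext I
    have h := fibreCovD_comm hU hL hreg (ha I) β α hu
    simp only [Pi.sub_apply, Finset.sum_apply, Pi.smul_apply, smul_eq_mul]
    rw [sub_eq_iff_eq_add] at h
    refine Eq.trans h ?_
    rw [neg_add_eq_sub]
    rfl
  rw [extD_extD hU hL hreg ha hu, add_add_add_comm, sum_extMul_extMul_add_self,
    ← Finset.sum_add_distrib]
  simp only [dGen_add_self hU hL hreg _ hu, hricci, map_sub, map_sum, map_smul,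
    Finset.sum_sub_distrib, Finset.sum_neg_distrib]
  have hswap : ∑ β, ∑ α, ∑ τ, (scalar (structCoef L τ β α u : ℂ) : WickFibre n) •
      extMul β (extMul α (formCovD L τ a u)) = ∑ τ, ∑ β, ∑ α,
      (scalar (structCoef L τ β α u : ℂ) : WickFibre n) •
        extMul β (extMul α (formCovD L τ a u)) := by
    conv_rhs => rw [Finset.sum_comm]
    exact Finset.sum_congr rfl fun β _ => Finset.sum_comm
  rw [hswap, sub_add_eq_add_sub, add_neg_cancel, zero_sub, Finset.sum_comm,
    ← Finset.sum_neg_distrib]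
  refine Finset.sum_congr rfl fun α _ => ?_
  rw [← Finset.sum_neg_distrib]
  refine Finset.sum_congr rfl fun β _ => ?_
  exact (LinearMap.congr_fun (extMul_anticomm (R := WickFibre n) α β) _).symm

theorem zDeriv_dOp (γ : Idx n) (u : Coord n) (x : WickForm n) :
    (fun I => zDeriv γ (dOp (dCoef L u) x I)) = dOp (dCoef L u) fun I => zDeriv γ (x I) := by
  simp only [dOp_apply, Finset.sum_apply, Pi.smul_apply, smul_eq_mul]
  funext I
  simp only [zDeriv_sum, Finset.sum_apply, Pi.smul_apply, smul_eq_mul]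
  refine Finset.sum_congr rfl fun τ _ => Finset.sum_congr rfl fun α _ =>
    Finset.sum_congr rfl fun ρ _ => ?_
  rw [dCoef, zDeriv_scalar_mul]
  congr 1
  have h1 := extMul_map (zDerivHom γ) α (extMul ρ (intMul τ x))
  have h2 := extMul_map (zDerivHom γ) ρ (intMul τ x)
  have h3 := intMul_map (zDerivHom γ) τ x
  exact congrFun (h1.trans (congrArg _ (h2.trans (congrArg _ h3)))) I

/-- In the graded commutator with the Fedosov operator only the commutators of `∇_α` with
`∂ / ∂z^γ` and the differentials of the coframe survive. -/
theorem opComm_extD_fedosovDelta (hU : IsOpen U) {a : Coord n → WickForm n} (ha : a ∈ sections U)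
    {u : Coord n} (hu : u ∈ U) :
    opComm 1 1 (extD L) fedosovDelta a u =
      ∑ α, ∑ γ, extMul α (extMul γ (∑ τ, (scalar (normalConn L τ γ α u : ℂ) : WickFibre n) •
        fun I => zDeriv τ (a u I))) +
        ∑ τ, dGen (dCoef L u) τ fun I => zDeriv τ (a u I) := by
  have hz : ∀ γ, (fun u I => zDeriv γ (a u I)) ∈ sections U := zDeriv_mem_sections ha
  have h1 : extD L (fedosovDelta a) u =
      ∑ α, ∑ γ, extMul α (extMul γ (formCovD L α (fun u I => zDeriv γ (a u I)) u)) +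
        ∑ γ, dOp (dCoef L u) (extMul γ fun I => zDeriv γ (a u I)) := by
    rw [extD_eq, funext (fedosovDelta_eq a), map_sum]
    congr 1
    refine Finset.sum_congr rfl fun α _ => ?_
    rw [formCovD_sum hU (fun γ _ => extMul_mem_sections (hz γ) γ) α hu, map_sum]
    exact Finset.sum_congr rfl fun γ _ => congrArg _ (formCovD_extMul hU (hz γ) α γ hu)
  have h2 : fedosovDelta (extD L a) u =
      ∑ γ, ∑ α, extMul γ (extMul α fun I => zDeriv γ (formCovD L α a u I)) +
        ∑ γ, extMul γ (dOp (dCoef L u) fun I => zDeriv γ (a u I)) := by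
    rw [fedosovDelta_eq, ← Finset.sum_add_distrib]
    refine Finset.sum_congr rfl fun γ _ => ?_
    rw [← map_sum, ← map_add]
    congr 1
    rw [← zDeriv_dOp]
    funext I
    rw [extD_eq]
    simp only [Pi.add_apply, Finset.sum_apply, zDeriv_add, zDeriv_sum]
    refine congrArg (· + _) (Finset.sum_congr rfl fun α _ => ?_)
    exact congrFun (extMul_map (zDerivHom γ) α (formCovD L α a u)) I
  have hcomm : ∀ α γ, formCovD L α (fun u I => zDeriv γ (a u I)) u =
      (fun I => zDeriv γ (formCovD L α a u I)) +
        ∑ τ, (scalar (normalConn L τ γ α u : ℂ) : WickFibre n) • fun I => zDeriv τ (a u I) := by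
    intro α γ
    funext I
    simp only [Pi.add_apply, Finset.sum_apply, Pi.smul_apply, smul_eq_mul]
    exact fibreCovD_zDeriv hU (ha I) α γ hu
  have h3 : ∑ γ, ∑ α, extMul γ (extMul α fun I => zDeriv γ (formCovD L α a u I)) =
      -∑ α, ∑ γ, extMul α (extMul γ fun I => zDeriv γ (formCovD L α a u I)) := by
    rw [Finset.sum_comm, ← Finset.sum_neg_distrib]
    refine Finset.sum_congr rfl fun α _ => ?_
    rw [← Finset.sum_neg_distrib]
    refine Finset.sum_congr rfl fun γ _ => ?_
    exact LinearMap.congr_fun (extMul_anticomm γ α) _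
  have hgen : ∀ γ, extMul γ (dOp (dCoef L u) fun I => zDeriv γ (a u I)) +
      dOp (dCoef L u) (extMul γ fun I => zDeriv γ (a u I)) =
      dGen (dCoef L u) γ fun I => zDeriv γ (a u I) := fun γ =>
    LinearMap.congr_fun (extMul_mul_dOp_add (dCoef L u) γ) _
  have hop : opComm 1 1 (extD L) fedosovDelta a u =
      extD L (fedosovDelta a) u + fedosovDelta (extD L a) u := by
    simp [opComm]
  rw [hop, h1, h2, h3, ← Finset.sum_congr rfl fun γ _ => hgen γ]
  simp only [hcomm, map_add, Finset.sum_add_distrib]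
  abel

/-- The graded commutator of the connection with the Fedosov operator is the contraction with the
torsion. -/
theorem opComm_add_self (hU : IsOpen U) (hL : ContDiffOn ℝ ∞ L U)
    (hreg : ∀ u ∈ U, (vHessian L u).det ≠ 0) {a : Coord n → WickForm n} (ha : a ∈ sections U)
    {u : Coord n} (hu : u ∈ U) :
    opComm 1 1 (extD L) fedosovDelta a u + opComm 1 1 (extD L) fedosovDelta a u =
      -∑ α, ∑ β, extMul α (extMul β fun I =>
        ∑ τ, scalar (torsionCoef L τ α β u : ℂ) * zDeriv τ (a u I)) := by
  have hT : ∀ α β, (fun I => ∑ τ, scalar (torsionCoef L τ α β u : ℂ) * zDeriv τ (a u I)) =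
      ∑ τ, (scalar (normalConn L τ α β u : ℂ) : WickFibre n) • (fun I => zDeriv τ (a u I)) -
        ∑ τ, (scalar (normalConn L τ β α u : ℂ) : WickFibre n) • (fun I => zDeriv τ (a u I)) -
        ∑ τ, (scalar (structCoef L τ β α u : ℂ) : WickFibre n) • fun I => zDeriv τ (a u I) := by
    intro α β
    funext I
    simp only [Pi.sub_apply, Finset.sum_apply, Pi.smul_apply, smul_eq_mul, torsionCoef_eq,
      Complex.ofReal_sub, scalar_sub, sub_mul, Finset.sum_sub_distrib]
  have hswap : ∑ τ, ∑ β, ∑ α, (scalar (structCoef L τ β α u : ℂ) : WickFibre n) •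
      extMul β (extMul α fun I => zDeriv τ (a u I)) = ∑ β, ∑ α, extMul β (extMul α
        (∑ τ, (scalar (structCoef L τ β α u : ℂ) : WickFibre n) •
          fun I => zDeriv τ (a u I))) := by
    rw [Finset.sum_comm]
    refine Finset.sum_congr rfl fun β _ => ?_
    rw [Finset.sum_comm]
    simp only [map_sum, map_smul]
  have hflip : ∑ α, ∑ β, extMul α (extMul β fun I =>
        ∑ τ, scalar (torsionCoef L τ α β u : ℂ) * zDeriv τ (a u I)) =
      -∑ β, ∑ α, extMul β (extMul α fun I =>
        ∑ τ, scalar (torsionCoef L τ α β u : ℂ) * zDeriv τ (a u I)) := by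
    rw [Finset.sum_comm, ← Finset.sum_neg_distrib]
    refine Finset.sum_congr rfl fun β _ => ?_
    rw [← Finset.sum_neg_distrib]
    refine Finset.sum_congr rfl fun α _ => ?_
    exact LinearMap.congr_fun (extMul_anticomm α β) _
  rw [opComm_extD_fedosovDelta hU ha hu, add_add_add_comm, sum_extMul_extMul_add_self,
    ← Finset.sum_add_distrib, hflip, neg_neg]
  simp only [dGen_add_self hU hL hreg _ hu, Finset.sum_neg_distrib, hswap, hT]
  rw [← sub_eq_add_neg]
  simp only [← Finset.sum_sub_distrib, ← map_sub]

/-! ### The torsion and curvature elements -/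

theorem sum_comm_pair {κ ι M : Type*} [Fintype κ] [Fintype ι] [AddCommMonoid M]
    (f : κ → ι → ι → M) : ∑ k, ∑ α, ∑ β, f k α β = ∑ α, ∑ β, ∑ k, f k α β := by
  rw [Finset.sum_comm]
  exact Finset.sum_congr rfl fun α _ => Finset.sum_comm

theorem torsionElt_eq (u : Coord n) : torsionElt L u = ∑ α, ∑ β,
    (PowerSeries.C (linForm fun γ => ((∑ τ, 1 / 2 * theta L u γ τ * torsionCoef L τ α β u : ℝ) : ℂ))
      : WickFibre n) • wedge (coframeForm α) (coframeForm β) := by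
  have h := sum_comm_pair fun (k : Idx n × Idx n) (α β : Idx n) =>
    (scalar ((1 / 2 * theta L u k.1 k.2 * torsionCoef L k.2 α β u : ℝ) : ℂ) * zVar k.1 :
      WickFibre n) • wedge (coframeForm α) (coframeForm β)
  rw [Fintype.sum_prod_type] at h
  refine Eq.trans h (Finset.sum_congr rfl fun α _ => Finset.sum_congr rfl fun β _ => ?_)
  rw [← Finset.sum_smul, Fintype.sum_prod_type]
  congr 1
  simp only [linForm, map_sum, map_mul, Complex.ofReal_sum, Finset.sum_mul]
  rfl

theorem curvatureElt_eq (u : Coord n) : curvatureElt L u = ∑ α, ∑ β,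
    (PowerSeries.C (quadForm fun γ φ =>
      ((∑ τ, 1 / 4 * theta L u γ τ * curvMatrix L α β u τ φ : ℝ) : ℂ)) : WickFibre n) •
        wedge (coframeForm α) (coframeForm β) := by
  have h := sum_comm_pair fun (k : Idx n × Idx n × Idx n) (α β : Idx n) =>
    (scalar ((1 / 4 * theta L u k.1 k.2.2 * curvatureCoef L k.2.2 k.2.1 α β u : ℝ) : ℂ) *
      zVar k.1 * zVar k.2.1 : WickFibre n) • wedge (coframeForm α) (coframeForm β)
  simp only [Fintype.sum_prod_type (α₁ := Idx n)] at h
  refine Eq.trans h (Finset.sum_congr rfl fun α _ => Finset.sum_congr rfl fun β _ => ?_)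
  simp only [← Finset.sum_smul]
  congr 1
  simp only [quadForm, map_sum, map_mul, Complex.ofReal_sum, Finset.sum_mul, mul_assoc]
  rfl

theorem torsionElt_mem_sections (hU : IsOpen U) (hL : ContDiffOn ℝ ∞ L U)
    (hreg : ∀ u ∈ U, (vHessian L u).det ≠ 0) : torsionElt L ∈ sections U :=
  sum_mem_sections fun γ _ => sum_mem_sections fun τ _ => sum_mem_sections fun α _ =>
    sum_mem_sections fun β _ => smul_mem_sections
      ((smoothSeries_scalar ((contDiffOn_const.mul (contDiffOn_theta hU hL γ τ)).mul
        (contDiffOn_torsionCoef hU hL hreg τ α β))).mul (SmoothSeries.const _))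
      (mem_sections_iff.2 fun _ => SmoothSeries.const _)

theorem curvatureElt_mem_sections (hU : IsOpen U) (hL : ContDiffOn ℝ ∞ L U)
    (hreg : ∀ u ∈ U, (vHessian L u).det ≠ 0) : curvatureElt L ∈ sections U :=
  sum_mem_sections fun γ _ => sum_mem_sections fun φ _ => sum_mem_sections fun τ _ =>
    sum_mem_sections fun α _ => sum_mem_sections fun β _ => smul_mem_sections
      (((smoothSeries_scalar ((contDiffOn_const.mul (contDiffOn_theta hU hL γ τ)).mul
        (contDiffOn_curvatureCoef hU hL hreg τ φ α β))).mul (SmoothSeries.const _)).mul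
          (SmoothSeries.const _))
      (mem_sections_iff.2 fun _ => SmoothSeries.const _)

/-- The torsion element acts by the Wick commutator as the contraction with the torsion. -/
theorem adWick_torsionElt (hU : IsOpen U) (hL : ContDiffOn ℝ ∞ L U)
    (hreg : ∀ u ∈ U, (vHessian L u).det ≠ 0) (a : Coord n → WickForm n) {u : Coord n}
    (hu : u ∈ U) :
    adWick L (torsionElt L) a u = (vVar n * scalar (Complex.I / 2)) • ∑ α, ∑ β,
      extMul α (extMul β fun I => ∑ τ, scalar (torsionCoef L τ α β u : ℂ) * zDeriv τ (a u I)) := by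
  rw [adWick_twoForm L _ a u _ (torsionElt_eq u)]
  simp only [Finset.smul_sum, ← map_smul]
  refine Finset.sum_congr rfl fun α _ => Finset.sum_congr rfl fun β _ => ?_
  congr 2
  funext I
  have h : ∀ τ, 2 * (1 / 2) * torsionCoef L τ α β u = torsionCoef L τ α β u := fun τ => by ring
  rw [wickMul_linForm_sub]
  simp only [sum_wickTensor_mul_theta hU hL hreg hu, h]
  exact (mul_assoc _ _ _).symm

/-- The curvature element acts by the Wick commutator as the contraction with the curvature. -/
theorem adWick_curvatureElt (hU : IsOpen U) (hL : ContDiffOn ℝ ∞ L U)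
    (hreg : ∀ u ∈ U, (vHessian L u).det ≠ 0) (a : Coord n → WickForm n) {u : Coord n}
    (hu : u ∈ U) :
    adWick L (curvatureElt L) a u = (vVar n * scalar (Complex.I / 2)) • ∑ α, ∑ β,
      extMul α (extMul β fun I => linearField (curvMatrix L α β u) (a u I)) := by
  rw [adWick_twoForm L _ a u _ (curvatureElt_eq u)]
  simp only [Finset.smul_sum, ← map_smul]
  refine Finset.sum_congr rfl fun α _ => Finset.sum_congr rfl fun β _ => ?_
  congr 2
  funext I
  have hS : ∀ γ φ, ∑ τ, 1 / 4 * theta L u γ τ * curvMatrix L α β u τ φ =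
      1 / 4 * (thetaMatrix L u * curvMatrix L α β u) γ φ := fun γ φ => by
    rw [Matrix.mul_apply, Finset.mul_sum]
    exact Finset.sum_congr rfl fun τ _ => mul_assoc _ _ _
  rw [wickMul_quadForm_sub]
  · have hhalf : ∀ τ φ, (scalar ((2 * (1 / 4) * curvMatrix L α β u τ φ : ℝ) : ℂ) : WickFibre n) =
        scalar (1 / 2) * scalar (curvMatrix L α β u τ φ : ℂ) := fun τ φ => by
      rw [← scalar_mul]
      congr 1
      push_cast
      ring
    have hI : (scalar (Complex.I / 2) : WickFibre n) = scalar Complex.I * scalar (1 / 2) := by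
      rw [← scalar_mul]
      congr 1
      ring
    simp only [sum_wickTensor_mul_theta hU hL hreg hu, hhalf]
    rw [Pi.smul_apply, smul_eq_mul, hI, linearField, Finset.sum_comm]
    simp only [mul_assoc, Finset.mul_sum]
  · intro γ φ
    have h := congrFun (congrFun (theta_curvature_symm hU hL hreg hu α β) φ) γ
    rw [Matrix.transpose_apply] at h
    rw [hS, hS, h]
  · intro ρ δ
    simp only [hS]
    exact sum_wickTensor_mul_curvature hU hL hreg hu _ α β ρ δ

theorem seriesMul_opComm (hU : IsOpen U) (hL : ContDiffOn ℝ ∞ L U)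
    (hreg : ∀ u ∈ U, (vHessian L u).det ≠ 0) {a : Coord n → WickForm n} (ha : a ∈ sections U)
    {u : Coord n} (hu : u ∈ U) :
    seriesMul (vVar n) (opComm 1 1 (extD L) fedosovDelta a) u =
      seriesMul (scalar Complex.I) (adWick L (torsionElt L) a) u := by
  have hI : (scalar Complex.I * (vVar n * scalar (Complex.I / 2)) : WickFibre n) +
      scalar Complex.I * (vVar n * scalar (Complex.I / 2)) = -vVar n := by
    have : (scalar Complex.I * scalar (Complex.I / 2) + scalar Complex.I * scalar (Complex.I / 2) :
        WickFibre n) = -1 := by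
      rw [← scalar_mul, ← scalar_add, ← scalar_one, ← scalar_neg]
      congr 1
      linear_combination Complex.I_mul_I
    linear_combination vVar n * this
  change vVar n • opComm 1 1 (extD L) fedosovDelta a u =
    (scalar Complex.I : WickFibre n) • adWick L (torsionElt L) a u
  refine wickForm_eq_of_add_self_eq ?_
  rw [← smul_add, opComm_add_self hU hL hreg ha hu, adWick_torsionElt hU hL hreg a hu, smul_smul,
    ← add_smul, hI, smul_neg, neg_smul]

theorem seriesMul_extD_extD (hU : IsOpen U) (hL : ContDiffOn ℝ ∞ L U)
    (hreg : ∀ u ∈ U, (vHessian L u).det ≠ 0) {a : Coord n → WickForm n} (ha : a ∈ sections U)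
    {u : Coord n} (hu : u ∈ U) :
    seriesMul (vVar n) (extD L (extD L a)) u =
      seriesMul (scalar (-Complex.I)) (adWick L (curvatureElt L) a) u := by
  have hI : (scalar (-Complex.I) * (vVar n * scalar (Complex.I / 2)) : WickFibre n) +
      scalar (-Complex.I) * (vVar n * scalar (Complex.I / 2)) = vVar n := by
    have : (scalar (-Complex.I) * scalar (Complex.I / 2) +
        scalar (-Complex.I) * scalar (Complex.I / 2) : WickFibre n) = 1 := by
      rw [← scalar_mul, ← scalar_add, ← scalar_one]
      congr 1
      linear_combination -Complex.I_mul_I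
    linear_combination vVar n * this
  change vVar n • extD L (extD L a) u =
    (scalar (-Complex.I) : WickFibre n) • adWick L (curvatureElt L) a u
  refine wickForm_eq_of_add_self_eq ?_
  rw [← smul_add, extD_extD_add_self hU hL hreg ha hu, adWick_curvatureElt hU hL hreg a hu,
    smul_smul, ← add_smul, hI]

end Forms

end LagrangeFedosov

end

theorem mainTheorem6 {n : ℕ} {V : Type*} [TopologicalSpace V] [ChartedSpace (LagrangeFedosov.Coord n) V]
    [IsManifold 𝓘(ℝ, LagrangeFedosov.Coord n) ∞ V]
    (φ : OpenPartialHomeomorph V (LagrangeFedosov.Coord n))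
    (hφ : φ ∈ IsManifold.maximalAtlas 𝓘(ℝ, LagrangeFedosov.Coord n) ∞ V)
    (Lag : V → ℝ) (hLag : ContMDiffOn 𝓘(ℝ, LagrangeFedosov.Coord n) 𝓘(ℝ, ℝ) ∞ Lag φ.source)
    (L : LagrangeFedosov.Coord n → ℝ) (hL : L = Lag ∘ φ.symm)
    (hreg : ∀ u ∈ φ.target, (LagrangeFedosov.vHessian L u).det ≠ 0) :
    -- the operators act on sections, and the torsion and curvature elements are sections
    (∀ a ∈ LagrangeFedosov.sections φ.target,
      LagrangeFedosov.extD L a ∈ LagrangeFedosov.sections φ.target ∧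
      LagrangeFedosov.fedosovDelta a ∈ LagrangeFedosov.sections φ.target) ∧
    LagrangeFedosov.torsionElt L ∈ LagrangeFedosov.sections φ.target ∧
    LagrangeFedosov.curvatureElt L ∈ LagrangeFedosov.sections φ.target ∧
    -- `[D, δ] = (i/v) ad_Wick(T)`: multiplication by `v` is injective, so this is `v [D, δ] = i ad_Wick(T)`
    (∀ a ∈ LagrangeFedosov.sections φ.target, ∀ u ∈ φ.target,
      LagrangeFedosov.seriesMul (LagrangeFedosov.vVar n)
          (LagrangeFedosov.opComm 1 1 (LagrangeFedosov.extD L) LagrangeFedosov.fedosovDelta a) u =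
        LagrangeFedosov.seriesMul (LagrangeFedosov.scalar Complex.I)
          (LagrangeFedosov.adWick L (LagrangeFedosov.torsionElt L) a) u) ∧
    -- `D² = -(i/v) ad_Wick(R)`
    (∀ a ∈ LagrangeFedosov.sections φ.target, ∀ u ∈ φ.target,
      LagrangeFedosov.seriesMul (LagrangeFedosov.vVar n)
          (LagrangeFedosov.extD L (LagrangeFedosov.extD L a)) u =
        LagrangeFedosov.seriesMul (LagrangeFedosov.scalar (-Complex.I))
          (LagrangeFedosov.adWick L (LagrangeFedosov.curvatureElt L) a) u) := by
  have hU : IsOpen φ.target := φ.open_target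
  have hsm : ContDiffOn ℝ ∞ L φ.target := by
    rw [hL, ← contMDiffOn_iff_contDiffOn]
    exact hLag.comp (contMDiffOn_symm_of_mem_maximalAtlas hφ) fun u hu => φ.map_target hu
  exact ⟨fun a ha => ⟨LagrangeFedosov.extD_mem_sections hU hsm hreg ha,
      LagrangeFedosov.fedosovDelta_mem_sections ha⟩,
    LagrangeFedosov.torsionElt_mem_sections hU hsm hreg,
    LagrangeFedosov.curvatureElt_mem_sections hU hsm hreg,
    fun a ha u hu => LagrangeFedosov.seriesMul_opComm hU hsm hreg ha hu,
    fun a ha u hu => LagrangeFedosov.seriesMul_extD_extD hU hsm hreg ha hu⟩
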